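/- All graphs are finite, simple and undirected. A connected 4-regular planar graph $G$ *admits a realization as a system of circles* if there is a finite set of circles in the plane such that the points lying on at least two of the circles (crossing and touching points) are in bijection with the vertices of $G$, and the arcs into which these points cut the circles are in bijection with the edges of $G$, the arc of an edge $uv$ having the points of $u$ and $v$ as its two endpoints. A *loop-subgraph* is obtained from a connected 4-regular planar graph $H$ by replacing one edge $ab$ of $H$ by a path $a,r,b$ with a new vertex $r$, its *root*. A *gadget* with endpoints $v_1,v_2$ consists of vertices $v_1,v_2,w$, two disjoint loop-subgraphs with roots $w_1,w_2$, and the edges $v_iw$, $w_iw$, $v_iw_i$ for $i=1,2$. An *augmented octahedron* is obtained from the octahedron graph as follows. For each edge $e=uv$ choose an integer $m_e\ge 2$ and replace $e$ by a path $u,z_1,\dots,z_{4m_e},v$. Partition $\{z_1,\dots,z_{4m_e}\}$ into $m_e$ quadruples; for each quadruple $z_a,z_b,z_c,z_d$ with $a<b<c<d$ attach a pair of gadgets, one with endpoints $z_a,z_d$ and one with endpoints $z_b,z_c$. The partition must be such that the gadgets can be distributed to the two sides of the path without two gadgets on the same side having interleaving endpoints, and such that some two of the quadruples, $a<b<c<d$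 and $a'<b'<c'<d'$, satisfy $a<b<a'<b'<c<d<c'<d'$. (For $m_e=2$ the gadgets thus join $z_1z_6$, $z_2z_5$, $z_3z_8$, $z_4z_7$.) The loop-subgraphs in the gadgets may be chosen arbitrarily and independently. **Theorem.** There is an infinite class of connected 4-regular planar graphs that admit no realization as a system of circles. More precisely: 1. Every augmented octahedron is a connected 4-regular planar graph that admits no realization as a system of circles. 2. If every loop-subgraph comes from the octahedron, then by varying the number of pairs one obtains infinitely many such graphs: for each $n\ge 0$ there is an augmented octahedron with $n+2$ pairs of gadgets attached to each edge such that these graphs are pairwise non-isomorphic. 3. With exactly two pairs of gadgets attached to each edge, by varying the loop-subgraphs one also obtains infinitely many such graphs: there are connected 4-regular planar graphs $H_0,H_1,\dots$, each with a chosen edge, such that the augmented octahedra with two pairs on each edge in which every loop-subgraph comes from $H_n$ are pairwise non-isomorphic for $n=0,1,\dots$. -/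

import Mathlib

/-- The Euclidean plane. -/
abbrev Plane : Type := EuclideanSpace ℝ (Fin 2)

/-! ### Planar graphs -/

/-- `G` is planar: it can be drawn in the plane with vertices as distinct points and edges as simple
arcs (injective continuous images of `[0,1]`) joining the points of their two ends, such that an arc
contains no other vertex point, and two different arcs meet only in points of common end
vertices. -/
def SimpleGraph.IsPlanar {V : Type*} (G : SimpleGraph V) : Prop :=
  ∃ (pt : V → Plane) (arc : G.edgeSet → C(unitInterval, Plane)),
    Function.Injective pt ∧
    (∀ e, Function.Injective (arc e)) ∧
    (∀ e, ({arc e 0, arc e 1} : Set Plane) = pt '' {v | v ∈ e.1}) ∧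
    (∀ e t v, arc e t = pt v → v ∈ e.1) ∧
    (∀ e e' t t', arc e t = arc e' t' → e ≠ e' → ∃ v, v ∈ e.1 ∧ v ∈ e'.1 ∧ arc e t = pt v)

/-- Every vertex has exactly four neighbours. -/
def SimpleGraph.IsFourRegular {V : Type*} (G : SimpleGraph V) : Prop :=
  ∀ v, (G.neighborSet v).ncard = 4

/-! ### Systems of circles -/

/-- The points common to at least two of the circles (crossing points and touching points). -/
def meetingPoints (S : Set (EuclideanGeometry.Sphere Plane)) : Set Plane :=
  {x | ∃ c ∈ S, ∃ c' ∈ S, c ≠ c' ∧ x ∈ c ∧ x ∈ c'}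

/-- The open arcs into which the circles are cut by the meeting points: the connected components
of each circle minus the meeting points. (A circle without meeting points counts as one arc.) -/
def circleArcs (S : Set (EuclideanGeometry.Sphere Plane)) : Set (Set Plane) :=
  {A | ∃ c ∈ S, ∃ x ∈ (c : Set Plane) \ meetingPoints S,
    A = connectedComponentIn ((c : Set Plane) \ meetingPoints S) x}

/-- `G` has a realization as a system of circles: there is a finite set of circles (of positive
radius) whose meeting points are, bijectively, the vertices of `G`, and whose arcs between meeting
points are, bijectively, the edges of `G`, where the boundary points of the arc of an edge are the
points of its two ends. -/
def SimpleGraph.HasCircleRealization {V : Type*} (G : SimpleGraph V) : Prop :=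
  ∃ S : Set (EuclideanGeometry.Sphere Plane), S.Finite ∧ (∀ c ∈ S, 0 < c.radius) ∧
    ∃ pt : V → Plane, Function.Injective pt ∧ Set.range pt = meetingPoints S ∧
      ∃ φ : G.edgeSet ≃ circleArcs S,
        ∀ e, closure (φ e : Set Plane) \ (φ e : Set Plane) = pt '' {v | v ∈ e.1}

/-- A finite connected 4-regular planar graph without a realization as a system of circles. -/
structure IsCircleCounterexample {V : Type*} (G : SimpleGraph V) : Prop where
  finite : Finite V
  connected : G.Connected
  regular : G.IsFourRegular
  planar : G.IsPlanar
  not_realizable : ¬ G.HasCircleRealization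

/-! ### The octahedron -/

/-- The octahedron graph: `i` and `j` are non-adjacent exactly if they are equal or antipodal,
the antipodal pairs being `{0,5}`, `{1,4}`, `{2,3}`. -/
def octahedron : SimpleGraph (Fin 6) where
  Adj i j := i ≠ j ∧ (i : ℕ) + (j : ℕ) ≠ 5
  symm := ⟨fun _ _ h => ⟨h.1.symm, fun h' => h.2 (by omega)⟩⟩
  loopless := ⟨fun _ h => h.1 rfl⟩

/-- The twelve edges of the octahedron, each directed from its smaller to its larger end. -/
abbrev OctEdge : Type := {p : Fin 6 × Fin 6 // p.1 < p.2 ∧ octahedron.Adj p.1 p.2}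

/-! ### Loop-subgraphs and attachment of gadgets -/

/-- A graph with two marked vertices `a`, `b` (meant to be joined by an edge). The loop-subgraph it
yields is obtained by replacing the edge `ab` by a path `a, r, b` with a new vertex `r`. -/
structure LoopPiece where
  V : Type
  graph : SimpleGraph V
  a : V
  b : V

/-- The piece is a finite connected 4-regular planar graph with a marked edge. -/
structure LoopPiece.Admissible (L : LoopPiece) : Prop where
  finite : Finite L.V
  connected : L.graph.Connected
  regular : L.graph.IsFourRegular
  planar : L.graph.IsPlanar
  adj : L.graph.Adj L.a L.b

/-- The octahedron with a marked edge. -/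
def octLoop : LoopPiece := ⟨Fin 6, octahedron, 0, 1⟩

/-- A pair of gadgets has four endpoints `0 < 1 < 2 < 3` in the order of the path; its outer gadget
(index `0`) joins `0` to `3` and its inner gadget (index `1`) joins `1` to `2`. `slot t s` is end
`s` of gadget `t`. -/
def slot : Fin 2 → Fin 2 → Fin 4 := ![![0, 3], ![1, 2]]

/-- A way to attach `m` pairs of gadgets along a path with `4 * m` internal vertices: each internal
vertex is an endpoint of exactly one gadget, the two gadgets of a pair are nested, the gadgets can
be placed on the two sides of the path without crossings, and two of the pairs, `p` and `q`,
are interlaced in the order `p p q q p p q q`. For `m = 2` the gadgets thus join, up to the names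
of the pairs, `z₁` to `z₆`, `z₂` to `z₅`, `z₃` to `z₈` and `z₄` to `z₇`. -/
structure Attachment (m : ℕ) where
  pos : Fin m × Fin 4 → Fin (4 * m)
  bijective : Function.Bijective pos
  nested : ∀ p, StrictMono fun t => pos (p, t)
  noncrossing : ∃ side : Fin m → Fin 2 → Bool, ∀ p t p' t', side p t = side p' t' →
    ¬ (pos (p, slot t 0) < pos (p', slot t' 0) ∧ pos (p', slot t' 0) < pos (p, slot t 1) ∧
      pos (p, slot t 1) < pos (p', slot t' 1))
  interlaced : ∃ p q, pos (p, 1) < pos (q, 0) ∧ pos (q, 1) < pos (p, 2) ∧ pos (p, 3) < pos (q, 2)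

/-! ### The augmented octahedron -/

section
variable (m : OctEdge → ℕ) (A : ∀ e, Attachment (m e))
  (L : ∀ e, Fin (m e) → Fin 2 → Fin 2 → LoopPiece)

/-- Vertices of the augmented octahedron: octahedron vertices; the internal vertices `path e i` of
the path that replaces the edge `e`; and, for gadget `t` of pair `p` on `e`, the middle vertex `w`
(`hub e p t`), the vertices `w₁`, `w₂` (`root e p t s`, the degree-2 vertices of the
loop-subgraphs), and the other vertices `loop e p t s x` of the two loop-subgraphs. The
endpoints `v₁`, `v₂` of the gadget are path vertices. -/
inductive AugVertex : Type
  | oct (v : Fin 6)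
  | path (e : OctEdge) (i : Fin (4 * m e))
  | hub (e : OctEdge) (p : Fin (m e)) (t : Fin 2)
  | root (e : OctEdge) (p : Fin (m e)) (t s : Fin 2)
  | loop (e : OctEdge) (p : Fin (m e)) (t s : Fin 2) (x : (L e p t s).V)

/-- The edges of the augmented octahedron, each listed in at least one direction. -/
inductive AugEdge : AugVertex m L → AugVertex m L → Prop
  | first (e : OctEdge) (i : Fin (4 * m e)) (h : (i : ℕ) = 0) : AugEdge (.oct e.1.1) (.path e i)
  | step (e : OctEdge) (i j : Fin (4 * m e)) (h : (i : ℕ) + 1 = j) :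
      AugEdge (.path e i) (.path e j)
  | last (e : OctEdge) (i : Fin (4 * m e)) (h : (i : ℕ) + 1 = 4 * m e) :
      AugEdge (.path e i) (.oct e.1.2)
  | endHub (e : OctEdge) (p : Fin (m e)) (t s : Fin 2) :
      AugEdge (.path e ((A e).pos (p, slot t s))) (.hub e p t)
  | endRoot (e : OctEdge) (p : Fin (m e)) (t s : Fin 2) :
      AugEdge (.path e ((A e).pos (p, slot t s))) (.root e p t s)
  | rootHub (e : OctEdge) (p : Fin (m e)) (t s : Fin 2) :
      AugEdge (.root e p t s) (.hub e p t)
  | rootA (e : OctEdge) (p : Fin (m e)) (t s : Fin 2) :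
      AugEdge (.root e p t s) (.loop e p t s (L e p t s).a)
  | rootB (e : OctEdge) (p : Fin (m e)) (t s : Fin 2) :
      AugEdge (.root e p t s) (.loop e p t s (L e p t s).b)
  | inner (e : OctEdge) (p : Fin (m e)) (t s : Fin 2) (x y : (L e p t s).V)
      (h : (L e p t s).graph.Adj x y) (hne : s(x, y) ≠ s((L e p t s).a, (L e p t s).b)) :
      AugEdge (.loop e p t s x) (.loop e p t s y)

/-- The augmented octahedron: each edge `e` of the octahedron is replaced by a path with `4 * m e`
internal vertices, along which `m e` pairs of gadgets are attached according to `A e`; the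
loop-subgraph at end `s` of gadget `t` of pair `p` on `e` comes from the piece `L e p t s`. -/
def augGraph : SimpleGraph (AugVertex m L) :=
  SimpleGraph.fromRel (AugEdge m A L)

end

/-! Non-realizability. In a realization exactly two circles carry the edges at a vertex, and each
carries two of the four edges (`CircleRealization.pairing`). A circle minus a point is connected, so
no circle leaves a part of the graph through a cut vertex and returns
(`CircleRealization.separation`). Hence the circles of the loop edges at a root stay in the
loop-subgraph, and the two outer edges at the root share a circle (`col_root_end`). As different
circles have at most two common points, a gadget consists of two circles, one through each triangle,
that touch at the hub (`col_hub`). The two path edges at a gadget end then share a circle as well,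
so the path that replaces an octahedron edge runs along one circle `C`, and the gadget circles touch
`C` (`exists_path_circle`, `touchAt_path_circle`).

Project `C` stereographically from an octahedron vertex. Circles touching the resulting line at `x`,
`y` with signed diameters `K`, `K'` satisfy `(x - y) ^ 2 = K * K'` if they are tangent and `K * K' <
(x - y) ^ 2` if they are disjoint (`exists_weights`). Interleaving gadgets must therefore use
different sides of the line (`opposite_sides`), and for nested gadgets on one side the interval
between the inner ends is shorter than both flanking intervals (`nested_gap`). For ends `x 0 < ... <
x 7` in the order p p q q p p q q this yields `x 5 - x 4 > x 4 - x 1 > x 3 - x 2 > x 6 - x 3 > x 5 -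
x 4`, which is absurd (`not_interlaced`).

Planarity. The graph without the loops has a two-page book layout, drawn by parabolas
(`exists_twoPage`, `TwoPage.toArcFamily`), in which all edges at a root are on one page. A
loop-subgraph is drawn in a half-disc with its root at the origin: an arc contains no disc, so some
disc outside the drawing of the piece touches the marked edge in one point, and inversion in it
turns the drawing inside out (`exists_loop_drawing`). Shrunken copies fit at the roots on the free
side of the spine (`TwoPage.attach`).

The infinite families are told apart by their numbers of vertices. For two pairs per edge, the
augmented octahedra themselves serve as loop pieces of growing size. -/

open scoped unitInterval

/-! ### Drawings given by families of arcs -/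

/-- A plane drawing with vertices `V` and edges `E`, the edge `e` being drawn as a simple arc from
the point of `src e` to the point of `tgt e`. -/
structure ArcFamily {V E : Type*} (src tgt : E → V) where
  pt : V → Plane
  arc : E → C(I, Plane)
  pt_injective : Function.Injective pt
  arc_injective : ∀ e, Function.Injective (arc e)
  arc_zero : ∀ e, arc e 0 = pt (src e)
  arc_one : ∀ e, arc e 1 = pt (tgt e)
  vertex : ∀ e t v, arc e t = pt v → v = src e ∨ v = tgt e
  meet : ∀ e e' t t', e ≠ e' → arc e t = arc e' t' →
    ∃ v, (v = src e ∨ v = tgt e) ∧ (v = src e' ∨ v = tgt e') ∧ arc e t = pt v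

/-- A graph is planar if its vertices and edges occur in a drawing by arcs. -/
theorem ArcFamily.isPlanar {V W E : Type*} {src tgt : E → W} (F : ArcFamily src tgt)
    (G : SimpleGraph V) (f : V → W) (hf : Function.Injective f)
    (cover : ∀ u v, G.Adj u v → ∃ e, s(src e, tgt e) = s(f u, f v)) : G.IsPlanar := by
  have h : ∀ e : G.edgeSet, ∃ d, s(src d, tgt d) = e.1.map f := by
    rintro ⟨e, he⟩
    induction e with | h u v => exact cover u v he
  choose d hd using h
  have hmem : ∀ e v, (f v = src (d e) ∨ f v = tgt (d e)) ↔ v ∈ e.1 := by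
    intro e v
    have h1 : (f v = src (d e) ∨ f v = tgt (d e)) ↔ f v ∈ s(src (d e), tgt (d e)) := by simp
    rw [h1, hd e, Sym2.mem_map]
    constructor
    · rintro ⟨w, hw, hwv⟩
      exact hf hwv ▸ hw
    · exact fun h => ⟨v, h, rfl⟩
  have hsrc : ∀ e, ∃ v, v ∈ e.1 ∧ f v = src (d e) := by
    intro e
    have : src (d e) ∈ e.1.map f := by rw [← hd e]; simp
    rwa [Sym2.mem_map] at this
  have htgt : ∀ e, ∃ v, v ∈ e.1 ∧ f v = tgt (d e) := by
    intro e
    have : tgt (d e) ∈ e.1.map f := by rw [← hd e]; simp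
    rwa [Sym2.mem_map] at this
  refine ⟨F.pt ∘ f, fun e => F.arc (d e), F.pt_injective.comp hf, fun e => F.arc_injective _,
    fun e => ?_, fun e t v h => ?_, fun e e' t t' h hne => ?_⟩
  · ext x
    simp only [Set.mem_insert_iff, Set.mem_singleton_iff, Set.mem_image, Set.mem_ofPred_eq,
      Function.comp, F.arc_zero, F.arc_one]
    constructor
    · rintro (rfl | rfl)
      · obtain ⟨v, hv, h⟩ := hsrc e
        exact ⟨v, hv, by rw [h]⟩
      · obtain ⟨v, hv, h⟩ := htgt e
        exact ⟨v, hv, by rw [h]⟩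
    · rintro ⟨v, hv, rfl⟩
      rcases (hmem e v).2 hv with h | h
      · left; rw [h]
      · right; rw [h]
  · exact (hmem e v).1 (F.vertex _ _ _ h)
  · have hdne : d e ≠ d e' := by
      intro h'
      apply hne
      apply Subtype.ext
      apply Sym2.map.injective hf
      rw [← hd e, ← hd e', h']
    obtain ⟨w, h1, h2, h3⟩ := F.meet _ _ _ _ hdne h
    have : ∃ v, f v = w := by
      rcases h1 with h1 | h1
      · obtain ⟨v, -, hv⟩ := hsrc e
        exact ⟨v, hv.trans h1.symm⟩
      · obtain ⟨v, -, hv⟩ := htgt e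
        exact ⟨v, hv.trans h1.symm⟩
    obtain ⟨v, rfl⟩ := this
    exact ⟨v, (hmem e v).1 h1, (hmem e' v).1 h2, h3⟩

/-- A planar graph has a drawing by directed arcs. -/
theorem SimpleGraph.IsPlanar.exists_arcFamily {V : Type*} {G : SimpleGraph V} (h : G.IsPlanar) :
    ∃ src tgt : G.edgeSet → V, (∀ e, s(src e, tgt e) = e.1) ∧ Nonempty (ArcFamily src tgt) := by
  obtain ⟨pt, arc, h1, h2, h3, h4, h5⟩ := h
  have hs : ∀ e, ∃ v, v ∈ e.1 ∧ pt v = arc e 0 := by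
    intro e
    have : arc e 0 ∈ pt '' {v | v ∈ e.1} := by rw [← h3]; simp
    obtain ⟨v, hv, h⟩ := this
    exact ⟨v, hv, h⟩
  have ht : ∀ e, ∃ v, v ∈ e.1 ∧ pt v = arc e 1 := by
    intro e
    have : arc e 1 ∈ pt '' {v | v ∈ e.1} := by rw [← h3]; simp
    obtain ⟨v, hv, h⟩ := this
    exact ⟨v, hv, h⟩
  choose src hsrc hsrc' using hs
  choose tgt htgt htgt' using ht
  have hne : ∀ e, src e ≠ tgt e := by
    intro e h
    have := h2 e ((hsrc' e).symm.trans ((congrArg pt h).trans (htgt' e)))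
    simp at this
  have he : ∀ e, s(src e, tgt e) = e.1 := fun e =>
    ((Sym2.mem_and_mem_iff (hne e)).1 ⟨hsrc e, htgt e⟩).symm
  have hm : ∀ e v, v ∈ e.1 → v = src e ∨ v = tgt e := by
    intro e v hv
    rw [← he e] at hv
    simpa using hv
  refine ⟨src, tgt, he, ⟨⟨pt, arc, h1, h2, fun e => (hsrc' e).symm, fun e => (htgt' e).symm,
    fun e t v h => hm e v (h4 e t v h), fun e e' t t' hne h => ?_⟩⟩⟩
  obtain ⟨v, a, b, c⟩ := h5 e e' t t' h hne
  exact ⟨v, hm _ _ a, hm _ _ b, c⟩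

/-! ### Two-page book drawings -/

/-- A two-page book layout: the vertices are ordered along a line, and the edges are distributed to
the two sides of the line such that edges on the same side do not interleave. -/
structure TwoPage {V E : Type*} (src tgt : E → V) (α : Type*) [LinearOrder α] where
  pos : V → α
  page : E → Bool
  pos_injective : Function.Injective pos
  src_ne_tgt : ∀ e, src e ≠ tgt e
  simple : ∀ e e', page e = page e' → s(src e, tgt e) = s(src e', tgt e') → e = e'
  noncrossing : ∀ e e', page e = page e' →
    ¬ (min (pos (src e)) (pos (tgt e)) < min (pos (src e')) (pos (tgt e')) ∧
      min (pos (src e')) (pos (tgt e')) < max (pos (src e)) (pos (tgt e)) ∧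
      max (pos (src e)) (pos (tgt e)) < max (pos (src e')) (pos (tgt e')))

/-- Transfer of a layout to another order. -/
def TwoPage.map {V E α β : Type*} [LinearOrder α] [LinearOrder β] {src tgt : E → V}
    (B : TwoPage src tgt α) (f : α ↪o β) : TwoPage src tgt β where
  pos := f ∘ B.pos
  page := B.page
  pos_injective := f.injective.comp B.pos_injective
  src_ne_tgt := B.src_ne_tgt
  simple := B.simple
  noncrossing e e' h := by
    simpa only [Function.comp, ← f.monotone.map_min, ← f.monotone.map_max, f.lt_iff_lt]
      using B.noncrossing e e' h

/-- Sign of a page. -/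
def pageSign (b : Bool) : ℝ := if b then 1 else -1

theorem pageSign_ne_zero (b : Bool) : pageSign b ≠ 0 := by cases b <;> simp [pageSign]

/-- Arcs on different pages lie in opposite closed half-planes, so they can meet on the spine only.
-/
theorem eq_zero_of_pageSign_mul {b b' : Bool} (h : b ≠ b') {u v : ℝ} (hu : 0 ≤ u) (hv : 0 ≤ v)
    (huv : pageSign b * u = pageSign b' * v) : u = 0 := by
  cases b <;> cases b' <;> simp [pageSign] at h huv <;> linarith

/-- The parabolic arc from `(a, 0)` to `(b, 0)`. -/
noncomputable def parabola (κ a b : ℝ) : C(I, Plane) where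
  toFun t := !₂[a + (b - a) * t, κ * ((b - a) ^ 2 * (t * (1 - t)))]
  continuous_toFun := by fun_prop

theorem parabola_apply_zero (κ a b : ℝ) (t : I) : parabola κ a b t 0 = a + (b - a) * t := rfl

theorem parabola_apply_one (κ a b : ℝ) (t : I) :
    parabola κ a b t 1 = κ * ((b - a) ^ 2 * (t * (1 - t))) := rfl

theorem parabola_injective {κ a b : ℝ} (h : a ≠ b) : Function.Injective (parabola κ a b) := by
  intro t t' ht
  have h0 := congrArg (fun p : Plane => p 0) ht
  simp only [parabola_apply_zero] at h0
  have : (b - a) * (t : ℝ) = (b - a) * t' := by linarith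
  exact Subtype.ext (mul_left_cancel₀ (sub_ne_zero.2 h.symm) this)

theorem parabola_height_nonneg (a b : ℝ) (t : I) : 0 ≤ (b - a) ^ 2 * ((t : ℝ) * (1 - t)) :=
  mul_nonneg (sq_nonneg _) (mul_nonneg t.2.1 (by linarith [t.2.2]))

theorem parabola_height_eq_zero {κ a b : ℝ} (hk : κ ≠ 0) (h : a ≠ b) {t : I}
    (ht : parabola κ a b t 1 = 0) : t = 0 ∨ t = 1 := by
  rw [parabola_apply_one] at ht
  have h1 : (b - a) ^ 2 ≠ 0 := pow_ne_zero _ (sub_ne_zero.2 h.symm)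
  rcases mul_eq_zero.1 ht with h2 | h2
  · exact absurd h2 hk
  rcases mul_eq_zero.1 h2 with h2 | h2
  · exact absurd h2 h1
  rcases mul_eq_zero.1 h2 with h2 | h2
  · exact Or.inl (Subtype.ext h2)
  · exact Or.inr (Subtype.ext (sub_eq_zero.1 h2).symm)

/-- Parabolas over non-interleaving intervals meet only over common ends. -/
theorem parabola_meet_ordered {a b c d x : ℝ} (hxa : a ≤ x) (hxb : x ≤ b) (hxc : c ≤ x)
    (hxd : x ≤ d) (hac : a ≤ c) (h : (x - a) * (b - x) = (x - c) * (d - x))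
    (h1 : ¬ (a < c ∧ c < b ∧ b < d)) (h2 : ¬ (a = c ∧ b = d)) :
    (x = a ∨ x = b) ∧ (x = c ∨ x = d) := by
  rcases hac.lt_or_eq with hac | hac
  · rcases (hxc.trans hxb).lt_or_eq with hcb | hcb
    · have hdb : d ≤ b := by by_contra hh; exact h1 ⟨hac, hcb, not_le.1 hh⟩
      -- The difference of the two quadratics is a sum of two nonnegative terms when `[c, d]` is
      -- nested in `[a, b]`.
      have h3 : (c - a) * (b - x) + (x - c) * (b - d) = 0 := by linear_combination h
      have h4 : 0 ≤ (c - a) * (b - x) := mul_nonneg (by linarith) (by linarith)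
      have h5 : 0 ≤ (x - c) * (b - d) := mul_nonneg (by linarith) (by linarith)
      have h6 : (c - a) * (b - x) = 0 := by linarith
      have h7 : b - x = 0 := (mul_eq_zero.1 h6).resolve_left (by linarith)
      exact ⟨Or.inr (by linarith), Or.inr (by linarith)⟩
    · exact ⟨Or.inr (by linarith), Or.inl (by linarith)⟩
  · subst hac
    have h3 : (x - a) * (b - d) = 0 := by linear_combination h
    rcases mul_eq_zero.1 h3 with h3 | h3
    · exact ⟨Or.inl (by linarith), Or.inl (by linarith)⟩
    · exact absurd ⟨rfl, by linarith⟩ h2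

theorem parabola_meet {a b c d x : ℝ} (hxa : a ≤ x) (hxb : x ≤ b) (hxc : c ≤ x)
    (hxd : x ≤ d) (h : (x - a) * (b - x) = (x - c) * (d - x))
    (h1 : ¬ (a < c ∧ c < b ∧ b < d)) (h1' : ¬ (c < a ∧ a < d ∧ d < b)) (h2 : ¬ (a = c ∧ b = d)) :
    (x = a ∨ x = b) ∧ (x = c ∨ x = d) := by
  rcases le_total a c with hac | hac
  · exact parabola_meet_ordered hxa hxb hxc hxd hac h h1 h2
  · exact (parabola_meet_ordered hxc hxd hxa hxb hac h.symm h1'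
      (fun hh => h2 ⟨hh.1.symm, hh.2.symm⟩)).symm

/-- The height depends on the abscissa alone, not on the direction of the arc, and all arcs of a
page have the same leading coefficient. Meeting points can thus be compared by abscissa. -/
theorem parabola_coord {κ a b : ℝ} (t : I) :
    min a b ≤ parabola κ a b t 0 ∧ parabola κ a b t 0 ≤ max a b ∧
    parabola κ a b t 1 =
      κ * ((parabola κ a b t 0 - min a b) * (max a b - parabola κ a b t 0)) := by
  simp only [parabola_apply_zero, parabola_apply_one]
  have h0 := t.2.1
  have h1 := t.2.2
  rcases le_total a b with h | h
  · rw [min_eq_left h, max_eq_right h]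
    refine ⟨by nlinarith, by nlinarith, by ring⟩
  · rw [min_eq_right h, max_eq_left h]
    refine ⟨by nlinarith, by nlinarith, by ring⟩

theorem eq_of_min_max {α : Type*} [LinearOrder α] {a b c d : α} (h1 : min a b = min c d)
    (h2 : max a b = max c d) : (a = c ∧ b = d) ∨ (a = d ∧ b = c) := by
  grind

/-- The drawing of a two-page layout by parabolic arcs. -/
noncomputable def TwoPage.toArcFamily {V E : Type*} {src tgt : E → V} (B : TwoPage src tgt ℝ) :
    ArcFamily src tgt where
  pt v := !₂[B.pos v, 0]
  arc e := parabola (pageSign (B.page e)) (B.pos (src e)) (B.pos (tgt e))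
  pt_injective v w h := B.pos_injective (congrArg (fun p : Plane => p 0) h)
  arc_injective e := parabola_injective fun h => B.src_ne_tgt e (B.pos_injective h)
  arc_zero e := by ext i; fin_cases i <;> simp [parabola]
  arc_one e := by ext i; fin_cases i <;> simp [parabola]
  vertex e t v h := by
    have hne : B.pos (src e) ≠ B.pos (tgt e) := fun h => B.src_ne_tgt e (B.pos_injective h)
    have h1 := congrArg (fun p : Plane => p 1) h
    have h0 := congrArg (fun p : Plane => p 0) h
    rcases parabola_height_eq_zero (pageSign_ne_zero _) hne h1 with rfl | rfl
    · left; apply B.pos_injective; simpa [parabola] using h0.symm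
    · right; apply B.pos_injective; simpa [parabola] using h0.symm
  meet e e' t t' hee h := by
    have hne : ∀ e, B.pos (src e) ≠ B.pos (tgt e) := fun e h => B.src_ne_tgt e (B.pos_injective h)
    obtain ⟨l1, l2, l3⟩ := parabola_coord (κ := pageSign (B.page e)) (a := B.pos (src e))
      (b := B.pos (tgt e)) t
    obtain ⟨m1, m2, m3⟩ := parabola_coord (κ := pageSign (B.page e')) (a := B.pos (src e'))
      (b := B.pos (tgt e')) t'
    have h1 := congrArg (fun p : Plane => p 1) h
    have h0 := congrArg (fun p : Plane => p 0) h
    simp only at h0 h1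
    -- On one page the heights agree at a common abscissa, so `parabola_meet` applies; on different
    -- pages the common height is zero. In both cases the parameters are ends.
    have key : (t = 0 ∨ t = 1) ∧ (t' = 0 ∨ t' = 1) := by
      by_cases hp : B.page e = B.page e'
      · rw [← h1, ← h0, ← hp] at m3
        rw [← h0] at m1 m2
        have hh := mul_left_cancel₀ (pageSign_ne_zero _) (l3.symm.trans m3)
        have hend := parabola_meet l1 l2 m1 m2 hh (B.noncrossing e e' hp)
          (B.noncrossing e' e hp.symm) (by
            rintro ⟨hmin, hmax⟩
            apply hee
            apply B.simple e e' hp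
            rcases eq_of_min_max hmin hmax with ⟨x, y⟩ | ⟨x, y⟩
            · rw [B.pos_injective x, B.pos_injective y]
            · rw [B.pos_injective x, B.pos_injective y, Sym2.eq_swap])
        have hz : parabola (pageSign (B.page e)) (B.pos (src e)) (B.pos (tgt e)) t 1 = 0 := by
          rw [l3]
          rcases hend.1 with hx | hx <;> rw [hx] <;> simp
        refine ⟨parabola_height_eq_zero (pageSign_ne_zero _) (hne e) hz, ?_⟩
        exact parabola_height_eq_zero (pageSign_ne_zero _) (hne e') (h1 ▸ hz)
      · have hz : parabola (pageSign (B.page e)) (B.pos (src e)) (B.pos (tgt e)) t 1 = 0 := by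
          have g1 := parabola_height_nonneg (B.pos (src e)) (B.pos (tgt e)) t
          have g2 := parabola_height_nonneg (B.pos (src e')) (B.pos (tgt e')) t'
          rw [parabola_apply_one, parabola_apply_one] at h1
          rw [parabola_apply_one]
          rw [eq_zero_of_pageSign_mul hp g1 g2 h1, mul_zero]
        refine ⟨parabola_height_eq_zero (pageSign_ne_zero _) (hne e) hz, ?_⟩
        exact parabola_height_eq_zero (pageSign_ne_zero _) (hne e') (h1 ▸ hz)
    have he0 : ∀ e, parabola (pageSign (B.page e)) (B.pos (src e)) (B.pos (tgt e)) 0 0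
      = B.pos (src e) := fun e => by simp [parabola]
    have he1 : ∀ e, parabola (pageSign (B.page e)) (B.pos (src e)) (B.pos (tgt e)) 1 0
      = B.pos (tgt e) := fun e => by simp [parabola]
    rcases key with ⟨rfl | rfl, rfl | rfl⟩
    · rw [he0, he0] at h0
      exact ⟨src e, Or.inl rfl, Or.inl (B.pos_injective h0),
        by ext i; fin_cases i <;> simp [parabola]⟩
    · rw [he0, he1] at h0
      exact ⟨src e, Or.inl rfl, Or.inr (B.pos_injective h0),
        by ext i; fin_cases i <;> simp [parabola]⟩
    · rw [he1, he0] at h0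
      exact ⟨tgt e, Or.inr rfl, Or.inl (B.pos_injective h0),
        by ext i; fin_cases i <;> simp [parabola]⟩
    · rw [he1, he1] at h0
      exact ⟨tgt e, Or.inr rfl, Or.inr (B.pos_injective h0),
        by ext i; fin_cases i <;> simp [parabola]⟩

/-! ### Splitting an edge and transforming a drawing -/

namespace ArcFamily

variable {V E : Type*} {src tgt : E → V} (F : ArcFamily src tgt)

theorem eq_zero_of_arc_eq {e : E} {t : I} (h : F.arc e t = F.pt (src e)) : t = 0 :=
  F.arc_injective e (h.trans (F.arc_zero e).symm)

theorem eq_one_of_arc_eq {e : E} {t : I} (h : F.arc e t = F.pt (tgt e)) : t = 1 :=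
  F.arc_injective e (h.trans (F.arc_one e).symm)

/-- The image of a drawing under an injective map that is continuous along the arcs. -/
def map (f : Plane → Plane) (hf : Function.Injective f) (hc : ∀ e, Continuous (f ∘ F.arc e)) :
    ArcFamily src tgt where
  pt := f ∘ F.pt
  arc e := ⟨f ∘ F.arc e, hc e⟩
  pt_injective := hf.comp F.pt_injective
  arc_injective e := hf.comp (F.arc_injective e)
  arc_zero e := congrArg f (F.arc_zero e)
  arc_one e := congrArg f (F.arc_one e)
  vertex e t v h := F.vertex e t v (hf h)
  meet e e' t t' hne h := by
    obtain ⟨v, h1, h2, h3⟩ := F.meet e e' t t' hne (hf h)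
    exact ⟨v, h1, h2, congrArg f h3⟩

/-- The segment from `a` to `b` in the unit interval. -/
def unitSeg (a b : I) : C(I, I) where
  toFun t := ⟨(1 - t) * a + t * b, by
    have ht0 := t.2.1
    have ht1 := t.2.2
    constructor
    · have := mul_nonneg (sub_nonneg.2 ht1) a.2.1
      have := mul_nonneg ht0 b.2.1
      linarith
    · have := mul_le_mul_of_nonneg_left a.2.2 (sub_nonneg.2 ht1)
      have := mul_le_mul_of_nonneg_left b.2.2 ht0
      linarith⟩
  continuous_toFun := by fun_prop

theorem coe_unitSeg (a b t : I) : (unitSeg a b t : ℝ) = (1 - t) * a + t * b := rfl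

theorem unitSeg_injective {a b : I} (h : a ≠ b) : Function.Injective (unitSeg a b) := by
  intro t t' ht
  have h1 := congrArg (Subtype.val) ht
  rw [coe_unitSeg, coe_unitSeg] at h1
  have h2 : ((t : ℝ) - t') * (b - a) = 0 := by linear_combination h1
  rcases mul_eq_zero.1 h2 with h3 | h3
  · exact Subtype.ext (sub_eq_zero.1 h3)
  · exact absurd (Subtype.ext (sub_eq_zero.1 h3).symm) h

theorem unitSeg_zero (a b : I) : unitSeg a b 0 = a := Subtype.ext (by simp [coe_unitSeg])

theorem unitSeg_one (a b : I) : unitSeg a b 1 = b := Subtype.ext (by simp [coe_unitSeg])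

theorem unitSeg_ne_zero {a : I} (h : a ≠ 0) (t : I) : unitSeg a 1 t ≠ 0 := by
  intro h'
  have h1 := congrArg (Subtype.val) h'
  rw [coe_unitSeg] at h1
  have ha : 0 < (a : ℝ) := unitInterval.pos_iff_ne_zero.2 h
  have ht0 := t.2.1
  have ht1 := t.2.2
  simp at h1
  rcases ht0.lt_or_eq with h0 | h0
  · have := mul_nonneg (sub_nonneg.2 ht1) ha.le
    linarith
  · rw [← h0] at h1; simp at h1; exact h h1

theorem unitSeg_ne_one {a : I} (h : a ≠ 1) (t : I) : unitSeg a 0 t ≠ 1 := by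
  intro h'
  have h1 := congrArg (Subtype.val) h'
  rw [coe_unitSeg] at h1
  have ha : (a : ℝ) < 1 := unitInterval.lt_one_iff_ne_one.2 h
  have ht0 := t.2.1
  have ht1 := t.2.2
  simp at h1
  nlinarith [a.2.1]

/-- The two segments leave `a` in opposite directions. -/
theorem unitSeg_meet {a : I} (h0 : a ≠ 0) (h1 : a ≠ 1) {t t' : I}
    (h : unitSeg a 0 t = unitSeg a 1 t') : unitSeg a 0 t = a := by
  have h2 := congrArg (Subtype.val) h
  rw [coe_unitSeg, coe_unitSeg] at h2
  simp at h2
  have ha : (a : ℝ) < 1 := unitInterval.lt_one_iff_ne_one.2 h1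
  have hb : 0 < (a : ℝ) := unitInterval.pos_iff_ne_zero.2 h0
  have ht : (t : ℝ) = 0 := by nlinarith [t.2.1, t'.2.1]
  have : t = 0 := Subtype.ext ht
  rw [this, unitSeg_zero]

theorem arc_ne_pt_of_interior {e : E} {t : I} (h0 : t ≠ 0) (h1 : t ≠ 1) (v : V) :
    F.arc e t ≠ F.pt v := by
  intro h
  rcases F.vertex _ _ _ h with rfl | rfl
  · exact h0 (F.eq_zero_of_arc_eq h)
  · exact h1 (F.eq_one_of_arc_eq h)

theorem arc_ne_arc_of_interior {e e' : E} {t : I} (h0 : t ≠ 0) (h1 : t ≠ 1) (hne : e ≠ e')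
    (t' : I) : F.arc e t ≠ F.arc e' t' := by
  intro h
  obtain ⟨v, -, -, hv⟩ := F.meet _ _ _ _ hne h
  exact F.arc_ne_pt_of_interior h0 h1 v hv

theorem half_eq_pt {e : E} {t : I} (h0 : t ≠ 0) (h1 : t ≠ 1) {b : Bool} {s : I} {v : V}
    (h : F.arc e (unitSeg t (bif b then 1 else 0) s) = F.pt v) :
    v = bif b then tgt e else src e := by
  rcases F.vertex _ _ _ h with rfl | rfl
  · cases b
    · rfl
    · exact absurd (F.eq_zero_of_arc_eq h) (unitSeg_ne_zero h0 s)
  · cases b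
    · exact absurd (F.eq_one_of_arc_eq h) (unitSeg_ne_one h1 s)
    · rfl

/-- Subdivision of the edge `e₀` at the point with parameter `t₀` by a new vertex `none`. -/
def split (e₀ : E) (t₀ : I) (h0 : t₀ ≠ 0) (h1 : t₀ ≠ 1) :
    ArcFamily (V := Option V) (E := {e // e ≠ e₀} ⊕ Bool)
      (Sum.elim (fun e => some (src e)) fun _ => none)
      (Sum.elim (fun e => some (tgt e)) fun b => some (bif b then tgt e₀ else src e₀)) where
  pt v := v.elim (F.arc e₀ t₀) F.pt
  arc := Sum.elim (fun e => F.arc e)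
    fun b => (F.arc e₀).comp (unitSeg t₀ (bif b then 1 else 0))
  pt_injective := by
    rintro (_ | v) (_ | w) h
    · rfl
    · exact absurd h (F.arc_ne_pt_of_interior h0 h1 w)
    · exact absurd h.symm (F.arc_ne_pt_of_interior h0 h1 v)
    · exact congrArg some (F.pt_injective h)
  arc_injective := by
    rintro (e | b)
    · exact F.arc_injective e
    · refine (F.arc_injective e₀).comp (unitSeg_injective ?_)
      cases b
      · exact h0
      · exact h1
  arc_zero := by
    rintro (e | b)
    · exact F.arc_zero e
    · simp [unitSeg_zero]
  arc_one := by
    rintro (e | b)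
    · exact F.arc_one e
    · cases b
      · simp [unitSeg_one, F.arc_zero]
      · simp [unitSeg_one, F.arc_one]
  vertex := by
    rintro (e | b) t (_ | v) h
    · exact absurd h.symm (F.arc_ne_arc_of_interior h0 h1 e.2.symm t)
    · rcases F.vertex _ _ _ h with h | h
      · exact Or.inl (congrArg some h)
      · exact Or.inr (congrArg some h)
    · exact Or.inl rfl
    · exact Or.inr (congrArg some (F.half_eq_pt h0 h1 h))
  meet := by
    rintro (e | b) (e' | b') t t' hne h
    · obtain ⟨v, a, b, c⟩ := F.meet e e' t t'
        (fun h => hne (congrArg Sum.inl (Subtype.ext h))) h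
      refine ⟨some v, ?_, ?_, c⟩
      · rcases a with a | a
        · exact Or.inl (congrArg some a)
        · exact Or.inr (congrArg some a)
      · rcases b with a | a
        · exact Or.inl (congrArg some a)
        · exact Or.inr (congrArg some a)
    · obtain ⟨v, a, -, c⟩ := F.meet _ _ _ _ e.2 h
      refine ⟨some v, ?_, Or.inr (congrArg some (F.half_eq_pt h0 h1 (h.symm.trans c))), c⟩
      rcases a with a | a
      · exact Or.inl (congrArg some a)
      · exact Or.inr (congrArg some a)
    · obtain ⟨v, -, a, c⟩ := F.meet _ _ _ _ e'.2.symm h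
      refine ⟨some v, Or.inr (congrArg some (F.half_eq_pt h0 h1 c)), ?_, c⟩
      rcases a with a | a
      · exact Or.inl (congrArg some a)
      · exact Or.inr (congrArg some a)
    · refine ⟨none, Or.inl rfl, Or.inl rfl, ?_⟩
      have h' := F.arc_injective e₀ h
      cases b <;> cases b'
      · exact absurd rfl hne
      · exact congrArg (F.arc e₀) (unitSeg_meet h0 h1 h')
      · exact (congrArg (F.arc e₀) (h'.trans (unitSeg_meet h0 h1 h'.symm)))
      · exact absurd rfl hne

end ArcFamily

/-! ### Arcs have empty interior -/

theorem Plane.one_lt_rank : 1 < Module.rank ℝ Plane := by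
  rw [← Module.finrank_eq_rank]
  simp

/-- A simple arc in the plane contains no disc. -/
theorem exists_mem_ball_notMem_range (γ : C(I, Plane)) (hγ : Function.Injective γ) (p : Plane)
    {ε : ℝ} (hε : 0 < ε) : ∃ q ∈ Metric.ball p ε, q ∉ Set.range γ := by
  -- If the arc filled the disc, deleting an interior parameter would disconnect an interval,
  -- whereas the disc stays connected when a point is deleted.
  by_contra! hcon
  have hemb : Topology.IsClosedEmbedding γ := γ.continuous.isClosedEmbedding hγ
  have himg : ∀ s : Set Plane, s ⊆ Metric.ball p ε → γ '' (γ ⁻¹' s) = s := fun s hs =>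
    Set.image_preimage_eq_of_subset fun x hx => hcon x (hs hx)
  have hconn : ∀ s : Set Plane, s ⊆ Metric.ball p ε → IsPreconnected s →
      IsPreconnected (γ ⁻¹' s) := by
    intro s hs hc
    rw [← himg s hs] at hc
    exact hemb.isInducing.isPreconnected_image.1 hc
  set T := γ ⁻¹' Metric.ball p ε with hT
  have hTo : IsOpen T := Metric.isOpen_ball.preimage γ.continuous
  obtain ⟨tp, htp⟩ := hcon p (Metric.mem_ball_self hε)
  obtain ⟨q, hqne, hq⟩ : ∃ q, q ≠ p ∧ q ∈ Metric.ball p ε := by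
    obtain ⟨v, hv⟩ := exists_ne (0 : Plane)
    have hv' : 0 < ‖v‖ := norm_pos_iff.2 hv
    refine ⟨p + (ε / 2 / ‖v‖) • v, ?_, ?_⟩
    · simp [hε.ne', hv]
    · rw [mem_ball_iff_norm, add_sub_cancel_left, norm_smul, Real.norm_of_nonneg (by positivity),
        div_mul_cancel₀ _ hv'.ne']
      linarith
  obtain ⟨tq, htq⟩ := hcon q hq
  have hpq : tp ≠ tq := by
    rintro rfl
    exact hqne (htq.symm.trans htp)
  have hTp : tp ∈ T := by simp [hT, htp, hε]
  have hTq : tq ∈ T := by rw [hT, Set.mem_preimage, htq]; exact hq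
  have hTc : IsPreconnected T :=
    hconn _ subset_rfl (convex_ball p ε).isPreconnected
  obtain ⟨lo, hi, hlo, hhi, hlt⟩ : ∃ lo hi, lo ∈ T ∧ hi ∈ T ∧ lo < hi := by
    rcases hpq.lt_or_gt with h | h
    · exact ⟨tp, tq, hTp, hTq, h⟩
    · exact ⟨tq, tp, hTq, hTp, h⟩
  obtain ⟨mid, h1, h2⟩ := exists_between hlt
  have hsub : Metric.ball p ε \ {γ mid} ⊆ Metric.ball p ε := Set.sdiff_subset
  have hc2 : IsPreconnected (Metric.ball p ε \ {γ mid}) := by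
    -- The disc is a homeomorphic copy of the plane, where the complement of a point is connected.
    set Φ := OpenPartialHomeomorph.univBall p ε
    have ht : Φ.target = Metric.ball p ε := OpenPartialHomeomorph.univBall_target p hε
    have hs : Φ.source = Set.univ := OpenPartialHomeomorph.univBall_source p ε
    have hmid : γ mid ∈ Φ.target := by
      rw [ht]
      exact hTc.ordConnected.out hlo hhi ⟨h1.le, h2.le⟩
    have himage : Φ '' {Φ.symm (γ mid)}ᶜ = Metric.ball p ε \ {γ mid} := by
      rw [← ht]
      ext x
      constructor
      · rintro ⟨y, hy, rfl⟩
        refine ⟨Φ.map_source (hs ▸ Set.mem_univ y), fun h => hy ?_⟩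
        rw [Set.mem_singleton_iff] at h
        rw [Set.mem_singleton_iff, ← h, Φ.left_inv (hs ▸ Set.mem_univ y)]
      · rintro ⟨hx, hne⟩
        refine ⟨Φ.symm x, fun h => hne ?_, Φ.right_inv hx⟩
        rw [Set.mem_singleton_iff] at h ⊢
        rw [← Φ.right_inv hx, h, Φ.right_inv hmid]
    rw [← himage]
    exact (isConnected_compl_singleton_of_one_lt_rank Plane.one_lt_rank _).isPreconnected.image _
      (OpenPartialHomeomorph.continuous_univBall p ε).continuousOn
  have hc3 := hconn _ hsub hc2
  have hord := hc3.ordConnected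
  have hmem : ∀ x ∈ T, x ≠ mid → x ∈ γ ⁻¹' (Metric.ball p ε \ {γ mid}) := fun x hx hne =>
    ⟨hx, fun h => hne (hγ h)⟩
  have := hord.out (hmem lo hlo h1.ne) (hmem hi hhi h2.ne') ⟨h1.le, h2.le⟩
  exact this.2 rfl

/-! ### Loop-subgraphs in a half-disc -/

/-- The origin together with an open half-disc above it. -/
def halfDisc : Set Plane := {p | p = 0 ∨ (0 < p 1 ∧ ‖p‖ < 2)}

/-- A disc touching a drawing in an interior point of an arc only. -/
theorem ArcFamily.exists_touching_disc {V E : Type*} [Finite V] [Finite E] {src tgt : E → V}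
    (F : ArcFamily src tgt) (e₀ : E) : ∃ (t₀ : I) (c : Plane) (ρ : ℝ), t₀ ≠ 0 ∧ t₀ ≠ 1 ∧ 0 < ρ ∧
      dist (F.arc e₀ t₀) c = ρ ∧ (∀ e t, F.arc e t = F.arc e₀ t₀ ∨ ρ < dist (F.arc e t) c) ∧
      ∀ v, ρ < dist (F.pt v) c := by
  let h : I := ⟨1 / 2, by norm_num, by norm_num⟩
  have hh0 : h ≠ 0 := fun hh => by simpa [h] using congrArg Subtype.val hh
  have hh1 : h ≠ 1 := fun hh => by
    have := congrArg Subtype.val hh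
    norm_num [h] at this
  set p := F.arc e₀ h with hp
  set K : Set Plane := Set.range F.pt ∪ ⋃ e : {e // e ≠ e₀}, Set.range (F.arc e) with hK
  have hKc : IsClosed K := by
    refine (Set.finite_range F.pt).isClosed.union (isClosed_iUnion_of_finite fun e => ?_)
    exact (isCompact_range (F.arc e).continuous).isClosed
  have hpK : p ∉ K := by
    rintro (⟨v, hv⟩ | hv)
    · exact F.arc_ne_pt_of_interior hh0 hh1 v hv.symm
    · obtain ⟨e, t, ht⟩ := Set.mem_iUnion.1 hv
      exact F.arc_ne_arc_of_interior hh0 hh1 e.2.symm t ht.symm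
  obtain ⟨ε, hε, hball⟩ := Metric.isOpen_iff.1 hKc.isOpen_compl p hpK
  -- The bound `ε / 2` makes `q` closer to the arc of `e₀` than to every vertex and every other arc.
  obtain ⟨q, hq, hqn⟩ := exists_mem_ball_notMem_range (F.arc e₀) (F.arc_injective e₀) p
    (half_pos hε)
  obtain ⟨r, ⟨t₀, rfl⟩, hr⟩ := (isCompact_range (F.arc e₀).continuous).exists_infDist_eq_dist
    ⟨_, h, rfl⟩ q
  have hnear : ∀ t, dist q (F.arc e₀ t₀) ≤ dist q (F.arc e₀ t) := fun t => by
    rw [← hr]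
    exact Metric.infDist_le_dist_of_mem ⟨t, rfl⟩
  have hqp : dist q p < ε / 2 := hq
  have hqr : dist q (F.arc e₀ t₀) < ε / 2 := (hnear h).trans_lt hqp
  have hfar : ∀ x ∈ K, dist q (F.arc e₀ t₀) < dist q x := by
    intro x hx
    by_contra! hcon
    refine hball (a := x) ?_ hx
    rw [Metric.mem_ball]
    calc dist x p ≤ dist x q + dist q p := dist_triangle _ _ _
      _ < ε := by rw [dist_comm x q]; linarith
  have hqne : q ≠ F.arc e₀ t₀ := fun hh => hqn ⟨t₀, hh.symm⟩
  have hd : 0 < dist q (F.arc e₀ t₀) := dist_pos.2 hqne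
  -- The disc with diameter from `q` to its nearest point lies in the disc about `q` through that
  -- point, and the two boundaries share this point only. Shrinking the disc in this way makes the
  -- contact unique.
  have hout : ∀ x, dist q (F.arc e₀ t₀) ≤ dist q x → x = F.arc e₀ t₀ ∨
      dist q (F.arc e₀ t₀) / 2 < dist x (midpoint ℝ q (F.arc e₀ t₀)) := by
    intro x hx
    by_contra! hcon
    obtain ⟨hne, hle⟩ := hcon
    set r := F.arc e₀ t₀
    have hm : dist q (midpoint ℝ q r) = dist q r / 2 := by
      rw [dist_left_midpoint, Real.norm_ofNat]; ring
    have h1 : dist q x ≤ dist q (midpoint ℝ q r) + dist (midpoint ℝ q r) x := dist_triangle _ _ _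
    rw [dist_comm (midpoint ℝ q r) x, hm] at h1
    have h2 : dist x (midpoint ℝ q r) = dist q r / 2 := by linarith
    have h3 : dist q (midpoint ℝ q r) + dist (midpoint ℝ q r) x = dist q x := by
      rw [dist_comm (midpoint ℝ q r) x, hm, h2]; linarith
    have h4 : midpoint ℝ q r = midpoint ℝ q x := by
      apply eq_midpoint_of_dist_eq_half
      · rw [hm]; linarith
      · rw [dist_comm, h2]; linarith
    apply hne
    have := congrArg (fun m => AffineEquiv.pointReflection ℝ m q) h4
    simpa using this.symm
  have hm : dist (F.arc e₀ t₀) (midpoint ℝ q (F.arc e₀ t₀)) = dist q (F.arc e₀ t₀) / 2 := by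
    rw [dist_right_midpoint, Real.norm_ofNat]; ring
  have hnv : ∀ v, F.arc e₀ t₀ ≠ F.pt v := fun v hv =>
    (hfar _ (Or.inl ⟨v, rfl⟩)).ne (by rw [hv])
  refine ⟨t₀, midpoint ℝ q (F.arc e₀ t₀), dist q (F.arc e₀ t₀) / 2, ?_, ?_, half_pos hd, hm,
    fun e t => ?_, fun v => ?_⟩
  · rintro rfl
    exact hnv _ (F.arc_zero e₀)
  · rintro rfl
    exact hnv _ (F.arc_one e₀)
  · by_cases he : e = e₀
    · subst he
      exact hout _ (hnear t)
    · exact hout _ (hfar _ (Or.inr (Set.mem_iUnion.2 ⟨⟨e, he⟩, t, rfl⟩))).le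
  · exact (hout _ (hfar _ (Or.inl ⟨v, rfl⟩)).le).resolve_left (hnv v).symm

/-- A map that turns the exterior of a disc, with a given boundary point, into the half-disc. -/
theorem exists_map_halfDisc {c r : Plane} {ρ : ℝ} (hρ : 0 < ρ) (hr : dist r c = ρ) :
    ∃ f : Plane → Plane, Function.Injective f ∧ f r = 0 ∧
      (∀ x, ρ < dist x c → f x ∈ halfDisc) ∧
      ∀ {X : Type} [TopologicalSpace X] (g : X → Plane), Continuous g → (∀ x, g x ≠ c) →
        Continuous (f ∘ g) := by
  -- The target is the open unit disc about `d`, which touches the horizontal axis at the origin and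
  -- lies within distance 2 of it.
  let d : Plane := !₂[0, 1]
  have hd : ‖d‖ = 1 := by simp [d, EuclideanSpace.norm_eq]
  have hn : ‖ρ⁻¹ • (c - r)‖ = ‖d‖ := by
    rw [norm_smul, hd, Real.norm_of_nonneg (by positivity), ← dist_eq_norm, dist_comm, hr,
      inv_mul_cancel₀ hρ.ne']
  -- Two vectors of equal norm are exchanged by a reflection.
  obtain ⟨A, hA⟩ : ∃ A : Plane ≃ₗᵢ[ℝ] Plane, A (ρ⁻¹ • (c - r)) = d :=
    ⟨_, Submodule.reflection_sub hn⟩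
  -- Inversion carries the exterior of the disc to its interior and fixes `r`; a similarity then
  -- moves `r` to the origin and the centre to `d`. Continuity is lost at `c` only, which the
  -- drawing avoids.
  refine ⟨fun x => A (ρ⁻¹ • (EuclideanGeometry.inversion c ρ x - r)), ?_, ?_, ?_, ?_⟩
  · intro x y hxy
    have h1 := smul_right_injective Plane (inv_ne_zero hρ.ne') (A.injective hxy)
    exact EuclideanGeometry.inversion_injective c hρ.ne' (sub_left_injective h1)
  · simp [EuclideanGeometry.inversion_of_mem_sphere (Metric.mem_sphere.2 hr)]
  · intro x hx
    right
    set y := A (ρ⁻¹ • (EuclideanGeometry.inversion c ρ x - r)) with hy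
    have hyd : ‖y - d‖ < 1 := by
      rw [← hA, hy, ← map_sub, A.norm_map, ← smul_sub, norm_smul,
        Real.norm_of_nonneg (by positivity), sub_sub_sub_cancel_right, ← dist_eq_norm,
        EuclideanGeometry.dist_inversion_center]
      have : ρ⁻¹ * (ρ ^ 2 / dist x c) = ρ / dist x c := by field_simp
      rw [this, div_lt_one (hρ.trans hx)]
      exact hx
    constructor
    · have h1 : |(y - d) 1| ≤ ‖y - d‖ := by
        simpa using PiLp.norm_apply_le (y - d) 1
      have h2 := (abs_lt.1 (h1.trans_lt hyd)).1
      simp [d] at h2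
      linarith
    · calc ‖y‖ = ‖(y - d) + d‖ := by rw [sub_add_cancel]
        _ ≤ ‖y - d‖ + ‖d‖ := norm_add_le _ _
        _ < 2 := by rw [hd]; linarith
  · intro X _ g hg hne
    have h1 : Continuous fun x => EuclideanGeometry.inversion c ρ (g x) :=
      continuous_const.inversion continuous_const hg hne
    have h2 : Continuous fun x => ρ⁻¹ • (EuclideanGeometry.inversion c ρ (g x) - r) := by fun_prop
    exact A.continuous.comp h2

/-- The loop-subgraph of a planar graph can be drawn in the half-disc with its root, the vertex
`none`, at the origin. -/
theorem exists_loop_drawing {V : Type} [Finite V] {G : SimpleGraph V}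
    (hG : G.IsPlanar) {a b : V} (hab : G.Adj a b) :
    ∃ (E : Type) (src tgt : E → Option V) (F : ArcFamily src tgt),
      (∀ x y, G.Adj x y → s(x, y) ≠ s(a, b) → ∃ e, s(src e, tgt e) = s(some x, some y)) ∧
      (∃ e, s(src e, tgt e) = s(none, some a)) ∧ (∃ e, s(src e, tgt e) = s(none, some b)) ∧
      F.pt none = 0 ∧ (∀ v, F.pt v ∈ halfDisc) ∧ ∀ e t, F.arc e t ∈ halfDisc := by
  obtain ⟨src, tgt, hst, ⟨F⟩⟩ := hG.exists_arcFamily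
  let e₀ : G.edgeSet := ⟨s(a, b), hab⟩
  obtain ⟨t₀, c, ρ, h0, h1, hρ, hr, harc, hpt⟩ := F.exists_touching_disc e₀
  obtain ⟨f, hf, hfr, hfd, hfc⟩ := exists_map_halfDisc hρ hr
  -- The root is put at the point of contact, so everything else in the drawing is outside the
  -- closed disc.
  let F' := F.split e₀ t₀ h0 h1
  have hdraw : ∀ e t, F'.arc e t = F.arc e₀ t₀ ∨ ρ < dist (F'.arc e t) c := by
    rintro (e | b) t
    · exact harc e t
    · exact harc e₀ _
  have hne : ∀ x : Plane, (x = F.arc e₀ t₀ ∨ ρ < dist x c) → x ≠ c := by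
    rintro x (rfl | h) rfl
    · rw [dist_self] at hr; exact hρ.ne hr
    · rw [dist_self] at h; exact absurd hρ h.not_gt
  have hmem : ∀ x : Plane, (x = F.arc e₀ t₀ ∨ ρ < dist x c) → f x ∈ halfDisc := by
    rintro x (rfl | h)
    · exact Or.inl hfr
    · exact hfd x h
  have hab' : ∀ v, v = a ∨ v = b → ∃ β : Bool, (bif β then tgt e₀ else src e₀) = v := by
    have h2 := hst e₀
    rw [Sym2.eq_iff] at h2
    rintro v hv
    rcases h2 with ⟨h2, h3⟩ | ⟨h2, h3⟩ <;> rcases hv with rfl | rfl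
    · exact ⟨false, h2⟩
    · exact ⟨true, h3⟩
    · exact ⟨true, h3⟩
    · exact ⟨false, h2⟩
  refine ⟨_, _, _, F'.map f hf (fun e => hfc _ (F'.arc e).continuous fun t => hne _ (hdraw e t)),
    ?_, ?_, ?_, hfr, ?_, fun e t => hmem _ (hdraw e t)⟩
  · intro x y hxy hne
    refine ⟨Sum.inl ⟨⟨s(x, y), hxy⟩, fun h => hne (congrArg Subtype.val h)⟩, ?_⟩
    have := congrArg (Sym2.map some) (hst ⟨s(x, y), hxy⟩)
    simpa using this
  · obtain ⟨β, hβ⟩ := hab' a (Or.inl rfl)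
    exact ⟨Sum.inr β, by simp [hβ]⟩
  · obtain ⟨β, hβ⟩ := hab' b (Or.inr rfl)
    exact ⟨Sum.inr β, by simp [hβ]⟩
  · rintro (_ | v)
    · exact hmem _ (Or.inl rfl)
    · exact hmem _ (Or.inr (hpt v))

/-! ### Attaching drawings at vertices of a drawing -/

/-- The vertices of the graph that arises by attaching, for each `i`, a rooted graph with vertices
`Option (W i)` and root `none` at the vertex `r i`. -/
def attachVertex {V ι : Type*} {W : ι → Type*} (r : ι → V) (i : ι) (o : Option (W i)) :
    V ⊕ Σ i, W i :=
  o.elim (Sum.inl (r i)) fun x => Sum.inr ⟨i, x⟩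

/-- The hypotheses say that a placed copy meets the base drawing at its root only and that two
copies never meet. Every intersection then comes from one of the given drawings or is a root. -/
theorem ArcFamily.attach {V E ι : Type*} {W E' : ι → Type*} {src tgt : E → V}
    (F : ArcFamily src tgt) (r : ι → V) {src' tgt' : ∀ i, E' i → Option (W i)}
    (L : ∀ i, ArcFamily (src' i) (tgt' i)) (D : Set Plane) (hroot : ∀ i, (L i).pt none = 0)
    (hpt : ∀ i v, (L i).pt v ∈ D) (harc : ∀ i e t, (L i).arc e t ∈ D)
    (place : ι → Plane → Plane) (hcont : ∀ i, Continuous (place i))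
    (hinj : ∀ i, Function.Injective (place i)) (hplace : ∀ i, place i 0 = F.pt (r i))
    (hbase_arc : ∀ i e t, ∀ p ∈ D, place i p = F.arc e t → p = 0)
    (hbase_pt : ∀ i v, ∀ p ∈ D, place i p = F.pt v → p = 0)
    (hdisj : ∀ i j, i ≠ j → ∀ p ∈ D, ∀ q ∈ D, place i p ≠ place j q) :
    Nonempty (ArcFamily (V := V ⊕ Σ i, W i) (E := E ⊕ Σ i, E' i)
      (Sum.elim (fun e => Sum.inl (src e)) fun x => attachVertex r x.1 (src' x.1 x.2))
      (Sum.elim (fun e => Sum.inl (tgt e)) fun x => attachVertex r x.1 (tgt' x.1 x.2))) := by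
  let P : V ⊕ (Σ i, W i) → Plane :=
    Sum.elim F.pt fun x => place x.1 ((L x.1).pt (some x.2))
  let A : E ⊕ (Σ i, E' i) → C(I, Plane) :=
    Sum.elim F.arc fun x => ⟨place x.1 ∘ (L x.1).arc x.2, (hcont _).comp ((L x.1).arc x.2).continuous⟩
  have hP : ∀ i o, P (attachVertex r i o) = place i ((L i).pt o) := by
    rintro i (_ | x)
    · exact (hplace i).symm.trans (congrArg _ (hroot i).symm)
    · rfl
  have hA : ∀ i e t, A (Sum.inr ⟨i, e⟩) t = place i ((L i).arc e t) := fun _ _ _ => rfl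
  have hnone : ∀ {i o}, (L i).pt o = 0 → o = none := fun {i o} h =>
    (L i).pt_injective (h.trans (hroot i).symm)
  have hzero : ∀ {i v}, F.pt v = place i 0 → v = r i := fun {i v} h =>
    F.pt_injective (h.trans (hplace i))
  have hPinj : Function.Injective P := by
    rintro (v | ⟨i, x⟩) (w | ⟨j, y⟩) h
    · exact congrArg _ (F.pt_injective h)
    · exact absurd (hnone (hbase_pt _ _ _ (hpt _ _) h.symm)) (by simp)
    · exact absurd (hnone (hbase_pt _ _ _ (hpt _ _) h)) (by simp)
    · by_cases hij : i = j
      · subst hij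
        have := (L i).pt_injective (hinj i h)
        simp only [Option.some.injEq] at this
        rw [this]
      · exact absurd h (hdisj i j hij _ (hpt _ _) _ (hpt _ _))
  refine ⟨⟨P, A, hPinj, ?_, ?_, ?_, ?_, ?_⟩⟩
  · rintro (e | ⟨i, e⟩)
    · exact F.arc_injective e
    · exact (hinj i).comp ((L i).arc_injective e)
  · rintro (e | ⟨i, e⟩)
    · exact F.arc_zero e
    · rw [hA, (L i).arc_zero]; exact (hP i _).symm
  · rintro (e | ⟨i, e⟩)
    · exact F.arc_one e
    · rw [hA, (L i).arc_one]; exact (hP i _).symm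
  · rintro (e | ⟨i, e⟩) t v h
    · rcases v with v | ⟨j, x⟩
      · rcases F.vertex e t v h with h | h
        · exact Or.inl (congrArg _ h)
        · exact Or.inr (congrArg _ h)
      · exact absurd (hnone (hbase_arc _ _ _ _ (hpt _ _) h.symm)) (by simp)
    · have hkey : ∀ o, (L i).arc e t = (L i).pt o →
          attachVertex r i o = attachVertex r i (src' i e) ∨
          attachVertex r i o = attachVertex r i (tgt' i e) := by
        intro o ho
        rcases (L i).vertex e t o ho with h | h
        · exact Or.inl (congrArg _ h)
        · exact Or.inr (congrArg _ h)
      rcases v with v | ⟨j, x⟩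
      · have h0 := hbase_pt i v _ (harc i e t) h
        have hv : v = r i := hzero (by rw [← h0]; exact h.symm)
        subst hv
        exact hkey none (h0.trans (hroot i).symm)
      · by_cases hij : i = j
        · subst hij
          exact hkey (some x) (hinj i h)
        · exact absurd h (hdisj i j hij _ (harc _ _ _) _ (hpt _ _))
  · have hmix : ∀ i e t e' t', place i ((L i).arc e t) = F.arc e' t' →
        (L i).arc e t = (L i).pt none ∧ F.arc e' t' = F.pt (r i) := by
      intro i e t e' t' h
      have h0 := hbase_arc i e' t' _ (harc i e t) h
      exact ⟨h0.trans (hroot i).symm, by rw [← h, h0, hplace]⟩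
    have hmixed : ∀ i e t e' t', place i ((L i).arc e t) = F.arc e' t' →
        (Sum.inl (r i) = attachVertex r i (src' i e) ∨
          Sum.inl (r i) = attachVertex r i (tgt' i e)) ∧
        ((Sum.inl (r i) : V ⊕ Σ i, W i) = Sum.inl (src e') ∨
          (Sum.inl (r i) : V ⊕ Σ i, W i) = Sum.inl (tgt e')) := by
      intro i e t e' t' h
      obtain ⟨h1, h2⟩ := hmix i e t e' t' h
      constructor
      · rcases (L i).vertex _ _ _ h1 with h | h
        · left; rw [← h]; rfl
        · right; rw [← h]; rfl
      · rcases F.vertex _ _ _ h2 with h | h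
        · exact Or.inl (congrArg _ h)
        · exact Or.inr (congrArg _ h)
    rintro (e | ⟨i, e⟩) (e' | ⟨j, e'⟩) t t' hne h
    · obtain ⟨v, a, b, c⟩ := F.meet e e' t t' (fun h => hne (congrArg _ h)) h
      refine ⟨Sum.inl v, ?_, ?_, c⟩
      · rcases a with h | h
        · exact Or.inl (congrArg _ h)
        · exact Or.inr (congrArg _ h)
      · rcases b with h | h
        · exact Or.inl (congrArg _ h)
        · exact Or.inr (congrArg _ h)
    · exact ⟨Sum.inl (r j), (hmixed j e' t' e t h.symm).2, (hmixed j e' t' e t h.symm).1,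
        (hmix j e' t' e t h.symm).2⟩
    · exact ⟨Sum.inl (r i), (hmixed i e t e' t' h).1, (hmixed i e t e' t' h).2,
        h.trans (hmix i e t e' t' h).2⟩
    · by_cases hij : i = j
      · subst hij
        obtain ⟨o, a, b, c⟩ := (L i).meet e e' t t' (fun h => hne (by rw [h])) (hinj i h)
        refine ⟨attachVertex r i o, ?_, ?_, ?_⟩
        · rcases a with h | h
          · exact Or.inl (congrArg _ h)
          · exact Or.inr (congrArg _ h)
        · rcases b with h | h
          · exact Or.inl (congrArg _ h)
          · exact Or.inr (congrArg _ h)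
        · rw [hP, hA, c]
      · exact absurd h (hdisj i j hij _ (harc _ _ _) _ (harc _ _ _))

/-- Rooted graphs drawn in the half-disc can be attached to a two-page layout at vertices all of
whose edges are on the same page. -/
theorem TwoPage.attach {V E ι α : Type*} [LinearOrder α] [Countable α] [Finite E] [Finite ι]
    {src tgt : E → V} (B : TwoPage src tgt α) (r : ι → V) (hr : Function.Injective r)
    (pg : ι → Bool) (hpg : ∀ i e, src e = r i ∨ tgt e = r i → B.page e = pg i)
    {W E' : ι → Type*} {src' tgt' : ∀ i, E' i → Option (W i)}
    (L : ∀ i, ArcFamily (src' i) (tgt' i)) (hroot : ∀ i, (L i).pt none = 0)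
    (hpt : ∀ i v, (L i).pt v ∈ halfDisc) (harc : ∀ i e t, (L i).arc e t ∈ halfDisc) :
    Nonempty (ArcFamily (V := V ⊕ Σ i, W i) (E := E ⊕ Σ i, E' i)
      (Sum.elim (fun e => Sum.inl (src e)) fun x => attachVertex r x.1 (src' x.1 x.2))
      (Sum.elim (fun e => Sum.inl (tgt e)) fun x => attachVertex r x.1 (tgt' x.1 x.2))) := by
  obtain ⟨ψ⟩ := Order.embedding_from_countable_to_dense α ℝ
  let B' := B.map ψ
  let F := B'.toArcFamily
  have hev : ∀ δ : ℝ, 0 < δ → ∀ᶠ ρ in nhdsWithin (0 : ℝ) (Set.Ioi 0), ρ < δ := fun δ hδ =>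
    mem_nhdsWithin_of_mem_nhds (Iio_mem_nhds hδ)
  -- An arc on the other page does not end at the root by `hpg`, so its compact image keeps a
  -- positive distance from it. The factors 2 and 4 come from the half-disc having radius 2.
  have h1 : ∀ i e, ∀ᶠ ρ in nhdsWithin (0 : ℝ) (Set.Ioi 0), B.page e ≠ pg i →
      ∀ t, 2 * ρ < dist (F.arc e t) (F.pt (r i)) := by
    intro i e
    by_cases he : B.page e = pg i
    · exact Filter.Eventually.of_forall fun _ h => absurd he h
    have hnot : F.pt (r i) ∈ (Set.range (F.arc e))ᶜ := by
      rintro ⟨t, ht⟩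
      apply he
      apply hpg
      rcases F.vertex _ _ _ ht with h | h
      · exact Or.inl h.symm
      · exact Or.inr h.symm
    obtain ⟨ε, hε, hball⟩ := Metric.isOpen_iff.1
      (isCompact_range (F.arc e).continuous).isClosed.isOpen_compl _ hnot
    filter_upwards [hev (ε / 2) (half_pos hε)] with ρ hρ _ t
    by_contra! hcon
    exact hball (a := F.arc e t) (by rw [Metric.mem_ball]; linarith) ⟨t, rfl⟩
  have h2 : ∀ i j, ∀ᶠ ρ in nhdsWithin (0 : ℝ) (Set.Ioi 0), i ≠ j →
      4 * ρ < dist (F.pt (r i)) (F.pt (r j)) := by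
    intro i j
    by_cases hij : i = j
    · exact Filter.Eventually.of_forall fun _ h => absurd hij h
    have hd : 0 < dist (F.pt (r i)) (F.pt (r j)) :=
      dist_pos.2 fun h => hij (hr (F.pt_injective h))
    filter_upwards [hev _ (by positivity : 0 < dist (F.pt (r i)) (F.pt (r j)) / 4)] with ρ hρ _
    linarith
  have h0 : ∀ᶠ ρ in nhdsWithin (0 : ℝ) (Set.Ioi 0), 0 < ρ := self_mem_nhdsWithin
  obtain ⟨ρ, hρ0, hρ1, hρ2⟩ := (h0.and
    ((Filter.eventually_all.2 fun i => Filter.eventually_all.2 fun e => h1 i e).and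
      (Filter.eventually_all.2 fun i => Filter.eventually_all.2 fun j => h2 i j))).exists
  -- The sign puts the copy on the side of the spine opposite to the page of the edges at its root.
  let k : ι → ℝ := fun i => -(pageSign (pg i)) * ρ
  have hk : ∀ i, k i ≠ 0 := fun i => mul_ne_zero (neg_ne_zero.2 (pageSign_ne_zero _)) hρ0.ne'
  have hkabs : ∀ i, |k i| = ρ := by
    intro i
    simp only [k, abs_mul, abs_neg, abs_of_pos hρ0]
    cases pg i <;> simp [pageSign]
  have hdist : ∀ i (p : Plane), dist (F.pt (r i) + k i • p) (F.pt (r i)) = ρ * ‖p‖ := by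
    intro i p
    rw [dist_eq_norm, add_sub_cancel_left, norm_smul, Real.norm_eq_abs, hkabs]
  have hnorm : ∀ p ∈ halfDisc, ‖p‖ < 2 := by
    rintro p (rfl | h)
    · simp
    · exact h.2
  have hone : ∀ i (p : Plane), (F.pt (r i) + k i • p) 1 = k i * p 1 := by
    intro i p
    have : (F.pt (r i)) 1 = 0 := rfl
    simp [this]
  refine F.attach r L halfDisc hroot hpt harc (fun i p => F.pt (r i) + k i • p)
    (fun i => by fun_prop) (fun i p q h => ?_) (fun i => by simp) ?_ ?_ ?_
  · exact smul_right_injective Plane (hk i) (add_left_cancel h)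
  · intro i e t p hp h
    by_contra hp0
    have hp' := hp.resolve_left hp0
    -- On the page of the root the arc and the copy have heights of opposite signs, the latter
    -- nonzero away from the root. On the other page the choice of `ρ` keeps them apart.
    by_cases he : B.page e = pg i
    · have h3 := congrArg (fun p : Plane => p 1) h
      simp only [hone] at h3
      have h4 : (F.arc e t) 1 = pageSign (pg i) * ((B'.pos (tgt e) - B'.pos (src e)) ^ 2 *
          ((t : ℝ) * (1 - t))) := by rw [← he]; rfl
      have h5 := parabola_height_nonneg (B'.pos (src e)) (B'.pos (tgt e)) t
      rw [h4] at h3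
      have h6 : 0 < ρ * p 1 := mul_pos hρ0 hp'.1
      simp only [k] at h3
      have h7 := mul_left_cancel₀ (pageSign_ne_zero (pg i))
        (show pageSign (pg i) * (-(ρ * p 1)) = _ by rw [← h3]; ring)
      linarith
    · have h3 := hρ1 i e he t
      rw [← h, hdist] at h3
      have := mul_lt_mul_of_pos_left (hnorm p hp) hρ0
      linarith
  · intro i v p hp h
    by_contra hp0
    have hp' := hp.resolve_left hp0
    have h3 := congrArg (fun p : Plane => p 1) h
    simp only [hone] at h3
    have h4 : (F.pt v) 1 = 0 := rfl
    rw [h4] at h3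
    exact mul_ne_zero (hk i) hp'.1.ne' h3
  · intro i j hij p hp q hq h
    have h3 := hρ2 i j hij
    have h4 := dist_triangle_left (F.pt (r i)) (F.pt (r j)) (F.pt (r i) + k i • p)
    rw [hdist] at h4
    rw [h, hdist] at h4
    have h5 := mul_lt_mul_of_pos_left (hnorm p hp) hρ0
    have h6 := mul_lt_mul_of_pos_left (hnorm q hq) hρ0
    linarith

/-! ### A two-page layout of the subdivided octahedron -/

instance : DecidableRel octahedron.Adj := fun i j =>
  inferInstanceAs (Decidable (i ≠ j ∧ (i : ℕ) + (j : ℕ) ≠ 5))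

/-- Ranks of the octahedron vertices on the spine of the layout. -/
def octRank : Fin 6 → ℕ := ![13, 1, 7, 3, 15, 9]

/-- Ranks of the octahedron edges on the spine of the layout. -/
def edgeRank (e : OctEdge) : ℕ :=
  (![![0, 0, 17, 12, 14, 0], ![0, 0, 6, 2, 0, 5], ![0, 0, 0, 0, 16, 8],
    ![0, 0, 0, 0, 11, 4], ![0, 0, 0, 0, 0, 10], ![0, 0, 0, 0, 0, 0]] :
    Fin 6 → Fin 6 → ℕ) e.1.1 e.1.2

/-- Pages of the first (`false`) and last (`true`) edges of the paths. -/
def endPage (e : OctEdge) (β : Bool) : Bool :=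
  if β then e = ⟨(0, 2), by decide⟩ ∨ e = ⟨(3, 4), by decide⟩
  else e = ⟨(0, 3), by decide⟩ ∨ e = ⟨(1, 2), by decide⟩ ∨ e = ⟨(1, 5), by decide⟩ ∨
    e = ⟨(2, 4), by decide⟩ ∨ e = ⟨(4, 5), by decide⟩

/-- The octahedron vertex at the first (`false`) or last (`true`) end of a path. -/
def octEnd (e : OctEdge) (β : Bool) : Fin 6 := if β then e.1.2 else e.1.1

theorem octRank_injective : Function.Injective octRank := by decide

theorem edgeRank_injective : Function.Injective edgeRank := by decide

theorem octRank_ne_edgeRank : ∀ v e, octRank v ≠ edgeRank e := by decide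

/-- Interleaving of two pairs. -/
def Interleaved {α : Type*} [LinearOrder α] (a b c d : α) : Prop :=
  (a < c ∨ b < c) ∧ (a < d ∨ b < d) ∧ (c < a ∨ c < b ∨ d < a ∨ d < b) ∧
    (a < c ∧ b < c ∨ a < d ∧ b < d)

instance {α : Type*} [LinearOrder α] (a b c d : α) : Decidable (Interleaved a b c d) := by
  unfold Interleaved; infer_instance

theorem interleaved_iff {α : Type*} [LinearOrder α] (a b c d : α) :
    Interleaved a b c d ↔ (min a b < min c d ∧ min c d < max a b ∧ max a b < max c d) := by
  simp only [Interleaved, lt_min_iff, min_lt_iff, lt_max_iff, max_lt_iff]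
  tauto

/-- Only strict inequalities occur in the definition, and none is negated. Crossings therefore
survive the passage to coarser positions, where they can be excluded by computation. -/
theorem Interleaved.imp {α β ι : Type*} [LinearOrder α] [LinearOrder β] {f : ι → α} {g : ι → β}
    (hfg : ∀ i j, f i < f j → g i < g j) {a b c d : ι}
    (h : Interleaved (f a) (f b) (f c) (f d)) : Interleaved (g a) (g b) (g c) (g d) := by
  obtain ⟨h1, h2, h3, h4⟩ := h
  exact ⟨h1.imp (hfg _ _) (hfg _ _), h2.imp (hfg _ _) (hfg _ _),
    h3.imp (hfg _ _) (Or.imp (hfg _ _) (Or.imp (hfg _ _) (hfg _ _))),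
    h4.imp (And.imp (hfg _ _) (hfg _ _)) (And.imp (hfg _ _) (hfg _ _))⟩

/-- The eighteen ranks arrange the octahedron vertices and the path blocks on the spine; doubling
them separates the two ends of a block. What remains is a finite check. -/
theorem endPage_noncrossing : ∀ e β e' β', endPage e β = endPage e' β' →
    ¬ Interleaved (2 * octRank (octEnd e β)) (2 * edgeRank e + β.toNat)
      (2 * octRank (octEnd e' β')) (2 * edgeRank e' + β'.toNat) := by
  decide

/-- Two points outside an interval do not interleave with its ends. -/
theorem not_interleaved_of_outside {α : Type*} [LinearOrder α] {a b x y : α}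
    (hx : (x ≤ a ∧ x ≤ b) ∨ (a ≤ x ∧ b ≤ x)) (hy : (y ≤ a ∧ y ≤ b) ∨ (a ≤ y ∧ b ≤ y)) :
    ¬ Interleaved a b x y ∧ ¬ Interleaved x y a b := by
  simp only [Interleaved]
  grind

/-! ### Sides of the gadgets along a path -/

namespace Attachment

variable {m : ℕ} (A : Attachment m)

theorem slot_injective : ∀ t s t' s', slot t s = slot t' s' → t = t' ∧ s = s' := by decide

theorem pos_slot_eq {p p' : Fin m} {t s t' s' : Fin 2}
    (h : (A.pos (p, slot t s) : ℕ) = A.pos (p', slot t' s')) : p = p' ∧ t = t' ∧ s = s' := by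
  have h1 := A.bijective.1 (Fin.ext h)
  rw [Prod.mk.injEq] at h1
  exact ⟨h1.1, slot_injective _ _ _ _ h1.2⟩

theorem pos_slot_lt (p : Fin m) (t : Fin 2) :
    (A.pos (p, slot t 0) : ℕ) < A.pos (p, slot t 1) := by
  apply A.nested p
  revert t
  decide

/-- Every path vertex is an end of a gadget. -/
theorem exists_slot (i : Fin (4 * m)) : ∃ p t s, A.pos (p, slot t s) = i := by
  obtain ⟨⟨p, q⟩, rfl⟩ := A.bijective.2 i
  have : ∀ q, ∃ t s, slot t s = q := by decide
  obtain ⟨t, s, rfl⟩ := this q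
  exact ⟨p, t, s, rfl⟩

/-- A distribution of the gadgets to the two sides of the path, given by the sides at the path
vertices, with prescribed side at the last vertex. -/
theorem exists_side (b : Bool) : ∃ τ : Fin (4 * m) → Bool,
    (∀ p t s, τ (A.pos (p, slot t s)) = τ (A.pos (p, slot t 0))) ∧
    (∀ p t p' t', τ (A.pos (p, slot t 0)) = τ (A.pos (p', slot t' 0)) →
      ¬ (A.pos (p, slot t 0) < A.pos (p', slot t' 0) ∧
        A.pos (p', slot t' 0) < A.pos (p, slot t 1) ∧
        A.pos (p, slot t 1) < A.pos (p', slot t' 1))) ∧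
    ∀ i : Fin (4 * m), (i : ℕ) + 1 = 4 * m → τ i = b := by
  obtain ⟨side, hside⟩ := A.noncrossing
  choose P T S hPTS using A.exists_slot
  have hP : ∀ p t s, P (A.pos (p, slot t s)) = p ∧ T (A.pos (p, slot t s)) = t := fun p t s => by
    obtain ⟨h1, h2, -⟩ := A.pos_slot_eq (congrArg Fin.val (hPTS (A.pos (p, slot t s))))
    exact ⟨h1, h2⟩
  -- Exchanging the two sides of the whole path preserves the noncrossing condition, so the side at
  -- the last vertex can be prescribed.
  have hflip : ∃ c : Bool, ∀ i : Fin (4 * m), (i : ℕ) + 1 = 4 * m →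
      (side (P i) (T i) ^^ c) = b := by
    by_cases h : ∃ i : Fin (4 * m), (i : ℕ) + 1 = 4 * m
    · obtain ⟨i, hi⟩ := h
      refine ⟨side (P i) (T i) ^^ b, fun j hj => ?_⟩
      have : j = i := Fin.ext (by omega)
      subst this
      simp
    · exact ⟨b, fun i hi => absurd ⟨i, hi⟩ h⟩
  obtain ⟨c, hc⟩ := hflip
  refine ⟨fun i => side (P i) (T i) ^^ c, fun p t s => ?_, fun p t p' t' h => ?_, hc⟩
  · simp only [(hP p t s).1, (hP p t s).2, (hP p t 0).1, (hP p t 0).2]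
  · simp only [(hP p t 0).1, (hP p t 0).2, (hP p' t' 0).1, (hP p' t' 0).2] at h
    exact hside p t p' t' (by simpa using h)

end Attachment

/-! ### Spine positions and pages outside the loops -/

section layout

variable (m : OctEdge → ℕ) (A : ∀ e, Attachment (m e))

/-- The vertices of the augmented octahedron outside the loops. -/
inductive BaseVertex : Type
  | oct (v : Fin 6)
  | path (e : OctEdge) (i : Fin (4 * m e))
  | hub (e : OctEdge) (p : Fin (m e)) (t : Fin 2)
  | root (e : OctEdge) (p : Fin (m e)) (t s : Fin 2)

/-- The edges of the augmented octahedron outside the loops. -/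
inductive BaseEdge : Type
  | first (e : OctEdge) (i : Fin (4 * m e)) (h : (i : ℕ) = 0)
  | step (e : OctEdge) (i j : Fin (4 * m e)) (h : (i : ℕ) + 1 = j)
  | last (e : OctEdge) (i : Fin (4 * m e)) (h : (i : ℕ) + 1 = 4 * m e)
  | endHub (e : OctEdge) (p : Fin (m e)) (t s : Fin 2)
  | endRoot (e : OctEdge) (p : Fin (m e)) (t s : Fin 2)
  | rootHub (e : OctEdge) (p : Fin (m e)) (t s : Fin 2)

instance : Finite (BaseVertex m) := by
  let f : Fin 6 ⊕ (Σ e, Fin (4 * m e)) ⊕ (Σ e, Fin (m e) × Fin 2) ⊕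
      (Σ e, Fin (m e) × Fin 2 × Fin 2) → BaseVertex m := fun x => match x with
    | .inl v => .oct v
    | .inr (.inl ⟨e, i⟩) => .path e i
    | .inr (.inr (.inl ⟨e, p, t⟩)) => .hub e p t
    | .inr (.inr (.inr ⟨e, p, t, s⟩)) => .root e p t s
  refine Finite.of_surjective f ?_
  rintro (v | ⟨e, i⟩ | ⟨e, p, t⟩ | ⟨e, p, t, s⟩)
  · exact ⟨.inl v, rfl⟩
  · exact ⟨.inr (.inl ⟨e, i⟩), rfl⟩
  · exact ⟨.inr (.inr (.inl ⟨e, p, t⟩)), rfl⟩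
  · exact ⟨.inr (.inr (.inr ⟨e, p, t, s⟩)), rfl⟩

variable {m}

/-- Tail of an edge. -/
def BaseEdge.src : BaseEdge m → BaseVertex m
  | first e _ _ => .oct e.1.1
  | step e i _ _ => .path e i
  | last e i _ => .path e i
  | endHub e p t s => .path e ((A e).pos (p, slot t s))
  | endRoot e p t s => .path e ((A e).pos (p, slot t s))
  | rootHub e p t s => .root e p t s

/-- Head of an edge. -/
def BaseEdge.tgt : BaseEdge m → BaseVertex m
  | first e i _ => .path e i
  | step e _ j _ => .path e j
  | last e _ _ => .oct e.1.2
  | endHub e p t _ => .hub e p t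
  | endRoot e p t s => .root e p t s
  | rootHub e p t _ => .hub e p t

/-- Position on the spine. -/
def BaseVertex.pos : BaseVertex m → ℕ ×ₗ ℕ
  | oct v => toLex (octRank v, 0)
  -- Spacing by three leaves room for a root and a hub directly after a path vertex. The root of
  -- each gadget end follows that end, and the hub follows the root of the first end.
  | path e i => toLex (edgeRank e, 3 * i)
  | hub e p t => toLex (edgeRank e, 3 * (A e).pos (p, slot t 0) + 2)
  | root e p t s => toLex (edgeRank e, 3 * (A e).pos (p, slot t s) + 1)

/-- Page of an edge, given the sides of the gadgets. -/
def BaseEdge.page (τ : ∀ e, Fin (4 * m e) → Bool) : BaseEdge m → Bool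
  | first e _ _ => endPage e false
  -- The root and hub after `path e i` send their edges out on page `τ e i`; the path edge over this
  -- gap must use the other page.
  | step e i _ _ => !τ e i
  | last e _ _ => endPage e true
  | endHub e p t s => τ e ((A e).pos (p, slot t s))
  | endRoot e p t s => τ e ((A e).pos (p, slot t s))
  | rootHub e p t s => τ e ((A e).pos (p, slot t s))

theorem BaseVertex.pos_injective : Function.Injective (BaseVertex.pos A) := by
  rintro (v | ⟨e, i⟩ | ⟨e, p, t⟩ | ⟨e, p, t, s⟩) (v' | ⟨e', i'⟩ | ⟨e', p', t'⟩ | ⟨e', p', t', s'⟩) h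
  all_goals
    simp only [BaseVertex.pos, EmbeddingLike.apply_eq_iff_eq, Prod.mk.injEq] at h
    obtain ⟨h1, h2⟩ := h
  · rw [octRank_injective h1]
  · exact absurd h1 (octRank_ne_edgeRank _ _)
  · exact absurd h1 (octRank_ne_edgeRank _ _)
  · exact absurd h1 (octRank_ne_edgeRank _ _)
  · exact absurd h1.symm (octRank_ne_edgeRank _ _)
  all_goals try exact absurd h1.symm (octRank_ne_edgeRank _ _)
  all_goals
    obtain rfl := edgeRank_injective h1
    try omega
  · rw [Fin.ext (by omega : (i : ℕ) = i')]
  · obtain ⟨rfl, rfl, -⟩ := (A e).pos_slot_eq (by omega :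
      ((A e).pos (p, slot t 0) : ℕ) = (A e).pos (p', slot t' 0))
    rfl
  · obtain ⟨rfl, rfl, rfl⟩ := (A e).pos_slot_eq (by omega :
      ((A e).pos (p, slot t s) : ℕ) = (A e).pos (p', slot t' s'))
    rfl

theorem BaseEdge.src_ne_tgt (d : BaseEdge m) : d.src A ≠ d.tgt := by
  cases d <;> simp [BaseEdge.src, BaseEdge.tgt, Fin.ext_iff]
  omega

/-- The layout must have no parallel edges on a page. The lemma also embeds the edges into pairs of
vertices, which shows that they are finite in number. -/
theorem BaseEdge.eq_of_ends {d d' : BaseEdge m} (h : s(d.src A, d.tgt) = s(d'.src A, d'.tgt)) :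
    d = d' := by
  rcases d with ⟨e, i, hi⟩ | ⟨e, i, j, hij⟩ | ⟨e, i, hi⟩ | ⟨e, p, t, s⟩ | ⟨e, p, t, s⟩ |
    ⟨e, p, t, s⟩ <;>
  rcases d' with ⟨e', i', hi'⟩ | ⟨e', i', j', hij'⟩ | ⟨e', i', hi'⟩ | ⟨e', p', t', s'⟩ |
    ⟨e', p', t', s'⟩ | ⟨e', p', t', s'⟩ <;>
  simp only [BaseEdge.src, BaseEdge.tgt, Sym2.eq_iff, reduceCtorEq, and_false, false_and, or_false,
    false_or, BaseVertex.path.injEq, BaseVertex.hub.injEq, BaseVertex.root.injEq,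
    BaseVertex.oct.injEq] at h
  · obtain ⟨-, rfl, h⟩ := h
    simpa using h
  · obtain ⟨h1, rfl, h2⟩ := h
    rw [heq_eq_eq] at h2; subst h2
    have := i.2
    omega
  · rcases h with ⟨⟨rfl, h1⟩, -, h2⟩ | ⟨⟨rfl, h1⟩, -, h2⟩
    · rw [heq_eq_eq] at h1 h2; subst h1 h2; rfl
    · rw [heq_eq_eq] at h1 h2; subst h1 h2; omega
  · obtain ⟨⟨rfl, h1⟩, h2⟩ := h
    rw [heq_eq_eq] at h1; subst h1
    have := i.2
    omega
  · obtain ⟨⟨rfl, h1⟩, -⟩ := h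
    rw [heq_eq_eq] at h1; subst h1; rfl
  · obtain ⟨⟨rfl, h1⟩, -, h2, h3⟩ := h
    rw [heq_eq_eq] at h1
    obtain ⟨rfl, rfl, rfl⟩ := (A e).pos_slot_eq (congrArg Fin.val h1)
    rfl
  · obtain ⟨-, rfl, h1, rfl, rfl⟩ := h
    rw [heq_eq_eq] at h1; subst h1; rfl
  · obtain ⟨⟨rfl, h1, rfl, rfl⟩, -⟩ := h
    rw [heq_eq_eq] at h1; subst h1; rfl

end layout

/-! ### Absence of crossings on each page -/

section layout

variable {m : OctEdge → ℕ} (A : ∀ e, Attachment (m e))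

/-- The edges inside the block of the edge `e`, described by the two local positions and the
page. -/
inductive InnerSpan (τ : ∀ e, Fin (4 * m e) → Bool) (e : OctEdge) : ℕ → ℕ → Bool → Prop
  | step (i j : Fin (4 * m e)) (h : (i : ℕ) + 1 = j) : InnerSpan τ e (3 * i) (3 * j) (!τ e i)
  | short (l : ℕ) (b : Bool) : InnerSpan τ e l (l + 1) b
  | corner (p : Fin (m e)) (t : Fin 2) : InnerSpan τ e (3 * (A e).pos (p, slot t 0))
      (3 * (A e).pos (p, slot t 0) + 2) (τ e ((A e).pos (p, slot t 0)))
  -- Edges from the hub to the far end (`δ = 0`) or to the far root (`δ = 1`).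
  | long (p : Fin (m e)) (t : Fin 2) (δ : ℕ) (hδ : δ ≤ 1) :
      InnerSpan τ e (3 * (A e).pos (p, slot t 0) + 2)
      (3 * (A e).pos (p, slot t 1) + δ) (τ e ((A e).pos (p, slot t 1)))

variable {A} {τ : ∀ e, Fin (4 * m e) → Bool}
  (hτ : ∀ e p t s, τ e ((A e).pos (p, slot t s)) = τ e ((A e).pos (p, slot t 0)))
  (hcross : ∀ e p t p' t', τ e ((A e).pos (p, slot t 0)) = τ e ((A e).pos (p', slot t' 0)) →
      ¬ ((A e).pos (p, slot t 0) < (A e).pos (p', slot t' 0) ∧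
        (A e).pos (p', slot t' 0) < (A e).pos (p, slot t 1) ∧
        (A e).pos (p, slot t 1) < (A e).pos (p', slot t' 1)))
  (hlast : ∀ e, ∀ i : Fin (4 * m e), (i : ℕ) + 1 = 4 * m e → τ e i = !endPage e true)

-- A path edge and a long edge could cross only if the gadget had an end at the start of the path
-- edge, but then they are on different pages. Two long edges cross only if their gadgets
-- interleave, which `hcross` excludes.
include hτ hcross in
theorem InnerSpan.noncrossing {e : OctEdge} {l h l' h' : ℕ} {b : Bool}
    (H : InnerSpan A τ e l h b) (H' : InnerSpan A τ e l' h' b) :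
    ¬ (l < l' ∧ l' < h ∧ h < h') := by
  have hne : ∀ p t p' t', ((A e).pos (p, slot t 0) : ℕ) ≠ (A e).pos (p', slot t' 1) := by
    intro p t p' t' h
    exact absurd ((A e).pos_slot_eq h).2.2 (by decide)
  have hpg : ∀ i j : Fin (4 * m e), (!τ e i) = τ e j → (i : ℕ) ≠ j := by
    intro i j h hij
    rw [Fin.ext hij] at h
    simp at h
  generalize hb : b = b' at H'
  cases H with
  | step i j hij =>
    cases H' with
    | step i' j' hij' => omega
    | short => omega
    | corner p' t' => omega
    | long p' t' δ hδ =>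
      rw [hτ] at hb
      have := hpg _ _ hb
      omega
  | short => omega
  | corner p t =>
    cases H' with
    | step i' j' hij' => omega
    | short => omega
    | corner p' t' => omega
    | long p' t' δ hδ => omega
  | long p t δ hδ =>
    have h1 := (A e).pos_slot_lt p t
    cases H' with
    | step i' j' hij' =>
      have := hpg _ _ hb.symm
      omega
    | short => omega
    | corner p' t' =>
      have := hne p' t' p t
      omega
    | long p' t' δ' hδ' =>
      have h2 := (A e).pos_slot_lt p' t'
      have h3 := hne p' t' p t
      have h5 : ((A e).pos (p, slot t 1) : ℕ) = (A e).pos (p', slot t' 1) →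
          ((A e).pos (p, slot t 0) : ℕ) = (A e).pos (p', slot t' 0) := by
        intro hh
        obtain ⟨rfl, rfl, -⟩ := (A e).pos_slot_eq hh
        rfl
      rw [hτ, hτ e p' t' 1] at hb
      have h4 := hcross e p t p' t' hb
      simp only [Fin.lt_def] at h4
      omega

-- The root after the last path vertex lies further right, so its long edge passes over that vertex.
-- By `hlast` it does so on the page not used by the last edge.
include hlast in
theorem InnerSpan.last {e : OctEdge} {l h : ℕ} (H : InnerSpan A τ e l h (endPage e true))
    {i : Fin (4 * m e)} (hi : (i : ℕ) + 1 = 4 * m e) : 3 * (i : ℕ) ≤ l ∨ h ≤ 3 * i := by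
  generalize hb : endPage e true = b at H
  cases H with
  | step i' j' hij' => have := j'.2; omega
  | short => omega
  | corner p t => have := ((A e).pos (p, slot t 0)).2; omega
  | long p t δ hδ =>
    right
    have h1 := ((A e).pos (p, slot t 1)).2
    by_cases hh : ((A e).pos (p, slot t 1) : ℕ) = i
    · rw [Fin.ext hh, hlast e i hi] at hb
      simp at hb
    · omega

theorem InnerSpan.lt {e : OctEdge} {l h : ℕ} {b : Bool} (H : InnerSpan A τ e l h b) : l < h := by
  cases H with
  | step i j hij => omega
  | short => omega
  | corner p t => omega
  | long p t δ hδ => have := (A e).pos_slot_lt p t; omega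

/-- Position of an end of an end edge: an octahedron vertex or an end of a path. -/
def endPos (m : OctEdge → ℕ) : Fin 6 ⊕ OctEdge × Bool → ℕ ×ₗ ℕ
  | .inl v => toLex (octRank v, 0)
  | .inr (e, β) => toLex (edgeRank e, if β then 3 * (4 * m e - 1) else 0)

/-- Simplified position of an end of an end edge. -/
def endRank : Fin 6 ⊕ OctEdge × Bool → ℕ
  | .inl v => 2 * octRank v
  | .inr (e, β) => 2 * edgeRank e + β.toNat

/-- With `Interleaved.imp` this removes the path lengths from the crossing test for end edges. -/
theorem endRank_lt (x y : Fin 6 ⊕ OctEdge × Bool) (h : endPos m x < endPos m y) :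
    endRank x < endRank y := by
  rcases x with v | ⟨e, β⟩ <;> rcases y with v' | ⟨e', β'⟩ <;>
    simp only [endPos, Prod.Lex.toLex_lt_toLex, endRank] at h ⊢
  · omega
  · have := octRank_ne_edgeRank v e'
    omega
  · have := octRank_ne_edgeRank v' e
    have := β.toNat_le
    omega
  · rcases h with h | ⟨h1, h2⟩
    · have := β.toNat_le
      omega
    · obtain rfl := edgeRank_injective h1
      cases β <;> cases β' <;> simp at h2 ⊢

/-- Every edge outside the loops is inside a block or joins a block to an octahedron vertex. -/
theorem BaseEdge.span_or_end (d : BaseEdge m) :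
    (∃ e l h, InnerSpan A τ e l h (d.page A τ) ∧
      (((d.src A).pos A = toLex (edgeRank e, l) ∧ d.tgt.pos A = toLex (edgeRank e, h)) ∨
        ((d.src A).pos A = toLex (edgeRank e, h) ∧ d.tgt.pos A = toLex (edgeRank e, l)))) ∨
    (∃ e β, d.page A τ = endPage e β ∧ 0 < m e ∧
      (((d.src A).pos A = endPos m (.inl (octEnd e β)) ∧ d.tgt.pos A = endPos m (.inr (e, β))) ∨
        ((d.src A).pos A = endPos m (.inr (e, β)) ∧
          d.tgt.pos A = endPos m (.inl (octEnd e β))))) := by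
  rcases d with ⟨e, i, hi⟩ | ⟨e, i, j, hij⟩ | ⟨e, i, hi⟩ | ⟨e, p, t, s⟩ | ⟨e, p, t, s⟩ |
    ⟨e, p, t, s⟩
  · refine Or.inr ⟨e, false, rfl, by have := i.2; omega, Or.inl ⟨rfl, ?_⟩⟩
    simp [BaseEdge.tgt, BaseVertex.pos, endPos, hi]
  · exact Or.inl ⟨e, _, _, .step i j hij, Or.inl ⟨rfl, rfl⟩⟩
  · refine Or.inr ⟨e, true, rfl, by have := i.2; omega, Or.inr ⟨?_, rfl⟩⟩
    have : (i : ℕ) = 4 * m e - 1 := by omega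
    simp [BaseEdge.src, BaseVertex.pos, endPos, this]
  · left
    fin_cases s
    · exact ⟨e, _, _, .corner p t, Or.inl ⟨rfl, rfl⟩⟩
    · exact ⟨e, _, _, .long p t 0 (by omega), Or.inr ⟨rfl, rfl⟩⟩
  · exact Or.inl ⟨e, _, _, .short _ _, Or.inl ⟨rfl, rfl⟩⟩
  · left
    fin_cases s
    · exact ⟨e, _, _, .short _ _, Or.inl ⟨rfl, rfl⟩⟩
    · exact ⟨e, _, _, .long p t 1 le_rfl, Or.inr ⟨rfl, rfl⟩⟩

theorem Interleaved.swap_left {α : Type*} [LinearOrder α] {a b c d : α}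
    (h : Interleaved a b c d) : Interleaved b a c d := by
  rw [interleaved_iff] at *
  rwa [min_comm b, max_comm b]

theorem Interleaved.swap_right {α : Type*} [LinearOrder α] {a b c d : α}
    (h : Interleaved a b c d) : Interleaved a b d c := by
  rw [interleaved_iff] at *
  rwa [min_comm d, max_comm d]

theorem not_interleaved_of_cases {α : Type*} [LinearOrder α] {a b c d a' b' c' d' : α}
    (h : (a = a' ∧ b = b') ∨ (a = b' ∧ b = a')) (h' : (c = c' ∧ d = d') ∨ (c = d' ∧ d = c'))
    (hn : ¬ Interleaved a' b' c' d') : ¬ Interleaved a b c d := by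
  rintro hi
  rcases h with ⟨rfl, rfl⟩ | ⟨rfl, rfl⟩ <;> rcases h' with ⟨rfl, rfl⟩ | ⟨rfl, rfl⟩
  · exact hn hi
  · exact hn hi.swap_right
  · exact hn hi.swap_left
  · exact hn hi.swap_left.swap_right

theorem outside_of_rank_ne {r r' : ℕ} (h : r ≠ r') (x l u : ℕ) :
    (toLex (r, x) ≤ toLex (r', l) ∧ toLex (r, x) ≤ toLex (r', u)) ∨
      (toLex (r', l) ≤ toLex (r, x) ∧ toLex (r', u) ≤ toLex (r, x)) := by
  simp only [Prod.Lex.toLex_le_toLex]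
  omega

-- The octahedron end lies outside the block. The path end is the leftmost point of its block, or it
-- is not passed over on this page by `InnerSpan.last`.
include hlast in
theorem InnerSpan.not_interleaved_end {e e' : OctEdge} {l h : ℕ} {β : Bool}
    (H : InnerSpan A τ e l h (endPage e' β)) (hm : 0 < m e') :
    ¬ Interleaved (toLex (edgeRank e, l)) (toLex (edgeRank e, h))
      (endPos m (.inl (octEnd e' β))) (endPos m (.inr (e', β))) ∧
    ¬ Interleaved (endPos m (.inl (octEnd e' β))) (endPos m (.inr (e', β)))
      (toLex (edgeRank e, l)) (toLex (edgeRank e, h)) := by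
  apply not_interleaved_of_outside
  · exact outside_of_rank_ne (octRank_ne_edgeRank _ _) _ _ _
  · by_cases hee : e' = e
    · subst hee
      cases β
      · left
        simp [endPos, Prod.Lex.toLex_le_toLex]
      · have h1 := H.lt
        have h2 := InnerSpan.last hlast H (i := ⟨4 * m e' - 1, by omega⟩)
          (by simp only; omega)
        simp only [endPos, Prod.Lex.toLex_le_toLex, if_true, lt_irrefl, true_and, false_or]
        simp only at h2
        omega
    · exact outside_of_rank_ne (fun h => hee (edgeRank_injective h)) _ _ _

include hτ hcross hlast in
theorem BaseEdge.noncrossing {d d' : BaseEdge m} (h : d.page A τ = d'.page A τ) :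
    ¬ Interleaved ((d.src A).pos A) (d.tgt.pos A) ((d'.src A).pos A) (d'.tgt.pos A) := by
  rcases d.span_or_end (A := A) (τ := τ) with ⟨e, l, u, H, hd⟩ | ⟨e, β, hp, hm, hd⟩ <;>
    rcases d'.span_or_end (A := A) (τ := τ) with ⟨e', l', u', H', hd'⟩ | ⟨e', β', hp', hm', hd'⟩
  · refine not_interleaved_of_cases hd hd' ?_
    by_cases hee : e' = e
    · subst hee
      intro hi
      rw [interleaved_iff] at hi
      have h1 := H.lt
      have h2 := H'.lt
      have h3 := (h ▸ H).noncrossing hτ hcross H'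
      have e1 : toLex (edgeRank e', l) ≤ toLex (edgeRank e', u) := by
        rw [Prod.Lex.toLex_le_toLex]; exact Or.inr ⟨rfl, h1.le⟩
      have e2 : toLex (edgeRank e', l') ≤ toLex (edgeRank e', u') := by
        rw [Prod.Lex.toLex_le_toLex]; exact Or.inr ⟨rfl, h2.le⟩
      rw [min_eq_left e1, min_eq_left e2, max_eq_right e1, max_eq_right e2] at hi
      simp only [Prod.Lex.toLex_lt_toLex, lt_irrefl, true_and, false_or] at hi
      exact h3 hi
    · have hne : edgeRank e' ≠ edgeRank e := fun h => hee (edgeRank_injective h)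
      exact (not_interleaved_of_outside (outside_of_rank_ne hne _ _ _)
        (outside_of_rank_ne hne _ _ _)).1
  · rw [h, hp'] at H
    exact not_interleaved_of_cases hd hd' (H.not_interleaved_end hlast hm').1
  · rw [← h, hp] at H'
    exact not_interleaved_of_cases hd hd' (H'.not_interleaved_end hlast hm).2
  · refine not_interleaved_of_cases hd hd' fun hi => ?_
    exact endPage_noncrossing e β e' β' (hp.symm.trans (h.trans hp')) (hi.imp endRank_lt)

end layout

/-! ### Planarity of augmented octahedra -/

section planar

variable {m : OctEdge → ℕ} (A : ∀ e, Attachment (m e))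
  (L : ∀ e, Fin (m e) → Fin 2 → Fin 2 → LoopPiece)

/-- The two-page layout of the part of the augmented octahedron outside the loops, with the property
that the edges at each root are on the same page. -/
theorem exists_twoPage : ∃ (B : TwoPage (BaseEdge.src A) BaseEdge.tgt (ℕ ×ₗ ℕ))
    (pg : (Σ e, Fin (m e) × Fin 2 × Fin 2) → Bool), ∀ x d,
    BaseEdge.src A d = .root x.1 x.2.1 x.2.2.1 x.2.2.2 ∨
      BaseEdge.tgt d = .root x.1 x.2.1 x.2.2.1 x.2.2.2 → B.page d = pg x := by
  -- Nothing in a block precedes the first path vertex, so only the side at the last vertex needs to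
  -- be prescribed.
  choose τ hτ hcross hlast using fun e => (A e).exists_side (!endPage e true)
  refine ⟨⟨BaseVertex.pos A, BaseEdge.page A τ, BaseVertex.pos_injective A, BaseEdge.src_ne_tgt A,
    fun d d' _ h => BaseEdge.eq_of_ends A h, fun d d' h hi => ?_⟩,
    fun x => τ x.1 ((A x.1).pos (x.2.1, slot x.2.2.1 x.2.2.2)), ?_⟩
  · exact BaseEdge.noncrossing hτ hcross hlast h ((interleaved_iff _ _ _ _).2 hi)
  · rintro ⟨e, p, t, s⟩ d h
    rcases d with ⟨e', i, hi⟩ | ⟨e', i, j, hij⟩ | ⟨e', i, hi⟩ | ⟨e', p', t', s'⟩ |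
      ⟨e', p', t', s'⟩ | ⟨e', p', t', s'⟩ <;>
    simp only [BaseEdge.src, BaseEdge.tgt, reduceCtorEq, or_false, false_or,
      BaseVertex.root.injEq] at h
    · obtain ⟨rfl, h1, rfl, rfl⟩ := h
      rw [heq_eq_eq] at h1; subst h1; rfl
    · obtain ⟨rfl, h1, rfl, rfl⟩ := h
      rw [heq_eq_eq] at h1; subst h1; rfl

/-- The vertices of the augmented octahedron as vertices of the base or of a loop. -/
def AugVertex.toSum : AugVertex m L →
    BaseVertex m ⊕ Σ x : (Σ e, Fin (m e) × Fin 2 × Fin 2), (L x.1 x.2.1 x.2.2.1 x.2.2.2).V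
  | oct v => .inl (.oct v)
  | path e i => .inl (.path e i)
  | hub e p t => .inl (.hub e p t)
  | root e p t s => .inl (.root e p t s)
  | loop e p t s x => .inr ⟨⟨e, p, t, s⟩, x⟩

theorem AugVertex.toSum_injective : Function.Injective (AugVertex.toSum L) := by
  rintro (v | ⟨e, i⟩ | ⟨e, p, t⟩ | ⟨e, p, t, s⟩ | ⟨e, p, t, s, x⟩)
    (v' | ⟨e', i'⟩ | ⟨e', p', t'⟩ | ⟨e', p', t', s'⟩ | ⟨e', p', t', s', x'⟩) h <;>
  simp only [AugVertex.toSum, Sum.inl.injEq, Sum.inr.injEq, reduceCtorEq, BaseVertex.oct.injEq,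
    BaseVertex.path.injEq, BaseVertex.hub.injEq, BaseVertex.root.injEq] at h
  · rw [h]
  · obtain ⟨rfl, h⟩ := h
    rw [heq_eq_eq] at h; rw [h]
  · obtain ⟨rfl, h, rfl⟩ := h
    rw [heq_eq_eq] at h; rw [h]
  · obtain ⟨rfl, h, rfl, rfl⟩ := h
    rw [heq_eq_eq] at h; rw [h]
  · cases h
    rfl

theorem augGraph_isPlanar (hL : ∀ e p t s, (L e p t s).Admissible) :
    (augGraph m A L).IsPlanar := by
  obtain ⟨B, pg, hpg⟩ := exists_twoPage A
  let ι := Σ e, Fin (m e) × Fin 2 × Fin 2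
  let L' : ι → LoopPiece := fun x => L x.1 x.2.1 x.2.2.1 x.2.2.2
  let r : ι → BaseVertex m := fun x => .root x.1 x.2.1 x.2.2.1 x.2.2.2
  have hr : Function.Injective r := by
    rintro ⟨e, p, t, s⟩ ⟨e', p', t', s'⟩ h
    simp only [r, BaseVertex.root.injEq] at h
    obtain ⟨rfl, h, rfl, rfl⟩ := h
    rw [heq_eq_eq] at h; rw [h]
  have hdraw : ∀ x : ι, _ := fun x =>
    haveI := (hL x.1 x.2.1 x.2.2.1 x.2.2.2).finite
    exists_loop_drawing (hL x.1 x.2.1 x.2.2.1 x.2.2.2).planar (hL x.1 x.2.1 x.2.2.1 x.2.2.2).adj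
  choose E' src' tgt' F hedge ha hb hroot hpt harc using hdraw
  have : Finite (BaseEdge m) :=
    Finite.of_injective (fun d : BaseEdge m => s(d.src A, d.tgt)) fun d d' h =>
      BaseEdge.eq_of_ends A h
  have : Finite ι := inferInstanceAs (Finite (Σ e, Fin (m e) × Fin 2 × Fin 2))
  have : Countable (ℕ ×ₗ ℕ) := inferInstanceAs (Countable (ℕ × ℕ))
  obtain ⟨D⟩ := B.attach r hr pg hpg F hroot hpt harc
  refine D.isPlanar (augGraph m A L) (AugVertex.toSum L) (AugVertex.toSum_injective L) ?_
  have key : ∀ u v, AugEdge m A L u v → ∃ d,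
      s((Sum.elim (fun e => Sum.inl (BaseEdge.src A e))
          (fun x : (Σ i, E' i) => attachVertex r x.1 (src' x.1 x.2))) d,
        (Sum.elim (fun e => Sum.inl (BaseEdge.tgt e))
          (fun x : (Σ i, E' i) => attachVertex r x.1 (tgt' x.1 x.2))) d) =
      s(AugVertex.toSum L u, AugVertex.toSum L v) := by
    have hloop : ∀ (x : ι) o o', (∃ e, s(src' x e, tgt' x e) = s(o, o')) →
        ∃ d, s((Sum.elim (fun e => Sum.inl (BaseEdge.src A e))
            (fun x : (Σ i, E' i) => attachVertex r x.1 (src' x.1 x.2))) d,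
          (Sum.elim (fun e => Sum.inl (BaseEdge.tgt e))
            (fun x : (Σ i, E' i) => attachVertex r x.1 (tgt' x.1 x.2))) d) =
        s(attachVertex (W := fun x => (L' x).V) r x o,
          attachVertex (W := fun x => (L' x).V) r x o') := by
      rintro x o o' ⟨e, he⟩
      refine ⟨Sum.inr ⟨x, e⟩, ?_⟩
      have := congrArg (Sym2.map (attachVertex (W := fun x => (L' x).V) r x)) he
      rw [Sym2.map_mk, Sym2.map_mk] at this
      exact this
    intro u v h
    cases h with
    | first e i h => exact ⟨.inl (.first e i h), rfl⟩
    | step e i j h => exact ⟨.inl (.step e i j h), rfl⟩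
    | last e i h => exact ⟨.inl (.last e i h), rfl⟩
    | endHub e p t s => exact ⟨.inl (.endHub e p t s), rfl⟩
    | endRoot e p t s => exact ⟨.inl (.endRoot e p t s), rfl⟩
    | rootHub e p t s => exact ⟨.inl (.rootHub e p t s), rfl⟩
    | rootA e p t s => exact hloop ⟨e, p, t, s⟩ _ _ (ha ⟨e, p, t, s⟩)
    | rootB e p t s => exact hloop ⟨e, p, t, s⟩ _ _ (hb ⟨e, p, t, s⟩)
    | inner e p t s x y h hne =>
      exact hloop ⟨e, p, t, s⟩ _ _ (hedge ⟨e, p, t, s⟩ x y h hne)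
  intro u v h
  rcases ((SimpleGraph.fromRel_adj _ _ _).1 h).2 with h | h
  · exact key u v h
  · rw [Sym2.eq_swap]
    exact key v u h

end planar

/-! ### Neighbourhoods in the augmented octahedron -/

section neighbours

variable {m : OctEdge → ℕ} {A : ∀ e, Attachment (m e)}
  {L : ∀ e, Fin (m e) → Fin 2 → Fin 2 → LoopPiece}

theorem AugEdge.ne {u v : AugVertex m L} (h : AugEdge m A L u v) : u ≠ v := by
  cases h with
  | step e i j h =>
    simp only [ne_eq, AugVertex.path.injEq, heq_eq_eq, true_and]
    rintro rfl
    omega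
  | inner e p t s x y h hne =>
    simp only [ne_eq, AugVertex.loop.injEq, heq_eq_eq, true_and]
    exact h.ne
  | _ => simp

theorem augGraph_adj {u v : AugVertex m L} :
    (augGraph m A L).Adj u v ↔ AugEdge m A L u v ∨ AugEdge m A L v u := by
  rw [augGraph, SimpleGraph.fromRel_adj]
  exact ⟨fun h => h.2, fun h => ⟨h.elim (fun h => h.ne) fun h => h.ne.symm, h⟩⟩

/-- The vertex before `path e i`. -/
def predVertex (L : ∀ e, Fin (m e) → Fin 2 → Fin 2 → LoopPiece) (e : OctEdge)
    (i : Fin (4 * m e)) : AugVertex m L :=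
  if (i : ℕ) = 0 then .oct e.1.1 else .path e ⟨i - 1, by omega⟩

/-- The vertex after `path e i`. -/
def succVertex (L : ∀ e, Fin (m e) → Fin 2 → Fin 2 → LoopPiece) (e : OctEdge)
    (i : Fin (4 * m e)) : AugVertex m L :=
  if h : (i : ℕ) + 1 < 4 * m e then .path e ⟨i + 1, h⟩ else .oct e.1.2

theorem predVertex_ne_succVertex (e : OctEdge) (i : Fin (4 * m e)) :
    predVertex L e i ≠ succVertex L e i := by
  unfold predVertex succVertex
  split_ifs <;> simp
  exact (e.2.1).ne

theorem path_adj {e : OctEdge} {i : Fin (4 * m e)} {p : Fin (m e)} {t s : Fin 2}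
    (hi : (A e).pos (p, slot t s) = i) (v : AugVertex m L) :
    (augGraph m A L).Adj (.path e i) v ↔
      v = predVertex L e i ∨ v = succVertex L e i ∨ v = .hub e p t ∨ v = .root e p t s := by
  rw [augGraph_adj]
  constructor
  · rintro (h | h)
    · cases h with
      | step _ _ j h =>
        right; left
        unfold succVertex
        have hj : (i : ℕ) + 1 < 4 * m e := h ▸ j.2
        rw [dif_pos hj]
        congr 1
        exact Fin.ext h.symm
      | last _ _ h =>
        right; left
        unfold succVertex
        rw [dif_neg (by omega)]
      | endHub _ p' t' s' =>
        obtain ⟨rfl, rfl, rfl⟩ := (A e).pos_slot_eq (congrArg Fin.val hi)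
        simp
      | endRoot _ p' t' s' =>
        obtain ⟨rfl, rfl, rfl⟩ := (A e).pos_slot_eq (congrArg Fin.val hi)
        simp
    · cases h with
      | first _ _ h => left; unfold predVertex; rw [if_pos h]
      | step _ j _ h =>
        left
        unfold predVertex
        rw [if_neg (by omega)]
        congr 1
        exact Fin.ext (by simp only; omega)
  · rintro (rfl | rfl | rfl | rfl)
    · right
      unfold predVertex
      split_ifs with h
      · exact .first e i h
      · exact .step e _ _ (by simp only; omega)
    · left
      unfold succVertex
      split_ifs with h
      · exact .step e _ _ rfl
      · exact .last e i (by omega)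
    · left; rw [← hi]; exact .endHub e p t s
    · left; rw [← hi]; exact .endRoot e p t s

theorem hub_adj {e : OctEdge} {p : Fin (m e)} {t : Fin 2} (v : AugVertex m L) :
    (augGraph m A L).Adj (.hub e p t) v ↔
      v = .path e ((A e).pos (p, slot t 0)) ∨ v = .path e ((A e).pos (p, slot t 1)) ∨
      v = .root e p t 0 ∨ v = .root e p t 1 := by
  rw [augGraph_adj]
  constructor
  · rintro (h | h)
    · cases h
    · cases h with
      | endHub _ _ _ s => fin_cases s <;> simp
      | rootHub _ _ _ s => fin_cases s <;> simp
  · rintro (rfl | rfl | rfl | rfl)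
    · exact Or.inr (.endHub e p t 0)
    · exact Or.inr (.endHub e p t 1)
    · exact Or.inr (.rootHub e p t 0)
    · exact Or.inr (.rootHub e p t 1)

theorem root_adj {e : OctEdge} {p : Fin (m e)} {t s : Fin 2} (v : AugVertex m L) :
    (augGraph m A L).Adj (.root e p t s) v ↔
      v = .path e ((A e).pos (p, slot t s)) ∨ v = .hub e p t ∨
      v = .loop e p t s (L e p t s).a ∨ v = .loop e p t s (L e p t s).b := by
  rw [augGraph_adj]
  constructor
  · rintro (h | h)
    · cases h <;> simp
    · cases h; simp
  · rintro (rfl | rfl | rfl | rfl)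
    · exact Or.inr (.endRoot e p t s)
    · exact Or.inl (.rootHub e p t s)
    · exact Or.inl (.rootA e p t s)
    · exact Or.inl (.rootB e p t s)

open Classical in
/-- The neighbour of `loop e p t s x` that corresponds to the neighbour `y` of `x`. -/
noncomputable def loopNeighbour (L : ∀ e, Fin (m e) → Fin 2 → Fin 2 → LoopPiece) (e : OctEdge)
    (p : Fin (m e)) (t s : Fin 2) (x y : (L e p t s).V) : AugVertex m L :=
  if s(x, y) = s((L e p t s).a, (L e p t s).b) then .root e p t s else .loop e p t s y

/-- Subdividing `ab` merely replaces `b` by the root as a neighbour of `a`, and `a` as a neighbour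
of `b`; degrees are inherited from the piece. -/
theorem loop_neighborSet (hL : ∀ e p t s, (L e p t s).Admissible) {e : OctEdge} {p : Fin (m e)}
    {t s : Fin 2} (x : (L e p t s).V) :
    (augGraph m A L).neighborSet (.loop e p t s x) =
      loopNeighbour L e p t s x '' (L e p t s).graph.neighborSet x := by
  have hab := (hL e p t s).adj
  ext v
  rw [SimpleGraph.mem_neighborSet, augGraph_adj, Set.mem_image]
  simp only [SimpleGraph.mem_neighborSet, loopNeighbour]
  constructor
  · rintro (h | h)
    · cases h with
      | inner _ _ _ _ _ y h hne => exact ⟨y, h, by rw [if_neg hne]⟩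
    · cases h with
      | rootA => exact ⟨(L e p t s).b, hab, by rw [if_pos rfl]⟩
      | rootB => exact ⟨(L e p t s).a, hab.symm, by rw [if_pos Sym2.eq_swap]⟩
      | inner _ _ _ _ y _ h hne => exact ⟨y, h.symm, by rw [if_neg (Sym2.eq_swap ▸ hne)]⟩
  · rintro ⟨y, hy, rfl⟩
    split_ifs with h
    · right
      rcases Sym2.eq_iff.1 h with ⟨rfl, rfl⟩ | ⟨rfl, rfl⟩
      · exact .rootA e p t s
      · exact .rootB e p t s
    · exact Or.inl (.inner e p t s x y hy h)

/-- The neighbour of `oct v` on the path towards `w`. -/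
def octNeighbour (L : ∀ e, Fin (m e) → Fin 2 → Fin 2 → LoopPiece) (hm : ∀ e, 0 < m e)
    (v : Fin 6) (w : {w // octahedron.Adj v w}) : AugVertex m L :=
  if h : v < w.1 then .path ⟨(v, w.1), h, w.2⟩ ⟨0, by have := hm ⟨(v, w.1), h, w.2⟩; omega⟩
  else .path ⟨(w.1, v), lt_of_le_of_ne (not_lt.1 h) w.2.1.symm, w.2.symm⟩
    ⟨4 * m ⟨(w.1, v), lt_of_le_of_ne (not_lt.1 h) w.2.1.symm, w.2.symm⟩ - 1, by
      have := hm ⟨(w.1, v), lt_of_le_of_ne (not_lt.1 h) w.2.1.symm, w.2.symm⟩; omega⟩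

theorem octNeighbour_injective (hm : ∀ e, 0 < m e) (v : Fin 6) :
    Function.Injective (octNeighbour L hm v) := by
  rintro ⟨w, hw⟩ ⟨w', hw'⟩ h
  unfold octNeighbour at h
  split_ifs at h with h1 h2 h2 <;>
    simp only [AugVertex.path.injEq, Subtype.mk.injEq, Prod.mk.injEq] at h ⊢
  · exact h.1.2
  · exact absurd h.1.2.symm hw.1
  · exact absurd h.1.1.symm hw.1
  · exact h.1.1

theorem oct_neighborSet (hm : ∀ e, 0 < m e) (v : Fin 6) :
    (augGraph m A L).neighborSet (.oct v) = Set.range (octNeighbour L hm v) := by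
  ext x
  rw [SimpleGraph.mem_neighborSet, augGraph_adj, Set.mem_range]
  constructor
  · rintro (h | h)
    · cases h with
      | first e i h =>
        refine ⟨⟨e.1.2, e.2.2⟩, ?_⟩
        unfold octNeighbour
        rw [dif_pos e.2.1]
        congr 1
        exact Fin.ext h.symm
    · cases h with
      | last e i h =>
        refine ⟨⟨e.1.1, e.2.2.symm⟩, ?_⟩
        unfold octNeighbour
        rw [dif_neg (not_lt.2 e.2.1.le)]
        congr 1
        exact Fin.ext (show 4 * m e - 1 = (i : ℕ) by omega)
  · rintro ⟨⟨w, hw⟩, rfl⟩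
    unfold octNeighbour
    split_ifs with h
    · exact Or.inl (.first ⟨(v, w), h, hw⟩ _ rfl)
    · refine Or.inr (.last ⟨(w, v), lt_of_le_of_ne (not_lt.1 h) hw.1.symm, hw.symm⟩ _ ?_)
      have := hm ⟨(w, v), lt_of_le_of_ne (not_lt.1 h) hw.1.symm, hw.symm⟩
      simp only
      omega

theorem Attachment.two_le {m : ℕ} (A : Attachment m) : 2 ≤ m := by
  obtain ⟨p, q, h1, h2, h3⟩ := A.interlaced
  have hpq : p ≠ q := by
    rintro rfl
    exact absurd (h1.trans (A.nested p (by decide : (0 : Fin 4) < 1))) (lt_irrefl _)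
  have := p.2
  have := q.2
  have : (p : ℕ) ≠ q := fun h => hpq (Fin.ext h)
  omega

theorem ncard_four {α : Type*} {a b c d : α} (h1 : a ≠ b) (h2 : a ≠ c) (h3 : a ≠ d) (h4 : b ≠ c)
    (h5 : b ≠ d) (h6 : c ≠ d) : ({a, b, c, d} : Set α).ncard = 4 := by
  rw [Set.ncard_insert_of_notMem (by simp [h1, h2, h3]),
    Set.ncard_insert_of_notMem (by simp [h4, h5]), Set.ncard_pair h6]

theorem path_distinct (e : OctEdge) (i : Fin (4 * m e)) (p : Fin (m e)) (t s : Fin 2) :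
    predVertex L e i ≠ succVertex L e i ∧ predVertex L e i ≠ .hub e p t ∧
    predVertex L e i ≠ .root e p t s ∧ succVertex L e i ≠ .hub e p t ∧
    succVertex L e i ≠ .root e p t s ∧ (AugVertex.hub e p t : AugVertex m L) ≠ .root e p t s := by
  refine ⟨predVertex_ne_succVertex e i, ?_, ?_, ?_, ?_, by simp⟩ <;>
    first
      | unfold predVertex; split_ifs <;> simp
      | unfold succVertex; split_ifs <;> simp

theorem augGraph_isFourRegular (hL : ∀ e p t s, (L e p t s).Admissible) :
    (augGraph m A L).IsFourRegular := by
  have hm : ∀ e, 0 < m e := fun e => by have := (A e).two_le; omega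
  rintro (v | ⟨e, i⟩ | ⟨e, p, t⟩ | ⟨e, p, t, s⟩ | ⟨e, p, t, s, x⟩)
  · rw [oct_neighborSet hm, ← Set.image_univ,
      Set.ncard_image_of_injective _ (octNeighbour_injective hm v), Set.ncard_univ,
      Nat.card_eq_fintype_card]
    revert v
    decide
  · obtain ⟨p, t, s, hi⟩ := (A e).exists_slot i
    have : (augGraph m A L).neighborSet (.path e i) =
        {predVertex L e i, succVertex L e i, .hub e p t, .root e p t s} := by
      ext v
      exact path_adj hi v
    rw [this]
    obtain ⟨h1, h2, h3, h4, h5, h6⟩ := path_distinct (L := L) e i p t s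
    exact ncard_four h1 h2 h3 h4 h5 h6
  · have : (augGraph m A L).neighborSet (.hub e p t) =
        {.path e ((A e).pos (p, slot t 0)), .path e ((A e).pos (p, slot t 1)), .root e p t 0,
          .root e p t 1} := by
      ext v
      exact hub_adj v
    rw [this]
    have := (A e).pos_slot_lt p t
    refine ncard_four ?_ ?_ ?_ ?_ ?_ ?_ <;> simp [Fin.ext_iff]
    omega
  · have : (augGraph m A L).neighborSet (.root e p t s) =
        {.path e ((A e).pos (p, slot t s)), .hub e p t, .loop e p t s (L e p t s).a,
          .loop e p t s (L e p t s).b} := by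
      ext v
      exact root_adj v
    rw [this]
    have := (hL e p t s).adj.ne
    refine ncard_four ?_ ?_ ?_ ?_ ?_ ?_ <;> simp [this]
  · rw [loop_neighborSet hL, Set.InjOn.ncard_image, (hL e p t s).regular x]
    intro y hy z hz h
    simp only [loopNeighbour] at h
    split_ifs at h with h1 h2 h2
    -- Both neighbours become the root, so each completes `x` to the marked edge and they coincide.
    · exact Sym2.congr_right.1 (h1.trans h2.symm)
    · simpa using h

theorem augVertex_finite (hL : ∀ e p t s, (L e p t s).Admissible) : Finite (AugVertex m L) := by
  have : ∀ x : (Σ e, Fin (m e) × Fin 2 × Fin 2), Finite (L x.1 x.2.1 x.2.2.1 x.2.2.2).V :=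
    fun x => (hL _ _ _ _).finite
  exact Finite.of_injective _ (AugVertex.toSum_injective L)

end neighbours

/-! ### Connectedness of augmented octahedra -/

section connected

variable {m : OctEdge → ℕ} {A : ∀ e, Attachment (m e)}
  {L : ∀ e, Fin (m e) → Fin 2 → Fin 2 → LoopPiece}

theorem AugEdge.reachable {u v : AugVertex m L} (h : AugEdge m A L u v) :
    (augGraph m A L).Reachable u v :=
  (augGraph_adj.2 (Or.inl h)).reachable

theorem oct_reachable_path (e : OctEdge) (i : Fin (4 * m e)) :
    (augGraph m A L).Reachable (.oct e.1.1) (.path e i) := by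
  obtain ⟨n, hn⟩ := i
  induction n with
  | zero => exact (AugEdge.first e ⟨0, hn⟩ rfl).reachable
  | succ n ih => exact (ih (by omega)).trans (AugEdge.step e ⟨n, by omega⟩ ⟨n + 1, hn⟩ rfl).reachable

theorem oct_reachable_oct (v w : Fin 6) :
    (augGraph m A L).Reachable (.oct v) (.oct w) := by
  have hm : ∀ e, 0 < m e := fun e => by have := (A e).two_le; omega
  have hedge : ∀ e : OctEdge, (augGraph m A L).Reachable (.oct e.1.1) (.oct e.1.2) := fun e => by
    have := hm e
    exact (oct_reachable_path e ⟨4 * m e - 1, by omega⟩).trans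
      (AugEdge.last e _ (by simp only; omega)).reachable
  have hadj : ∀ v w, octahedron.Adj v w → (augGraph m A L).Reachable (.oct v) (.oct w) := by
    intro v w h
    rcases lt_or_gt_of_ne h.1 with hlt | hlt
    · exact hedge ⟨(v, w), hlt, h⟩
    · exact (hedge ⟨(w, v), hlt, h.symm⟩).symm
  have : ∀ v w, ∃ x, octahedron.Adj v x ∧ octahedron.Adj x w := by decide
  obtain ⟨x, h1, h2⟩ := this v w
  exact (hadj v x h1).trans (hadj x w h2)

/-- A walk in the piece lifts step by step; the missing edge `ab` is replaced by the detour through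
the root. -/
theorem root_reachable_loop (hL : ∀ e p t s, (L e p t s).Admissible) (e : OctEdge) (p : Fin (m e))
    (t s : Fin 2) (x : (L e p t s).V) :
    (augGraph m A L).Reachable (.root e p t s) (.loop e p t s x) := by
  have hstep : ∀ y z, (L e p t s).graph.Adj y z →
      (augGraph m A L).Reachable (.loop e p t s y) (.loop e p t s z) := by
    intro y z h
    by_cases hne : s(y, z) = s((L e p t s).a, (L e p t s).b)
    · rcases Sym2.eq_iff.1 hne with ⟨rfl, rfl⟩ | ⟨rfl, rfl⟩
      · exact (AugEdge.rootA e p t s).reachable.symm.trans (AugEdge.rootB e p t s).reachable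
      · exact (AugEdge.rootB e p t s).reachable.symm.trans (AugEdge.rootA e p t s).reachable
    · exact (AugEdge.inner e p t s y z h hne).reachable
  refine (AugEdge.rootA e p t s).reachable.trans ?_
  obtain ⟨w⟩ := (hL e p t s).connected.preconnected (L e p t s).a x
  generalize (L e p t s).a = y at w
  induction w with
  | nil => rfl
  | cons h _ ih => exact (hstep _ _ h).trans ih

theorem augGraph_connected (hL : ∀ e p t s, (L e p t s).Admissible) :
    (augGraph m A L).Connected := by
  have hpath : ∀ e i, (augGraph m A L).Reachable (.oct 0) (.path e i) := fun e i =>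
    (oct_reachable_oct 0 e.1.1).trans (oct_reachable_path e i)
  have hroot : ∀ e p t s, (augGraph m A L).Reachable (.oct 0) (.root e p t s) := fun e p t s =>
    (hpath e _).trans (AugEdge.endRoot e p t s).reachable
  have h0 : ∀ v, (augGraph m A L).Reachable (.oct 0) v := by
    rintro (v | ⟨e, i⟩ | ⟨e, p, t⟩ | ⟨e, p, t, s⟩ | ⟨e, p, t, s, x⟩)
    · exact oct_reachable_oct 0 v
    · exact hpath e i
    · exact (hpath e _).trans (AugEdge.endHub e p t 0).reachable
    · exact hroot e p t s
    · exact (hroot e p t s).trans (root_reachable_loop hL e p t s x)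
  have : Nonempty (AugVertex m L) := ⟨.oct 0⟩
  exact ⟨fun u v => (h0 u).symm.trans (h0 v)⟩

end connected

open EuclideanGeometry

/-! ### Circles in coordinates -/

theorem Plane.dist_sq (x y : Plane) : dist x y ^ 2 = (x 0 - y 0) ^ 2 + (x 1 - y 1) ^ 2 := by
  rw [EuclideanSpace.dist_eq, Real.sq_sqrt (by positivity)]
  simp [Real.dist_eq, sq_abs]

theorem Plane.ext_coord {x y : Plane} (h0 : x 0 = y 0) (h1 : x 1 = y 1) : x = y := by
  ext i
  fin_cases i
  · exact h0
  · exact h1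

theorem mem_circle_iff {c : Sphere Plane} (hc : 0 < c.radius) {x : Plane} :
    x ∈ c ↔ (x 0 - c.center 0) ^ 2 + (x 1 - c.center 1) ^ 2 = c.radius ^ 2 := by
  rw [EuclideanGeometry.mem_sphere, ← Plane.dist_sq]
  exact (pow_left_inj₀ dist_nonneg hc.le two_ne_zero).symm

/-- Stereographic parametrization of the circle `c` from its point `P`. -/
noncomputable def stereo (c : Sphere Plane) (P : Plane) (x : ℝ) : Plane :=
  !₂[P 0 - 2 / (1 + x ^ 2) * ((P 0 - c.center 0) - x * (P 1 - c.center 1)),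
    P 1 - 2 / (1 + x ^ 2) * ((P 1 - c.center 1) + x * (P 0 - c.center 0))]

/-- Stereographic coordinate on the circle `c` with respect to its point `P`. -/
noncomputable def stereoCoord (c : Sphere Plane) (P Q : Plane) : ℝ :=
  ((Q 1 - P 1) * (P 0 - c.center 0) - (Q 0 - P 0) * (P 1 - c.center 1)) /
    ((Q 0 - P 0) * (P 0 - c.center 0) + (Q 1 - P 1) * (P 1 - c.center 1))

theorem stereo_zero (c : Sphere Plane) (P : Plane) (x : ℝ) : stereo c P x 0 =
    P 0 - 2 / (1 + x ^ 2) * ((P 0 - c.center 0) - x * (P 1 - c.center 1)) := rfl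

theorem stereo_one (c : Sphere Plane) (P : Plane) (x : ℝ) : stereo c P x 1 =
    P 1 - 2 / (1 + x ^ 2) * ((P 1 - c.center 1) + x * (P 0 - c.center 0)) := rfl

theorem stereo_continuous (c : Sphere Plane) (P : Plane) : Continuous (stereo c P) := by
  have h : ∀ x : ℝ, 1 + x ^ 2 ≠ 0 := fun x => by positivity
  unfold stereo
  refine (PiLp.continuous_toLp 2 _).comp (continuous_pi fun i => ?_)
  fin_cases i
  · simp only [Fin.zero_eta, Matrix.cons_val_zero]
    exact continuous_const.sub (((continuous_const).div (by fun_prop) h).mul (by fun_prop))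
  · simp only [Fin.mk_one, Matrix.cons_val_one, Matrix.cons_val_fin_one]
    exact continuous_const.sub (((continuous_const).div (by fun_prop) h).mul (by fun_prop))

section stereo

variable {c : Sphere Plane} (hc : 0 < c.radius) {P : Plane} (hP : P ∈ c)
include hc hP

theorem stereo_mem (x : ℝ) : stereo c P x ∈ c := by
  rw [mem_circle_iff hc] at *
  rw [stereo_zero, stereo_one, ← hP]
  have h : 1 + x ^ 2 ≠ 0 := by positivity
  field_simp
  ring

theorem stereo_denom (x : ℝ) :
    (stereo c P x 0 - P 0) * (P 0 - c.center 0) + (stereo c P x 1 - P 1) * (P 1 - c.center 1) =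
      -(2 / (1 + x ^ 2) * c.radius ^ 2) := by
  rw [mem_circle_iff hc] at hP
  rw [stereo_zero, stereo_one, ← hP]
  ring

omit hP in
theorem stereo_denom_ne (x : ℝ) : -(2 / (1 + x ^ 2) * c.radius ^ 2) ≠ 0 := by
  have : 0 < 2 / (1 + x ^ 2) * c.radius ^ 2 := by positivity
  linarith

theorem stereo_ne (x : ℝ) : stereo c P x ≠ P := by
  intro h
  have h1 := stereo_denom hc hP x
  rw [h] at h1
  simp only [sub_self, zero_mul, add_zero] at h1
  exact stereo_denom_ne hc x h1.symm

theorem stereoCoord_stereo (x : ℝ) : stereoCoord c P (stereo c P x) = x := by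
  unfold stereoCoord
  rw [stereo_denom hc hP, div_eq_iff (stereo_denom_ne hc x)]
  rw [mem_circle_iff hc] at hP
  rw [stereo_zero, stereo_one, ← hP]
  ring

theorem stereo_injective : Function.Injective (stereo c P) :=
  Function.LeftInverse.injective (stereoCoord_stereo hc hP)

/-- The denominator of the coordinate is minus half the squared chord, since both points lie on the
circle. It therefore vanishes only at the pole. -/
theorem stereoCoord_denom {Q : Plane} (hQ : Q ∈ c) :
    2 * ((Q 0 - P 0) * (P 0 - c.center 0) + (Q 1 - P 1) * (P 1 - c.center 1)) =
      -((Q 0 - P 0) ^ 2 + (Q 1 - P 1) ^ 2) := by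
  rw [mem_circle_iff hc] at hP hQ
  linear_combination hQ - hP

theorem stereoCoord_denom_neg {Q : Plane} (hQ : Q ∈ c) (hne : Q ≠ P) :
    (Q 0 - P 0) * (P 0 - c.center 0) + (Q 1 - P 1) * (P 1 - c.center 1) < 0 := by
  have h := stereoCoord_denom hc hP hQ
  have h2 : 0 < (Q 0 - P 0) ^ 2 + (Q 1 - P 1) ^ 2 := by
    rw [← Plane.dist_sq]
    exact pow_pos (dist_pos.2 hne) 2
  linarith

theorem stereo_stereoCoord {Q : Plane} (hQ : Q ∈ c) (hne : Q ≠ P) :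
    stereo c P (stereoCoord c P Q) = Q := by
  have hD := stereoCoord_denom_neg hc hP hQ hne
  have h2D := stereoCoord_denom hc hP hQ
  rw [mem_circle_iff hc] at hP
  have hr : (P 0 - c.center 0) ^ 2 + (P 1 - c.center 1) ^ 2 ≠ 0 := by rw [hP]; positivity
  set D := (Q 0 - P 0) * (P 0 - c.center 0) + (Q 1 - P 1) * (P 1 - c.center 1) with hDdef
  set N := (Q 1 - P 1) * (P 0 - c.center 0) - (Q 0 - P 0) * (P 1 - c.center 1) with hNdef
  have hx : stereoCoord c P Q = N / D := rfl
  -- Lagrange's identity for the chord and the radius vector at `P`, combined with the chord formula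
  -- for `D`.
  have hDN : D ^ 2 + N ^ 2 = -2 * D * ((P 0 - c.center 0) ^ 2 + (P 1 - c.center 1) ^ 2) := by
    have : D ^ 2 + N ^ 2 = ((Q 0 - P 0) ^ 2 + (Q 1 - P 1) ^ 2) *
      ((P 0 - c.center 0) ^ 2 + (P 1 - c.center 1) ^ 2) := by rw [hDdef, hNdef]; ring
    rw [this]
    linear_combination ((P 0 - c.center 0) ^ 2 + (P 1 - c.center 1) ^ 2) * h2D
  have hD0 := hD.ne
  have hk : 2 / (1 + (N / D) ^ 2) = -D / ((P 0 - c.center 0) ^ 2 + (P 1 - c.center 1) ^ 2) := by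
    have h1 : 1 + (N / D) ^ 2 = (D ^ 2 + N ^ 2) / D ^ 2 := by field_simp
    rw [h1, hDN]
    field_simp
  apply Plane.ext_coord
  · rw [stereo_zero, hx, hk]
    have h1 : -D / ((P 0 - c.center 0) ^ 2 + (P 1 - c.center 1) ^ 2) *
        (P 0 - c.center 0 - N / D * (P 1 - c.center 1)) = -(Q 0 - P 0) := by
      have h2 : -D / ((P 0 - c.center 0) ^ 2 + (P 1 - c.center 1) ^ 2) *
        (P 0 - c.center 0 - N / D * (P 1 - c.center 1)) =
        -(D * (P 0 - c.center 0) - N * (P 1 - c.center 1)) /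
          ((P 0 - c.center 0) ^ 2 + (P 1 - c.center 1) ^ 2) := by
        field_simp
      rw [h2, div_eq_iff hr, hDdef, hNdef]
      ring
    rw [h1]; ring
  · rw [stereo_one, hx, hk]
    have h1 : -D / ((P 0 - c.center 0) ^ 2 + (P 1 - c.center 1) ^ 2) *
        (P 1 - c.center 1 + N / D * (P 0 - c.center 0)) = -(Q 1 - P 1) := by
      have h2 : -D / ((P 0 - c.center 0) ^ 2 + (P 1 - c.center 1) ^ 2) *
        (P 1 - c.center 1 + N / D * (P 0 - c.center 0)) =
        -(D * (P 1 - c.center 1) + N * (P 0 - c.center 0)) /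
          ((P 0 - c.center 0) ^ 2 + (P 1 - c.center 1) ^ 2) := by
        field_simp
      rw [h2, div_eq_iff hr, hDdef, hNdef]
      ring
    rw [h1]; ring

theorem stereoCoord_continuousAt {Q : Plane} (hQ : Q ∈ c) (hne : Q ≠ P) :
    ContinuousAt (stereoCoord c P) Q := by
  have hD := (stereoCoord_denom_neg hc hP hQ hne).ne
  unfold stereoCoord
  refine ContinuousAt.div ?_ ?_ hD <;> fun_prop

theorem stereoCoord_injOn {Q Q' : Plane} (hQ : Q ∈ c) (hne : Q ≠ P) (hQ' : Q' ∈ c) (hne' : Q' ≠ P)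
    (h : stereoCoord c P Q = stereoCoord c P Q') : Q = Q' := by
  rw [← stereo_stereoCoord hc hP hQ hne, h, stereo_stereoCoord hc hP hQ' hne']

/-- The factors of this chord formula separate the two points, so they can be absorbed into the
weights of `exists_weights`. -/
theorem dist_stereo_sq (x y : ℝ) : dist (stereo c P x) (stereo c P y) ^ 2 =
    4 * c.radius ^ 2 * (x - y) ^ 2 / ((1 + x ^ 2) * (1 + y ^ 2)) := by
  rw [mem_circle_iff hc] at hP
  rw [Plane.dist_sq, stereo_zero, stereo_one, stereo_zero, stereo_one, ← hP]
  have h1 : 1 + x ^ 2 ≠ 0 := by positivity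
  have h2 : 1 + y ^ 2 ≠ 0 := by positivity
  field_simp
  ring

theorem circle_diff_point : (c : Set Plane) \ {P} = Set.range (stereo c P) := by
  ext Q
  constructor
  · rintro ⟨hQ, hne⟩
    exact ⟨_, stereo_stereoCoord hc hP hQ hne⟩
  · rintro ⟨x, rfl⟩
    exact ⟨stereo_mem hc hP x, stereo_ne hc hP x⟩

theorem dist_stereo_base_sq (x : ℝ) :
    dist (stereo c P x) P ^ 2 = 4 * c.radius ^ 2 / (1 + x ^ 2) := by
  rw [mem_circle_iff hc] at hP
  rw [Plane.dist_sq, stereo_zero, stereo_one, ← hP]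
  have h1 : 1 + x ^ 2 ≠ 0 := by positivity
  field_simp
  ring

end stereo

/-! ### Tangent circles -/

/-- `c` and `C` are different circles whose only common point is `P`. -/
def TouchAt (c C : Sphere Plane) (P : Plane) : Prop :=
  c ≠ C ∧ P ∈ c ∧ P ∈ C ∧ ∀ Q, Q ∈ c → Q ∈ C → Q = P

/-- The reflection of `P` in the line of centres is also a common point, hence equals `P`. So `P` is
on that line, and `c` is the image of `C` under the homothety about `P` with ratio `1 - l`. This
covers internal and external tangency. -/
theorem TouchAt.exists_ratio {c C : Sphere Plane} (hc : 0 < c.radius) (hC : 0 < C.radius)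
    {P : Plane} (h : TouchAt c C P) : ∃ l : ℝ, l ≠ 0 ∧
      c.center 0 = C.center 0 + l * (P 0 - C.center 0) ∧
      c.center 1 = C.center 1 + l * (P 1 - C.center 1) ∧
      c.radius ^ 2 = (1 - l) ^ 2 * C.radius ^ 2 := by
  obtain ⟨hne, hPc, hPC, huniq⟩ := h
  rw [mem_circle_iff hc] at hPc
  rw [mem_circle_iff hC] at hPC
  set a := P 0 - C.center 0 with ha
  set b := P 1 - C.center 1 with hb
  set d := c.center 0 - C.center 0 with hd
  set e := c.center 1 - C.center 1 with he
  have hde : d ^ 2 + e ^ 2 ≠ 0 := by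
    intro h0
    have hd0 : d = 0 := by nlinarith [sq_nonneg d, sq_nonneg e]
    have he0 : e = 0 := by nlinarith [sq_nonneg d, sq_nonneg e]
    have hcen : c.center = C.center :=
      Plane.ext_coord (by linarith) (by linarith)
    apply hne
    have hrad : c.radius ^ 2 = C.radius ^ 2 := by rw [← hPc, ← hPC, hcen]
    have := (pow_left_inj₀ hc.le hC.le two_ne_zero).1 hrad
    exact EuclideanGeometry.Sphere.ext hcen this
  -- Chosen so that `Q` below is the mirror image of `P` in the line of centres, whose normal is
  -- `(e, -d)`.
  set k := 2 * (b * d - a * e) / (d ^ 2 + e ^ 2) with hk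
  have hkm : k * (d ^ 2 + e ^ 2) = 2 * (b * d - a * e) := by rw [hk]; field_simp
  let Q : Plane := !₂[P 0 + k * e, P 1 - k * d]
  have hQ0 : Q 0 = P 0 + k * e := rfl
  have hQ1 : Q 1 = P 1 - k * d := rfl
  have hQC : Q ∈ C := by
    rw [mem_circle_iff hC, ← hPC, hQ0, hQ1]
    have : (P 0 + k * e - C.center 0) ^ 2 + (P 1 - k * d - C.center 1) ^ 2 =
      (a + k * e) ^ 2 + (b - k * d) ^ 2 := by rw [ha, hb]; ring
    rw [this]
    linear_combination k * hkm
  have hQc : Q ∈ c := by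
    rw [mem_circle_iff hc, ← hPc, hQ0, hQ1]
    have h1 : (P 0 + k * e - c.center 0) ^ 2 + (P 1 - k * d - c.center 1) ^ 2 =
      (a - d + k * e) ^ 2 + (b - e - k * d) ^ 2 := by rw [ha, hb, hd, he]; ring
    have h2 : (P 0 - c.center 0) ^ 2 + (P 1 - c.center 1) ^ 2 = (a - d) ^ 2 + (b - e) ^ 2 := by
      rw [ha, hb, hd, he]; ring
    rw [h1, h2]
    linear_combination k * hkm
  have hQP := huniq Q hQc hQC
  have hke : k * e = 0 := by
    have := congrArg (fun p : Plane => p 0) hQP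
    simp only [hQ0] at this
    linarith
  have hkd : k * d = 0 := by
    have := congrArg (fun p : Plane => p 1) hQP
    simp only [hQ1] at this
    linarith
  have hpar : b * d - a * e = 0 := by
    have : k * (d ^ 2 + e ^ 2) = 0 := by linear_combination d * hkd + e * hke
    linarith
  have hR : C.radius ^ 2 ≠ 0 := by positivity
  have hab : a ^ 2 + b ^ 2 = C.radius ^ 2 := hPC
  set l := (d * a + e * b) / C.radius ^ 2 with hl
  have hlm : l * C.radius ^ 2 = d * a + e * b := by rw [hl]; field_simp
  have h0 : d = l * a := by
    apply mul_right_cancel₀ hR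
    linear_combination (-a) * hlm - d * hab + b * hpar
  have h1 : e = l * b := by
    apply mul_right_cancel₀ hR
    linear_combination (-b) * hlm - e * hab - a * hpar
  refine ⟨l, ?_, by linarith, by linarith, ?_⟩
  · rintro h
    apply hde
    rw [h0, h1, h]; ring
  · rw [← hPc, ← hab]
    have h2 : P 0 - c.center 0 = a - d := by rw [ha, hd]; ring
    have h3 : P 1 - c.center 1 = b - e := by rw [hb, he]; ring
    rw [h2, h3, h0, h1]; ring

/-- Circles with one common point. -/
theorem TouchAt.dist_centers {c C : Sphere Plane} (hc : 0 < c.radius) (hC : 0 < C.radius)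
    {P : Plane} (h : TouchAt c C P) :
    (dist c.center C.center ^ 2 - c.radius ^ 2 - C.radius ^ 2) ^ 2 =
      4 * c.radius ^ 2 * C.radius ^ 2 := by
  obtain ⟨l, -, h0, h1, hr⟩ := h.exists_ratio hc hC
  have hP := (mem_circle_iff hC).1 h.2.2.1
  have : dist c.center C.center ^ 2 = l ^ 2 * C.radius ^ 2 := by
    rw [Plane.dist_sq, h0, h1, ← hP]; ring
  rw [this, hr]; ring

/-- Circles without common points. -/
theorem dist_centers_of_disjoint {c C : Sphere Plane} (hc : 0 < c.radius) (hC : 0 < C.radius)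
    (h : ∀ Q, Q ∈ c → Q ∉ C) : 4 * c.radius ^ 2 * C.radius ^ 2 <
      (dist c.center C.center ^ 2 - c.radius ^ 2 - C.radius ^ 2) ^ 2 := by
  by_contra! hcon
  set d := C.center 0 - c.center 0 with hd
  set e := C.center 1 - c.center 1 with he
  have hD : dist c.center C.center ^ 2 = d ^ 2 + e ^ 2 := by rw [Plane.dist_sq, hd, he]; ring
  rw [hD] at hcon
  set r := c.radius
  set R := C.radius
  by_cases h0 : d ^ 2 + e ^ 2 = 0
  · have hd0 : d = 0 := by nlinarith [sq_nonneg d, sq_nonneg e]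
    have he0 : e = 0 := by nlinarith [sq_nonneg d, sq_nonneg e]
    have hrr : r ^ 2 = R ^ 2 := by
      rw [h0] at hcon
      have : (r ^ 2 - R ^ 2) ^ 2 ≤ 0 := by linarith
      nlinarith [sq_nonneg (r ^ 2 - R ^ 2)]
    refine h !₂[c.center 0 + r, c.center 1] ?_ ?_
    · rw [mem_circle_iff hc]; simp [r]
    · rw [mem_circle_iff hC]
      have h1 : C.center 0 = c.center 0 := by linarith
      have h2 : C.center 1 = c.center 1 := by linarith
      rw [h1, h2]
      simp only [Matrix.cons_val_zero, Matrix.cons_val_one,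
        Matrix.cons_val_fin_one]
      rw [← show R = C.radius from rfl, ← hrr]; ring
  · set D := d ^ 2 + e ^ 2
    have hDpos : 0 < D := lt_of_le_of_ne (by positivity) (Ne.symm h0)
    -- The negated inequality makes `r ^ 2 / D - al ^ 2` nonnegative, so a common point exists with
    -- components `al` along and `be` across the line of centres.
    set al := (D + r ^ 2 - R ^ 2) / (2 * D) with hal
    have halm : 2 * D * al = D + r ^ 2 - R ^ 2 := by rw [hal]; field_simp
    have hbe : 0 ≤ r ^ 2 / D - al ^ 2 := by
      have : r ^ 2 / D - al ^ 2 = (4 * D * r ^ 2 - (D + r ^ 2 - R ^ 2) ^ 2) / (4 * D ^ 2) := by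
        rw [hal]; field_simp; ring
      rw [this]
      apply div_nonneg _ (by positivity)
      linarith
    set be := Real.sqrt (r ^ 2 / D - al ^ 2) with hbedef
    have hbe2 : be ^ 2 = r ^ 2 / D - al ^ 2 := Real.sq_sqrt hbe
    have hsum : D * (al ^ 2 + be ^ 2) = r ^ 2 := by rw [hbe2]; field_simp; ring
    refine h !₂[c.center 0 + al * d - be * e, c.center 1 + al * e + be * d] ?_ ?_
    · rw [mem_circle_iff hc]
      simp only [Matrix.cons_val_zero, Matrix.cons_val_one,
        Matrix.cons_val_fin_one]
      linear_combination hsum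
    · rw [mem_circle_iff hC]
      simp only [Matrix.cons_val_zero, Matrix.cons_val_one,
        Matrix.cons_val_fin_one]
      have h1 : C.center 0 = c.center 0 + d := by rw [hd]; ring
      have h2 : C.center 1 = c.center 1 + e := by rw [he]; ring
      rw [h1, h2]
      linear_combination hsum - halm

/-- Circles that touch a circle `C` have weights by which tangency and disjointness of two of them
are expressed in the stereographic coordinates of the touching points. -/
theorem exists_weights {C : Sphere Plane} (hC : 0 < C.radius) {u : Plane} (hu : u ∈ C) {ι : Type*}
    (P : ι → Plane) (c : ι → Sphere Plane) (hc : ∀ i, 0 < (c i).radius)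
    (hP : ∀ i, P i ≠ u) (htouch : ∀ i, TouchAt (c i) C (P i)) : ∃ K : ι → ℝ,
      (∀ i j, P i ≠ P j → (∃ w, TouchAt (c i) (c j) w) →
        (stereoCoord C u (P i) - stereoCoord C u (P j)) ^ 2 = K i * K j) ∧
      ∀ i j, P i ≠ P j → (∀ Q, Q ∈ c i → Q ∉ c j) →
        K i * K j < (stereoCoord C u (P i) - stereoCoord C u (P j)) ^ 2 := by
  choose l hl0 hlx hly hlr using fun i => (htouch i).exists_ratio (hc i) hC
  set x : ι → ℝ := fun i => stereoCoord C u (P i) with hx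
  have hPx : ∀ i, stereo C u (x i) = P i := fun i =>
    stereo_stereoCoord hC hu (htouch i).2.2.1 (hP i)
  have hchord : ∀ i j, dist (P i) (P j) ^ 2 * ((1 + x i ^ 2) * (1 + x j ^ 2)) =
      4 * C.radius ^ 2 * (x i - x j) ^ 2 := by
    intro i j
    rw [← hPx i, ← hPx j, dist_stereo_sq hC hu]
    have h1 : 1 + x i ^ 2 ≠ 0 := by positivity
    have h2 : 1 + x j ^ 2 ≠ 0 := by positivity
    field_simp
  have hcen : ∀ i j, dist (c i).center (c j).center ^ 2 - (c i).radius ^ 2 - (c j).radius ^ 2 =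
      l i * l j * dist (P i) (P j) ^ 2 - 2 * C.radius ^ 2 * ((1 - l i) * (1 - l j)) := by
    intro i j
    have h1 := (mem_circle_iff hC).1 (htouch i).2.2.1
    have h2 := (mem_circle_iff hC).1 (htouch j).2.2.1
    rw [Plane.dist_sq, Plane.dist_sq, hlr, hlr, hlx, hly, hlx, hly]
    linear_combination (l i ^ 2 - l i * l j) * h1 + (l j ^ 2 - l i * l j) * h2
  -- After an inversion centred at `u` that turns `C` into a line, `K i` is the diameter of the
  -- image of `c i`, with a sign for its side: `0 < l i < 1` means inside `C`, otherwise it is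
  -- outside.
  refine ⟨fun i => (1 - l i) / l i * (1 + x i ^ 2), fun i j hij ⟨w, hw⟩ => ?_,
    fun i j hij hdis => ?_⟩
  · have h1 := hw.dist_centers (hc i) (hc j)
    rw [hcen, hlr, hlr] at h1
    have hq : dist (P i) (P j) ^ 2 ≠ 0 := pow_ne_zero _ (dist_ne_zero.2 hij)
    -- The tangency equation is a difference of squares, from which the nonzero factor `l i * l j *
    -- dist (P i) (P j) ^ 2` cancels.
    have h2 : l i * l j * dist (P i) (P j) ^ 2 = 4 * C.radius ^ 2 * ((1 - l i) * (1 - l j)) := by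
      apply mul_left_cancel₀ (mul_ne_zero (mul_ne_zero (hl0 i) (hl0 j)) hq)
      linear_combination h1
    have h3 := hchord i j
    have h4 : 4 * C.radius ^ 2 ≠ 0 := by positivity
    have hi := hl0 i
    have hj := hl0 j
    have h5 : dist (P i) (P j) ^ 2 = 4 * C.radius ^ 2 * ((1 - l i) / l i * ((1 - l j) / l j)) := by
      field_simp
      linear_combination h2
    rw [h5] at h3
    apply mul_left_cancel₀ h4
    linear_combination -h3
  · have h1 := dist_centers_of_disjoint (hc i) (hc j) hdis
    rw [hcen, hlr, hlr] at h1
    have hq : 0 < dist (P i) (P j) ^ 2 := pow_pos (dist_pos.2 hij) 2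
    have hi := hl0 i
    have hj := hl0 j
    set q := dist (P i) (P j) ^ 2
    set kk := (1 - l i) / l i * ((1 - l j) / l j) with hkk
    have hkkm : kk * (l i * l j) = (1 - l i) * (1 - l j) := by rw [hkk]; field_simp
    have h2 : 0 < (l i * l j) ^ 2 * (q * (q - 4 * C.radius ^ 2 * kk)) := by
      rw [← hkkm] at h1
      have h1' : 4 * ((1 - l i) ^ 2 * C.radius ^ 2) * ((1 - l j) ^ 2 * C.radius ^ 2) =
        4 * (C.radius ^ 2) ^ 2 * (kk * (l i * l j)) ^ 2 := by rw [hkkm]; ring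
      rw [h1'] at h1
      linarith
    have h3 : 0 < q * (q - 4 * C.radius ^ 2 * kk) :=
      pos_of_mul_pos_right h2 (by positivity)
    have h4 : 0 < q - 4 * C.radius ^ 2 * kk := pos_of_mul_pos_right h3 hq.le
    have h5 : 0 < (1 + x i ^ 2) * (1 + x j ^ 2) := by positivity
    have h6 := mul_pos h4 h5
    have h7 := hchord i j
    have h8 : 0 < 4 * C.radius ^ 2 := by positivity
    have h9 : 0 < 4 * C.radius ^ 2 *
        ((x i - x j) ^ 2 - kk * ((1 + x i ^ 2) * (1 + x j ^ 2))) := by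
      rw [mul_sub, ← h7]
      linarith
    have h10 := pos_of_mul_pos_right h9 h8.le
    have : (1 - l i) / l i * (1 + x i ^ 2) * ((1 - l j) / l j * (1 + x j ^ 2)) =
      kk * ((1 + x i ^ 2) * (1 + x j ^ 2)) := by rw [hkk]; ring
    rw [this]
    linarith

/-! ### Interlaced pairs of gadgets on a line -/

/-- Two interleaving pairs of tangent circles are on different sides of a line. -/
theorem opposite_sides {a b c d Ka Kb Kc Kd : ℝ} (hab : a < b) (hbc : b < c) (hcd : c < d)
    (hac : (a - c) ^ 2 = Ka * Kc) (hbd : (b - d) ^ 2 = Kb * Kd) (h1 : Ka * Kb < (a - b) ^ 2)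
    (h2 : Kc * Kd < (c - d) ^ 2) : Ka * Kb ≤ 0 := by
  by_contra! hpos
  -- The same four weights express both tangencies and both disjointness conditions. On one side
  -- they would give `(c - a) * (d - b) < (b - a) * (d - c)`, contrary to the order of the points.
  have hprod : (Ka * Kb) * (Kc * Kd) = ((c - a) * (d - b)) ^ 2 := by
    linear_combination (-(Kb * Kd)) * hac - (a - c) ^ 2 * hbd
  have hq : 0 < (c - a) * (d - b) := mul_pos (by linarith) (by linarith)
  have hpos' : 0 < Kc * Kd := by
    have : 0 < (Ka * Kb) * (Kc * Kd) := by rw [hprod]; positivity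
    exact pos_of_mul_pos_right this hpos.le
  have h3 : (Ka * Kb) * (Kc * Kd) < (a - b) ^ 2 * (c - d) ^ 2 :=
    mul_lt_mul'' h1 h2 hpos.le hpos'.le
  rw [hprod] at h3
  have h4 : (b - a) * (d - c) < (c - a) * (d - b) :=
    mul_lt_mul'' (by linarith) (by linarith) (by linarith) (by linarith)
  have h5 : ((b - a) * (d - c)) ^ 2 < ((c - a) * (d - b)) ^ 2 :=
    pow_lt_pow_left₀ h4 (mul_nonneg (by linarith) (by linarith)) two_ne_zero
  have h6 : (a - b) ^ 2 * (c - d) ^ 2 = ((b - a) * (d - c)) ^ 2 := by ring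
  linarith

/-- Nested pairs of tangent circles on the same side of a line. -/
theorem nested_gap {a b c d Ka Kb Kc Kd : ℝ} (hab : a < b) (hbc : b < c) (hcd : c < d)
    (had : (a - d) ^ 2 = Ka * Kd) (hbc' : (b - c) ^ 2 = Kb * Kc) (h1 : Ka * Kb < (a - b) ^ 2)
    (h2 : Kc * Kd < (c - d) ^ 2) (hpos : 0 < Ka * Kb) : c - b < b - a ∧ c - b < d - c := by
  have hprod : (Ka * Kb) * (Kc * Kd) = ((d - a) * (c - b)) ^ 2 := by
    linear_combination (-(Kb * Kc)) * had - (a - d) ^ 2 * hbc'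
  have hq : 0 < (d - a) * (c - b) := mul_pos (by linarith) (by linarith)
  have hpos' : 0 < Kc * Kd := by
    have : 0 < (Ka * Kb) * (Kc * Kd) := by rw [hprod]; positivity
    exact pos_of_mul_pos_right this hpos.le
  have h3 : (Ka * Kb) * (Kc * Kd) < (a - b) ^ 2 * (c - d) ^ 2 :=
    mul_lt_mul'' h1 h2 hpos.le hpos'.le
  have h4 : ((d - a) * (c - b)) ^ 2 < ((b - a) * (d - c)) ^ 2 := by
    rw [← hprod]
    linarith
  -- The same comparison of products for nested pairs; here it is consistent but bounds the inner
  -- gap, since `d - a` exceeds both outer gaps.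
  have h5 : (d - a) * (c - b) < (b - a) * (d - c) :=
    lt_of_pow_lt_pow_left₀ 2 (mul_nonneg (by linarith) (by linarith)) h4
  constructor
  · have h6 : (b - a) * (d - c) < (b - a) * (d - a) :=
      mul_lt_mul_of_pos_left (by linarith) (by linarith)
    have h7 : (d - a) * (c - b) < (d - a) * (b - a) := by linarith
    exact lt_of_mul_lt_mul_left h7 (by linarith)
  · have h6 : (b - a) * (d - c) < (d - a) * (d - c) :=
      mul_lt_mul_of_pos_right (by linarith) (by linarith)
    exact lt_of_mul_lt_mul_left (h5.trans h6) (by linarith)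

/-- The gadgets of one pair both interleave a gadget of the other, so each pair is on one side. The
nested gap bounds then give `x 4 - x 1 < x 5 - x 4` and `x 6 - x 3 < x 3 - x 2`, although `x 3 - x 2
< x 4 - x 1` and `x 5 - x 4 < x 6 - x 3`. -/
theorem not_interlaced {x : Fin 8 → ℝ} {K : Fin 8 → ℝ} (hx : StrictMono x)
    (h05 : (x 0 - x 5) ^ 2 = K 0 * K 5) (h14 : (x 1 - x 4) ^ 2 = K 1 * K 4)
    (h27 : (x 2 - x 7) ^ 2 = K 2 * K 7) (h36 : (x 3 - x 6) ^ 2 = K 3 * K 6)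
    (hdis : ∀ i j : Fin 8, i < j → (i, j) ≠ (0, 5) → (i, j) ≠ (1, 4) → (i, j) ≠ (2, 7) →
      (i, j) ≠ (3, 6) → K i * K j < (x i - x j) ^ 2) : False := by
  have l01 : x 0 < x 1 := hx (by decide)
  have l12 : x 1 < x 2 := hx (by decide)
  have l23 : x 2 < x 3 := hx (by decide)
  have l34 : x 3 < x 4 := hx (by decide)
  have l45 : x 4 < x 5 := hx (by decide)
  have l56 : x 5 < x 6 := hx (by decide)
  have l67 : x 6 < x 7 := hx (by decide)
  have p05 : 0 < K 0 * K 5 := by rw [← h05]; exact sq_pos_of_neg (by linarith)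
  have p14 : 0 < K 1 * K 4 := by rw [← h14]; exact sq_pos_of_neg (by linarith)
  have p27 : 0 < K 2 * K 7 := by rw [← h27]; exact sq_pos_of_neg (by linarith)
  have p36 : 0 < K 3 * K 6 := by rw [← h36]; exact sq_pos_of_neg (by linarith)
  have s02 := opposite_sides (by linarith) (by linarith) (by linarith) h05 h27
    (hdis 0 2 (by decide) (by decide) (by decide) (by decide) (by decide))
    (hdis 5 7 (by decide) (by decide) (by decide) (by decide) (by decide))
  have s12 := opposite_sides (by linarith) (by linarith) (by linarith) h14 h27
    (hdis 1 2 (by decide) (by decide) (by decide) (by decide) (by decide))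
    (hdis 4 7 (by decide) (by decide) (by decide) (by decide) (by decide))
  have s03 := opposite_sides (by linarith) (by linarith) (by linarith) h05 h36
    (hdis 0 3 (by decide) (by decide) (by decide) (by decide) (by decide))
    (hdis 5 6 (by decide) (by decide) (by decide) (by decide) (by decide))
  have n0 : K 0 ≠ 0 := left_ne_zero_of_mul p05.ne'
  have n1 : K 1 ≠ 0 := left_ne_zero_of_mul p14.ne'
  have n2 : K 2 ≠ 0 := left_ne_zero_of_mul p27.ne'
  have n3 : K 3 ≠ 0 := left_ne_zero_of_mul p36.ne'
  -- Gadget circles 0 and 1 are both on the side opposite to circle 2; multiplying by `K 2 ^ 2`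
  -- shows it.
  have s01 : 0 < K 0 * K 1 := by
    refine lt_of_le_of_ne ?_ (mul_ne_zero n0 n1).symm
    have : 0 ≤ K 2 ^ 2 * (K 0 * K 1) := by linarith [mul_nonneg_of_nonpos_of_nonpos s02 s12]
    exact nonneg_of_mul_nonneg_right this (sq_pos_of_ne_zero n2)
  have s23 : 0 < K 2 * K 3 := by
    refine lt_of_le_of_ne ?_ (mul_ne_zero n2 n3).symm
    have : 0 ≤ K 0 ^ 2 * (K 2 * K 3) := by linarith [mul_nonneg_of_nonpos_of_nonpos s02 s03]
    exact nonneg_of_mul_nonneg_right this (sq_pos_of_ne_zero n0)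
  have g := (nested_gap l01 (by linarith) l45 h05 h14
    (hdis 0 1 (by decide) (by decide) (by decide) (by decide) (by decide))
    (hdis 4 5 (by decide) (by decide) (by decide) (by decide) (by decide)) s01).2
  have g' := (nested_gap l23 (by linarith) l67 h27 h36
    (hdis 2 3 (by decide) (by decide) (by decide) (by decide) (by decide))
    (hdis 6 7 (by decide) (by decide) (by decide) (by decide) (by decide)) s23).1
  linarith

/-! ### Realizations as systems of circles -/

/-- A realization of a graph as a system of circles. -/
structure CircleRealization {V : Type*} (G : SimpleGraph V) where
  S : Set (Sphere Plane)
  radius_pos : ∀ c ∈ S, 0 < c.radius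
  pt : V → Plane
  pt_injective : Function.Injective pt
  range_pt : Set.range pt = meetingPoints S
  φ : G.edgeSet ≃ circleArcs S
  boundary : ∀ e, closure (φ e : Set Plane) \ (φ e : Set Plane) = pt '' {v | v ∈ e.1}

theorem SimpleGraph.HasCircleRealization.nonempty {V : Type*} {G : SimpleGraph V}
    (h : G.HasCircleRealization) : Nonempty (CircleRealization G) := by
  obtain ⟨S, -, hr, pt, hinj, hrange, φ, hφ⟩ := h
  exact ⟨⟨S, hr, pt, hinj, hrange, φ, hφ⟩⟩

namespace CircleRealization

variable {V : Type*} {G : SimpleGraph V} (R : CircleRealization G)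

theorem isClosed_circle (c : Sphere Plane) : IsClosed (c : Set Plane) := Metric.isClosed_sphere

/-- The arc of an edge. -/
def arc (e : G.edgeSet) : Set Plane := R.φ e

theorem exists_circ (e : G.edgeSet) : ∃ c ∈ R.S, ∃ x ∈ (c : Set Plane) \ meetingPoints R.S,
    R.arc e = connectedComponentIn ((c : Set Plane) \ meetingPoints R.S) x := (R.φ e).2

/-- The circle of an edge. -/
noncomputable def circ (e : G.edgeSet) : Sphere Plane := (R.exists_circ e).choose

theorem circ_mem (e : G.edgeSet) : R.circ e ∈ R.S := (R.exists_circ e).choose_spec.1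

theorem exists_arc_eq (e : G.edgeSet) : ∃ x ∈ (R.circ e : Set Plane) \ meetingPoints R.S,
    R.arc e = connectedComponentIn ((R.circ e : Set Plane) \ meetingPoints R.S) x :=
  (R.exists_circ e).choose_spec.2

theorem arc_subset (e : G.edgeSet) : R.arc e ⊆ (R.circ e : Set Plane) \ meetingPoints R.S := by
  obtain ⟨x, -, h⟩ := R.exists_arc_eq e
  rw [h]
  exact connectedComponentIn_subset _ _

theorem arc_nonempty (e : G.edgeSet) : (R.arc e).Nonempty := by
  obtain ⟨x, hx, h⟩ := R.exists_arc_eq e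
  exact ⟨x, h ▸ mem_connectedComponentIn hx⟩

theorem arc_isPreconnected (e : G.edgeSet) : IsPreconnected (R.arc e) := by
  obtain ⟨x, -, h⟩ := R.exists_arc_eq e
  rw [h]
  exact isPreconnected_connectedComponentIn

theorem closure_arc_subset (e : G.edgeSet) : closure (R.arc e) ⊆ R.circ e :=
  closure_minimal (fun _ hx => (R.arc_subset e hx).1) (isClosed_circle _)

theorem pt_mem_meetingPoints (v : V) : R.pt v ∈ meetingPoints R.S :=
  R.range_pt ▸ Set.mem_range_self v

/-- A common point of arcs on different circles would be a meeting point, and arcs on one circle are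
components of the same set. -/
theorem eq_of_mem_arc {e e' : G.edgeSet} {x : Plane} (h : x ∈ R.arc e) (h' : x ∈ R.arc e') :
    e = e' := by
  have hx := R.arc_subset e h
  have hx' := R.arc_subset e' h'
  have hc : R.circ e = R.circ e' := by
    by_contra hne
    exact hx.2 ⟨_, R.circ_mem e, _, R.circ_mem e', hne, hx.1, hx'.1⟩
  obtain ⟨y, -, hy⟩ := R.exists_arc_eq e
  obtain ⟨z, -, hz⟩ := R.exists_arc_eq e'
  apply R.φ.injective
  apply Subtype.ext
  change R.arc e = R.arc e'
  rw [hy] at h ⊢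
  rw [hz] at h' ⊢
  rw [← hc] at h' ⊢
  rw [connectedComponentIn_eq h, connectedComponentIn_eq h']

theorem mem_closure_arc {e : G.edgeSet} {v : V} (h : v ∈ e.1) : R.pt v ∈ closure (R.arc e) := by
  have : R.pt v ∈ R.pt '' {v | v ∈ e.1} := ⟨v, h, rfl⟩
  rw [← R.boundary e] at this
  exact this.1

theorem exists_pt_of_mem_closure {e : G.edgeSet} {x : Plane} (h : x ∈ closure (R.arc e))
    (hx : x ∉ R.arc e) : ∃ v, v ∈ e.1 ∧ R.pt v = x := by
  have : x ∈ R.pt '' {v | v ∈ e.1} := by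
    rw [← R.boundary e]
    exact ⟨h, hx⟩
  exact this

theorem pt_notMem_arc (v : V) (e : G.edgeSet) : R.pt v ∉ R.arc e := fun h =>
  (R.arc_subset e h).2 (R.pt_mem_meetingPoints v)

theorem mem_of_pt_mem_closure {e : G.edgeSet} {v : V} (h : R.pt v ∈ closure (R.arc e)) :
    v ∈ e.1 := by
  obtain ⟨w, hw, hwv⟩ := R.exists_pt_of_mem_closure h (R.pt_notMem_arc v e)
  exact R.pt_injective hwv ▸ hw

theorem pt_mem_circ {e : G.edgeSet} {v : V} (h : v ∈ e.1) : R.pt v ∈ R.circ e :=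
  R.closure_arc_subset e (R.mem_closure_arc h)

/-- A connected set of non-meeting points on a circle lies in the arc of an edge. -/
theorem exists_edge_of_connected {c : Sphere Plane} (hc : c ∈ R.S) {s : Set Plane}
    (hs : IsPreconnected s) (hne : s.Nonempty) (hsub : s ⊆ (c : Set Plane) \ meetingPoints R.S) :
    ∃ e, R.circ e = c ∧ s ⊆ R.arc e := by
  obtain ⟨x, hx⟩ := hne
  let a : circleArcs R.S := ⟨connectedComponentIn ((c : Set Plane) \ meetingPoints R.S) x,
    c, hc, x, hsub hx, rfl⟩
  have ha : R.arc (R.φ.symm a) = a := by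
    unfold arc
    rw [Equiv.apply_symm_apply]
  have hsa : s ⊆ R.arc (R.φ.symm a) := ha ▸ hs.subset_connectedComponentIn hx hsub
  refine ⟨R.φ.symm a, ?_, hsa⟩
  by_contra hne
  exact (hsub hx).2 ⟨_, R.circ_mem _, c, hc, hne, (R.arc_subset _ (hsa hx)).1, (hsub hx).1⟩

/-- The filter is controlled through `x ^ 2` in order to treat both ends of the line at once. -/
theorem tendsto_stereo {c : Sphere Plane} (hc : 0 < c.radius) {P : Plane} (hP : P ∈ c)
    {l : Filter ℝ} (hl : Filter.Tendsto (fun x : ℝ => x ^ 2) l Filter.atTop) :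
    Filter.Tendsto (stereo c P) l (nhds P) := by
  rw [tendsto_iff_dist_tendsto_zero]
  have h : (fun x => dist (stereo c P x) P) =
      fun x => Real.sqrt (4 * c.radius ^ 2 / (1 + x ^ 2)) := by
    ext x
    rw [← dist_stereo_base_sq hc hP, Real.sqrt_sq dist_nonneg]
  rw [h, ← Real.sqrt_zero]
  refine (Real.continuous_sqrt.tendsto 0).comp ?_
  exact Filter.Tendsto.const_div_atTop (Filter.tendsto_atTop_add_const_left _ _ hl) _

theorem meetingPoints_finite [Finite V] : (meetingPoints R.S).Finite :=
  R.range_pt ▸ Set.finite_range R.pt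

/-- Every circle through a vertex contains at least two edges at the vertex. -/
theorem exists_two_edges [Finite V] {c : Sphere Plane} (hc : c ∈ R.S) {v : V} (hv : R.pt v ∈ c) :
    ∃ e e', e ≠ e' ∧ v ∈ e.1 ∧ v ∈ e'.1 ∧ R.circ e = c ∧ R.circ e' = c := by
  have hr := R.radius_pos c hc
  set γ := stereo c (R.pt v)
  have hfin : (γ ⁻¹' meetingPoints R.S).Finite :=
    R.meetingPoints_finite.preimage (stereo_injective hr hv).injOn
  obtain ⟨B, hB⟩ := hfin.bddAbove
  obtain ⟨B', hB'⟩ := hfin.bddBelow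
  have hray : ∀ s : Set ℝ, s.OrdConnected → s.Nonempty → (∀ x ∈ s, γ x ∉ meetingPoints R.S) →
      ∃ e, R.circ e = c ∧ γ '' s ⊆ R.arc e := by
    intro s hs hne hsM
    refine R.exists_edge_of_connected hc
      (hs.isPreconnected.image _ (stereo_continuous _ _).continuousOn) (hne.image _) ?_
    rintro _ ⟨x, hx, rfl⟩
    exact ⟨stereo_mem hr hv x, hsM x hx⟩
  have hmem : ∀ (e : G.edgeSet) (s : Set ℝ) (l : Filter ℝ) [l.NeBot], s ∈ l →
      Filter.Tendsto (fun x : ℝ => x ^ 2) l Filter.atTop → γ '' s ⊆ R.arc e → v ∈ e.1 := by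
    intro e s l _ hs hl hsub
    apply R.mem_of_pt_mem_closure
    refine mem_closure_of_tendsto (tendsto_stereo hr hv hl) ?_
    filter_upwards [hs] with x hx using hsub ⟨x, hx, rfl⟩
  -- Finitely many meeting points leave two unbounded rays of the coordinate line free. Each ray
  -- lies in one arc, and that arc ends at `v`.
  obtain ⟨e, hec, hes⟩ := hray (Set.Ioi B) Set.ordConnected_Ioi ⟨B + 1, by simp⟩
    fun x hx h => (hB h).not_gt hx
  obtain ⟨e', hec', hes'⟩ := hray (Set.Iio B') Set.ordConnected_Iio ⟨B' - 1, by simp⟩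
    fun x hx h => (hB' h).not_gt hx
  have hve : v ∈ e.1 := hmem e _ Filter.atTop (Filter.Ioi_mem_atTop B)
    (Filter.tendsto_pow_atTop two_ne_zero) hes
  have hve' : v ∈ e'.1 := hmem e' _ Filter.atBot (Filter.Iio_mem_atBot B')
    (Filter.Tendsto.comp (Filter.tendsto_pow_atTop two_ne_zero) Filter.tendsto_abs_atBot_atTop
      |>.congr fun x => by simp) hes'
  refine ⟨e, e', ?_, hve, hve', hec, hec'⟩
  rintro rfl
  -- If both rays were in one arc, its coordinates would be an interval unbounded in both
  -- directions. The other end `w` of the edge would then lie on the open arc.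
  have hQ : ∃ w, w ∈ e.1 ∧ w ≠ v := by
    have h1 := e.2
    refine ⟨Sym2.Mem.other hve, Sym2.other_mem hve, ?_⟩
    intro h
    have h2 := Sym2.other_spec hve
    rw [h] at h2
    rw [← h2] at h1
    exact G.loopless.irrefl v h1
  obtain ⟨w, hwe, hwv⟩ := hQ
  have hwne : R.pt w ≠ R.pt v := fun h => hwv (R.pt_injective h)
  have hwc : R.pt w ∈ c := hec ▸ R.pt_mem_circ hwe
  have hsubset : ∀ x ∈ R.arc e, x ∈ c ∧ x ≠ R.pt v := fun x hx =>
    ⟨hec ▸ (R.arc_subset e hx).1, fun h => R.pt_notMem_arc v e (h ▸ hx)⟩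
  have hpre : IsPreconnected (stereoCoord c (R.pt v) '' R.arc e) :=
    (R.arc_isPreconnected e).image _ fun x hx =>
      (stereoCoord_continuousAt hr hv (hsubset x hx).1 (hsubset x hx).2).continuousWithinAt
  have hcoord : ∀ x, γ x ∈ R.arc e → x ∈ stereoCoord c (R.pt v) '' R.arc e := fun x hx =>
    ⟨γ x, hx, stereoCoord_stereo hr hv x⟩
  set x := stereoCoord c (R.pt v) (R.pt w)
  have hin : x ∈ stereoCoord c (R.pt v) '' R.arc e := by
    refine hpre.ordConnected.out (hcoord _ (hes' ⟨min (x - 1) (B' - 1), ?_, rfl⟩))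
      (hcoord _ (hes ⟨max (x + 1) (B + 1), ?_, rfl⟩)) ⟨?_, ?_⟩
    · exact (min_le_right (x - 1) (B' - 1)).trans_lt (sub_one_lt B')
    · exact (lt_add_one B).trans_le (le_max_right (x + 1) (B + 1))
    · exact (min_le_left _ _).trans (by linarith)
    · exact le_trans (by linarith) (le_max_left _ _)
  obtain ⟨y, hy, hyx⟩ := hin
  have := stereoCoord_injOn hr hv (hsubset y hy).1 (hsubset y hy).2 hwc hwne hyx
  exact R.pt_notMem_arc w e (this ▸ hy)

/-- The edges of a circle cannot be split into two classes that meet at one vertex only. -/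
theorem edges_separation [Finite V] {c : Sphere Plane} (hc : c ∈ R.S) (T : G.edgeSet → Prop)
    {v : V} (hv : R.pt v ∈ c)
    (hT : ∀ e e', R.circ e = c → R.circ e' = c → ∀ w, w ≠ v → w ∈ e.1 → w ∈ e'.1 → T e → T e')
    {e e' : G.edgeSet} (he : R.circ e = c) (he' : R.circ e' = c) (hTe : T e) : T e' := by
  by_contra hTe'
  have hr := R.radius_pos c hc
  have hfin : Finite G.edgeSet := inferInstance
  -- The closed arcs of the two classes cover the circle without `v`, which is connected. A point in
  -- both unions is a vertex other than `v` shared by an edge of each class, against `hT`.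
  let U : Prop → Set Plane := fun p => ⋃ f : {f // R.circ f = c ∧ (T f ↔ p)}, closure (R.arc f)
  have hU : ∀ p, IsClosed (U p) := fun p => isClosed_iUnion_of_finite fun _ => isClosed_closure
  have hpre : IsPreconnected ((c : Set Plane) \ {R.pt v}) := by
    rw [circle_diff_point hr hv]
    exact isPreconnected_range (stereo_continuous _ _)
  have hcover : (c : Set Plane) \ {R.pt v} ⊆ U True ∪ U False := by
    rintro x ⟨hx, -⟩
    have : ∃ f, R.circ f = c ∧ x ∈ closure (R.arc f) := by
      by_cases hxM : x ∈ meetingPoints R.S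
      · rw [← R.range_pt] at hxM
        obtain ⟨w, rfl⟩ := hxM
        obtain ⟨f, -, -, hf, -, hfc, -⟩ := R.exists_two_edges hc hx
        exact ⟨f, hfc, R.mem_closure_arc hf⟩
      · obtain ⟨f, hf, hxf⟩ := R.exists_edge_of_connected hc (isPreconnected_singleton (x := x))
          (Set.singleton_nonempty x) (Set.singleton_subset_iff.2 ⟨hx, hxM⟩)
        exact ⟨f, hf, subset_closure (hxf rfl)⟩
    obtain ⟨f, hf, hxf⟩ := this
    by_cases hTf : T f
    · exact Or.inl (Set.mem_iUnion.2 ⟨⟨f, hf, by simp [hTf]⟩, hxf⟩)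
    · exact Or.inr (Set.mem_iUnion.2 ⟨⟨f, hf, by simp [hTf]⟩, hxf⟩)
  have hmeet : ∀ (p : Prop) (f : G.edgeSet), R.circ f = c → (T f ↔ p) →
      (((c : Set Plane) \ {R.pt v}) ∩ U p).Nonempty := by
    intro p f hf hTf
    obtain ⟨x, hx⟩ := R.arc_nonempty f
    refine ⟨x, ⟨hf ▸ (R.arc_subset f hx).1, ?_⟩, Set.mem_iUnion.2 ⟨⟨f, hf, hTf⟩,
      subset_closure hx⟩⟩
    rintro rfl
    exact R.pt_notMem_arc v f hx
  obtain ⟨x, ⟨-, hxv⟩, hx1, hx2⟩ := isPreconnected_closed_iff.1 hpre _ _ (hU True) (hU False)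
    hcover (hmeet True e he (by simp [hTe])) (hmeet False e' he' (by simp [hTe']))
  obtain ⟨⟨f, hf, hTf⟩, hxf⟩ := Set.mem_iUnion.1 hx1
  obtain ⟨⟨f', hf', hTf'⟩, hxf'⟩ := Set.mem_iUnion.1 hx2
  simp only [iff_true, iff_false] at hTf hTf' hxf hxf'
  have hff : f ≠ f' := fun h => hTf' (h ▸ hTf)
  have hxM : ∃ w, R.pt w = x := by
    by_cases h1 : x ∈ R.arc f
    · by_cases h2 : x ∈ R.arc f'
      · exact absurd (R.eq_of_mem_arc h1 h2) hff
      · obtain ⟨w, -, hw⟩ := R.exists_pt_of_mem_closure hxf' h2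
        exact ⟨w, hw⟩
    · obtain ⟨w, -, hw⟩ := R.exists_pt_of_mem_closure hxf h1
      exact ⟨w, hw⟩
  obtain ⟨w, rfl⟩ := hxM
  exact hTf' (hT f f' hf hf' w (fun h => hxv (by rw [h]; rfl)) (R.mem_of_pt_mem_closure hxf)
    (R.mem_of_pt_mem_closure hxf') hTf)

/-! ### The circles of the edges at a vertex -/

open Classical in
/-- The circle of the edge between two adjacent vertices. -/
noncomputable def col (u v : V) : Sphere Plane :=
  if h : G.Adj u v then R.circ ⟨s(u, v), h⟩ else ⟨0, 0⟩

theorem col_eq {u v : V} (h : G.Adj u v) : R.col u v = R.circ ⟨s(u, v), h⟩ := dif_pos h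

theorem col_comm {u v : V} (h : G.Adj u v) : R.col u v = R.col v u := by
  rw [R.col_eq h, R.col_eq h.symm]
  congr 1
  exact Subtype.ext Sym2.eq_swap

theorem col_mem {u v : V} (h : G.Adj u v) : R.col u v ∈ R.S := R.col_eq h ▸ R.circ_mem _

theorem pt_mem_col {u v : V} (h : G.Adj u v) : R.pt u ∈ R.col u v :=
  R.col_eq h ▸ R.pt_mem_circ (by simp)

theorem pt_mem_col_right {u v : V} (h : G.Adj u v) : R.pt v ∈ R.col u v :=
  R.col_eq h ▸ R.pt_mem_circ (by simp)

theorem exists_two_neighbors [Finite V] {c : Sphere Plane} (hc : c ∈ R.S) {v : V}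
    (hv : R.pt v ∈ c) :
    ∃ x y, x ≠ y ∧ G.Adj v x ∧ G.Adj v y ∧ R.col v x = c ∧ R.col v y = c := by
  obtain ⟨⟨e, he⟩, ⟨e', he'⟩, hne, hv, hv', hc, hc'⟩ := R.exists_two_edges hc hv
  obtain ⟨x, rfl⟩ := Sym2.mem_iff_exists.1 hv
  obtain ⟨y, rfl⟩ := Sym2.mem_iff_exists.1 hv'
  refine ⟨x, y, ?_, he, he', (R.col_eq he).trans hc, (R.col_eq he').trans hc'⟩
  rintro rfl
  exact hne rfl

/-- At a vertex with four neighbours, the edges are paired by the two circles through it. -/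
theorem pairing [Finite V] {v a b c d : V}
    (hN : ∀ x, G.Adj v x ↔ x = a ∨ x = b ∨ x = c ∨ x = d) :
    (R.col v a = R.col v b ∧ R.col v c = R.col v d ∧ R.col v a ≠ R.col v c) ∨
    (R.col v a = R.col v c ∧ R.col v b = R.col v d ∧ R.col v a ≠ R.col v b) ∨
    (R.col v a = R.col v d ∧ R.col v b = R.col v c ∧ R.col v a ≠ R.col v b) := by
  obtain ⟨C, hC, C', hC', hne, h, h'⟩ := R.pt_mem_meetingPoints v
  obtain ⟨x, y, hxy, hx, hy, hxC, hyC⟩ := R.exists_two_neighbors hC h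
  obtain ⟨x', y', hxy', hx', hy', hxC', hyC'⟩ := R.exists_two_neighbors hC' h'
  rw [hN] at hx hy hx' hy'
  -- Each of the two different circles takes at least two of the four edges, so each takes exactly
  -- two.
  rcases hx with rfl | rfl | rfl | rfl <;> rcases hy with rfl | rfl | rfl | rfl <;> grind

/-- The edges of a circle satisfy `T` if one does and `T` changes at most at the vertex `v`. -/
theorem separation [Finite V] {c : Sphere Plane} (T : V → V → Prop)
    (hsymm : ∀ x y, T x y → T y x) {v : V} (hv : R.pt v ∈ c)
    (hT : ∀ w x y, w ≠ v → G.Adj w x → G.Adj w y → R.col w x = c → R.col w y = c → T w x → T w y)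
    {x y : V} (hxy : G.Adj x y) (hc : R.col x y = c) (hTxy : T x y)
    {x' y' : V} (hxy' : G.Adj x' y') (hc' : R.col x' y' = c) : T x' y' := by
  have hcS : c ∈ R.S := hc ▸ R.col_mem hxy
  have := R.edges_separation hcS (fun e => ∀ a b, e.1 = s(a, b) → T a b) hv
    (e := ⟨s(x, y), hxy⟩) (e' := ⟨s(x', y'), hxy'⟩) ?_ (by rw [← hc, R.col_eq hxy])
    (by rw [← hc', R.col_eq hxy']) ?_
  · exact this x' y' rfl
  · rintro ⟨e, he⟩ ⟨e', he'⟩ hec hec' w hw hwe hwe' hTe a b hab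
    obtain ⟨p, rfl⟩ := Sym2.mem_iff_exists.1 hwe
    obtain ⟨q, rfl⟩ := Sym2.mem_iff_exists.1 hwe'
    have h1 : T w q := hT w p q hw he he' ((R.col_eq he).trans hec) ((R.col_eq he').trans hec')
      (hTe w p rfl)
    rcases Sym2.eq_iff.1 hab with ⟨rfl, rfl⟩ | ⟨rfl, rfl⟩
    · exact h1
    · exact hsymm _ _ h1
  · intro a b hab
    rcases Sym2.eq_iff.1 hab with ⟨rfl, rfl⟩ | ⟨rfl, rfl⟩
    · exact hTxy
    · exact hsymm _ _ hTxy

/-- Two circles with three common vertices are equal. -/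
theorem eq_of_three {c c' : Sphere Plane} {u v w : V} (huv : u ≠ v) (huw : u ≠ w) (hvw : v ≠ w)
    (h1 : R.pt u ∈ c) (h2 : R.pt v ∈ c) (h3 : R.pt w ∈ c) (h1' : R.pt u ∈ c') (h2' : R.pt v ∈ c')
    (h3' : R.pt w ∈ c') : c = c' := by
  by_contra hne
  have := EuclideanGeometry.eq_of_mem_sphere_of_mem_sphere_of_finrank_eq_two
    (by simp : Module.finrank ℝ Plane = 2) hne (fun h => huv (R.pt_injective h)) h1 h2 h3 h1' h2' h3'
  rcases this with h | h
  · exact huw (R.pt_injective h.symm)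
  · exact hvw (R.pt_injective h.symm)

/-- Common points of different circles are vertices. -/
theorem exists_pt_of_mem {c c' : Sphere Plane} (hc : c ∈ R.S) (hc' : c' ∈ R.S) (hne : c ≠ c')
    {x : Plane} (hx : x ∈ c) (hx' : x ∈ c') : ∃ v, R.pt v = x := by
  have : x ∈ Set.range R.pt := by
    rw [R.range_pt]
    exact ⟨c, hc, c', hc', hne, hx, hx'⟩
  exact this

end CircleRealization

/-! ### Order of consecutive vertices on a circle -/

theorem mem_of_mem_closure_of_lt {J : Set ℝ} (hJ : IsPreconnected J) {a b t : ℝ}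
    (ha : a ∈ closure J) (hb : b ∈ closure J) (hat : a < t) (htb : t < b) : t ∈ J := by
  obtain ⟨a', ha', haJ⟩ := mem_closure_iff.1 ha (Set.Iio t) isOpen_Iio hat
  obtain ⟨b', hb', hbJ⟩ := mem_closure_iff.1 hb (Set.Ioi t) isOpen_Ioi htb
  exact hJ.ordConnected.out haJ hbJ ⟨le_of_lt ha', le_of_lt hb'⟩

/-- A sequence of reals without turning points is monotone. -/
theorem monotone_or_antitone_of_no_turn {f : ℕ → ℝ} {n : ℕ} (hne : ∀ i < n, f i ≠ f (i + 1))
    (hup : ∀ i, i + 1 < n → ¬ (f i < f (i + 1) ∧ f (i + 2) < f (i + 1)))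
    (hdown : ∀ i, i + 1 < n → ¬ (f (i + 1) < f i ∧ f (i + 1) < f (i + 2))) :
    (∀ i j, i < j → j ≤ n → f i < f j) ∨ (∀ i j, i < j → j ≤ n → f j < f i) := by
  rcases Nat.eq_zero_or_pos n with rfl | hn
  · left; intro i j h1 h2; omega
  rcases lt_or_gt_of_ne (hne 0 hn) with h0 | h0
  · have hs : ∀ i < n, f i < f (i + 1) := by
      intro i
      induction i with
      | zero => exact fun _ => h0
      | succ i ih =>
        intro hi
        exact lt_of_le_of_ne (not_lt.1 fun h => hup i hi ⟨ih (by omega), h⟩) (hne _ hi)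
    left
    intro i j hij
    induction j, hij using Nat.le_induction with
    | base => exact fun h => hs i h
    | succ j hj ih => exact fun h => (ih (by omega)).trans (hs j h)
  · have hs : ∀ i < n, f (i + 1) < f i := by
      intro i
      induction i with
      | zero => exact fun _ => h0
      | succ i ih =>
        intro hi
        exact lt_of_le_of_ne (not_lt.1 fun h => hdown i hi ⟨ih (by omega), h⟩) (hne _ hi).symm
    right
    intro i j hij
    induction j, hij using Nat.le_induction with
    | base => exact fun h => hs i h
    | succ j hj ih => exact fun h => (hs j h).trans (ih (by omega))

namespace CircleRealization

variable {V : Type*} {G : SimpleGraph V} (R : CircleRealization G)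

/-- The vertices of a path along a circle are in monotone order with respect to a stereographic
coordinate from another vertex. -/
theorem path_monotone {c : Sphere Plane} (hc : c ∈ R.S) {u : V} (hu : R.pt u ∈ c) {n : ℕ}
    (y : ℕ → V) (hadj : ∀ i < n, G.Adj (y i) (y (i + 1))) (hcol : ∀ i < n, R.col (y i) (y (i + 1)) = c)
    (hyu : ∀ i ≤ n, y i ≠ u) (hy : ∀ i, i + 1 < n → y i ≠ y (i + 2)) :
    (∀ i j, i < j → j ≤ n → stereoCoord c (R.pt u) (R.pt (y i)) <
      stereoCoord c (R.pt u) (R.pt (y j))) ∨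
    (∀ i j, i < j → j ≤ n → stereoCoord c (R.pt u) (R.pt (y j)) <
      stereoCoord c (R.pt u) (R.pt (y i))) := by
  have hr := R.radius_pos c hc
  have hcirc : ∀ i (hi : i < n), R.circ ⟨s(y i, y (i + 1)), hadj i hi⟩ = c := fun i hi => by
    rw [← R.col_eq (hadj i hi), hcol i hi]
  have hsub : ∀ i (hi : i < n), ∀ x ∈ R.arc ⟨s(y i, y (i + 1)), hadj i hi⟩, x ∈ c ∧ x ≠ R.pt u := by
    intro i hi x hx
    refine ⟨?_, fun h => R.pt_notMem_arc u _ (h ▸ hx)⟩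
    have := (R.arc_subset _ hx).1
    rwa [hcirc i hi] at this
  -- The arcs of the path edges become intervals. Consecutive ones are disjoint as their edges
  -- differ by `hy`, but at a turning point of the sequence they would overlap.
  let J : ∀ i, i < n → Set ℝ := fun i hi =>
    stereoCoord c (R.pt u) '' R.arc ⟨s(y i, y (i + 1)), hadj i hi⟩
  have hJ : ∀ i hi, IsPreconnected (J i hi) := fun i hi =>
    (R.arc_isPreconnected _).image _ fun x hx =>
      (stereoCoord_continuousAt hr hu (hsub i hi x hx).1 (hsub i hi x hx).2).continuousWithinAt
  have hptc : ∀ i (hi : i < n) v, v ∈ s(y i, y (i + 1)) → R.pt v ∈ c := fun i hi v hv =>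
    hcirc i hi ▸ R.pt_mem_circ (e := ⟨s(y i, y (i + 1)), hadj i hi⟩) hv
  have hcl : ∀ i (hi : i < n) v, v ∈ s(y i, y (i + 1)) → v ≠ u →
      stereoCoord c (R.pt u) (R.pt v) ∈ closure (J i hi) := by
    intro i hi v hv hvu
    have hcont := stereoCoord_continuousAt hr hu (hptc i hi v hv)
      (fun h => hvu (R.pt_injective h))
    exact hcont.continuousWithinAt.mem_closure_image
      (R.mem_closure_arc (e := ⟨s(y i, y (i + 1)), hadj i hi⟩) hv)
  have hdisj : ∀ i (hi : i + 1 < n), ∀ t, t ∈ J i (by omega) → t ∉ J (i + 1) hi := by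
    rintro i hi t ⟨x, hx, rfl⟩ ⟨x', hx', hxx⟩
    have h1 := hsub i (by omega) x hx
    have h2 := hsub (i + 1) hi x' hx'
    have h3 := stereoCoord_injOn hr hu h2.1 h2.2 h1.1 h1.2 hxx
    subst h3
    have h4 := congrArg Subtype.val (R.eq_of_mem_arc hx hx')
    simp only at h4
    rcases Sym2.eq_iff.1 h4 with ⟨h5, -⟩ | ⟨h5, -⟩
    · exact (hadj i (by omega)).ne h5
    · exact hy i hi h5
  apply monotone_or_antitone_of_no_turn (f := fun i => stereoCoord c (R.pt u) (R.pt (y i)))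
  · intro i hi h
    have := stereoCoord_injOn hr hu (hptc i hi _ (by simp))
      (fun h => hyu i hi.le (R.pt_injective h)) (hptc i hi _ (by simp))
      (fun h => hyu (i + 1) hi (R.pt_injective h)) h
    exact (hadj i hi).ne (R.pt_injective this)
  · rintro i hi ⟨h1, h2⟩
    obtain ⟨t, ht, ht'⟩ := exists_between (max_lt h1 h2)
    rw [max_lt_iff] at ht
    exact hdisj i hi t
      (mem_of_mem_closure_of_lt (hJ i (by omega)) (hcl i (by omega) _ (by simp) (hyu _ (by omega)))
        (hcl i (by omega) _ (by simp) (hyu _ (by omega))) ht.1 ht')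
      (mem_of_mem_closure_of_lt (hJ (i + 1) hi) (hcl (i + 1) hi _ (by simp) (hyu (i + 2) (by omega)))
        (hcl (i + 1) hi _ (by simp) (hyu _ (by omega))) ht.2 ht')
  · rintro i hi ⟨h1, h2⟩
    obtain ⟨t, ht', ht⟩ := exists_between (lt_min h1 h2)
    rw [lt_min_iff] at ht
    exact hdisj i hi t
      (mem_of_mem_closure_of_lt (hJ i (by omega)) (hcl i (by omega) _ (by simp) (hyu _ (by omega)))
        (hcl i (by omega) _ (by simp) (hyu _ (by omega))) ht' ht.1)
      (mem_of_mem_closure_of_lt (hJ (i + 1) hi) (hcl (i + 1) hi _ (by simp) (hyu _ (by omega)))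
        (hcl (i + 1) hi _ (by simp) (hyu (i + 2) (by omega))) ht' ht.2)

end CircleRealization

/-! ### Gadgets in a realization -/

section gadgets

variable {m : OctEdge → ℕ} {A : ∀ e, Attachment (m e)}
  {L : ∀ e, Fin (m e) → Fin 2 → Fin 2 → LoopPiece} (hL : ∀ e p t s, (L e p t s).Admissible)
  (R : CircleRealization (augGraph m A L))

/-- The vertices of a loop-subgraph. -/
def InLoop (e : OctEdge) (p : Fin (m e)) (t s : Fin 2) (v : AugVertex m L) : Prop :=
  v = .root e p t s ∨ ∃ x, v = .loop e p t s x

/-- End `s` of gadget `t` of pair `p`. -/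
abbrev gadgetEnd (A : ∀ e, Attachment (m e)) (L : ∀ e, Fin (m e) → Fin 2 → Fin 2 → LoopPiece)
    (e : OctEdge) (p : Fin (m e)) (t s : Fin 2) : AugVertex m L :=
  .path e ((A e).pos (p, slot t s))

variable (A L) in
/-- The three vertices of a triangle in a gadget. -/
def InTriangle (e : OctEdge) (p : Fin (m e)) (t s : Fin 2) (v : AugVertex m L) : Prop :=
  v = gadgetEnd A L e p t s ∨ v = .root e p t s ∨ v = .hub e p t

theorem adj_end_hub (e : OctEdge) (p : Fin (m e)) (t s : Fin 2) :
    (augGraph m A L).Adj (gadgetEnd A L e p t s) (.hub e p t) :=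
  augGraph_adj.2 (Or.inl (.endHub e p t s))

theorem adj_end_root (e : OctEdge) (p : Fin (m e)) (t s : Fin 2) :
    (augGraph m A L).Adj (gadgetEnd A L e p t s) (.root e p t s) :=
  augGraph_adj.2 (Or.inl (.endRoot e p t s))

theorem adj_root_hub (e : OctEdge) (p : Fin (m e)) (t s : Fin 2) :
    (augGraph m A L).Adj (.root e p t s) (.hub e p t) :=
  augGraph_adj.2 (Or.inl (.rootHub e p t s))

theorem gadgetEnd_ne (e : OctEdge) (p : Fin (m e)) (t : Fin 2) :
    gadgetEnd A L e p t 0 ≠ gadgetEnd A L e p t 1 := by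
  have := (A e).pos_slot_lt p t
  simp only [gadgetEnd, ne_eq, AugVertex.path.injEq, heq_eq_eq, true_and]
  intro h
  rw [h] at this
  exact lt_irrefl _ this

include hL

/-- The circles through the loop edges at a root stay in the loop-subgraph. -/
theorem inLoop_of_col_eq {e : OctEdge} {p : Fin (m e)} {t s : Fin 2} {x₀ : (L e p t s).V}
    (h₀ : (augGraph m A L).Adj (.root e p t s) (.loop e p t s x₀)) {x y : AugVertex m L}
    (hxy : (augGraph m A L).Adj x y)
    (hcol : R.col x y = R.col (.root e p t s) (.loop e p t s x₀)) : InLoop e p t s x := by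
  have := augVertex_finite hL
  -- The root is a cut vertex: every neighbour of any other vertex of the loop-subgraph is in the
  -- loop-subgraph.
  refine (R.separation (fun x y => InLoop e p t s x ∧ InLoop e p t s y) (fun _ _ h => h.symm)
    (R.pt_mem_col h₀) ?_ h₀ rfl ⟨Or.inl rfl, Or.inr ⟨x₀, rfl⟩⟩ hxy hcol).1
  rintro w x y hw - hwy - - ⟨hwl, -⟩
  refine ⟨hwl, ?_⟩
  obtain ⟨z, rfl⟩ := hwl.resolve_left hw
  have hmem : y ∈ (augGraph m A L).neighborSet (.loop e p t s z) := hwy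
  rw [loop_neighborSet hL] at hmem
  obtain ⟨q, -, rfl⟩ := hmem
  unfold loopNeighbour
  split_ifs
  · exact Or.inl rfl
  · exact Or.inr ⟨q, rfl⟩

/-- The circles of the two loop edges cannot contain the edge to the gadget end, so only one of the
three pairings at the root remains. -/
theorem col_root_end (e : OctEdge) (p : Fin (m e)) (t s : Fin 2) :
    R.col (.root e p t s) (gadgetEnd A L e p t s) = R.col (.root e p t s) (.hub e p t) := by
  have := augVertex_finite hL
  have ha : (augGraph m A L).Adj (.root e p t s) (.loop e p t s (L e p t s).a) :=
    augGraph_adj.2 (Or.inl (.rootA e p t s))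
  have h1 : R.col (.root e p t s) (gadgetEnd A L e p t s) ≠
      R.col (.root e p t s) (.loop e p t s (L e p t s).a) := by
    intro h
    rw [R.col_comm (adj_end_root e p t s).symm] at h
    rcases inLoop_of_col_eq hL R ha (adj_end_root e p t s) h with h | ⟨x, h⟩ <;> cases h
  have hb : (augGraph m A L).Adj (.root e p t s) (.loop e p t s (L e p t s).b) :=
    augGraph_adj.2 (Or.inl (.rootB e p t s))
  have h2 : R.col (.root e p t s) (gadgetEnd A L e p t s) ≠
      R.col (.root e p t s) (.loop e p t s (L e p t s).b) := by
    intro h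
    rw [R.col_comm (adj_end_root e p t s).symm] at h
    rcases inLoop_of_col_eq hL R hb (adj_end_root e p t s) h with h | ⟨x, h⟩ <;> cases h
  rcases R.pairing (fun x => root_adj (A := A) (L := L) (e := e) (p := p) (t := t) (s := s) x) with
    h | h | h
  · exact h.1
  · exact absurd h.1 h1
  · exact absurd h.1 h2

/-- The two triangles of a gadget are on different circles. -/
theorem col_hub (e : OctEdge) (p : Fin (m e)) (t : Fin 2) :
    (∀ s, R.col (.hub e p t) (gadgetEnd A L e p t s) = R.col (.hub e p t) (.root e p t s)) ∧
    R.col (.hub e p t) (.root e p t 0) ≠ R.col (.hub e p t) (.root e p t 1) := by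
  have := augVertex_finite hL
  have hend : ∀ s, R.pt (gadgetEnd A L e p t s) ∈ R.col (.hub e p t) (.root e p t s) := by
    intro s
    rw [← R.col_comm (adj_root_hub e p t s), ← col_root_end hL R]
    exact R.pt_mem_col_right (adj_end_root e p t s).symm
  have hend' : ∀ s, R.pt (gadgetEnd A L e p t s) ∈ R.col (.hub e p t) (gadgetEnd A L e p t s) :=
    fun s => R.pt_mem_col_right (adj_end_hub e p t s).symm
  have hhub : ∀ s, R.pt (.hub e p t) ∈ R.col (.hub e p t) (gadgetEnd A L e p t s) :=
    fun s => R.pt_mem_col (adj_end_hub e p t s).symm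
  have hhub' : ∀ s, R.pt (.hub e p t) ∈ R.col (.hub e p t) (.root e p t s) :=
    fun s => R.pt_mem_col (adj_root_hub e p t s).symm
  have hne : ∀ s, gadgetEnd A L e p t s ≠ .hub e p t := fun s => by simp
  rcases R.pairing (fun x => hub_adj (A := A) (L := L) (e := e) (p := p) (t := t) x) with
    ⟨h1, h2, h3⟩ | ⟨h1, h2, h3⟩ | ⟨h1, h2, h3⟩
  -- In either wrong pairing at the hub, the two different circles there would both contain the hub
  -- and both gadget ends.
  · refine absurd (R.eq_of_three (gadgetEnd_ne e p t) (hne 0) (hne 1) (hend' 0) ?_ (hhub 0)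
      (hend 0) ?_ (hhub' 0)) h3
    · exact h1 ▸ hend' 1
    · exact h2 ▸ hend 1
  · refine ⟨fun s => ?_, by rwa [← h1, ← h2]⟩
    fin_cases s
    · exact h1
    · exact h2
  · refine absurd (R.eq_of_three (gadgetEnd_ne e p t) (hne 0) (hne 1) (hend' 0) ?_ (hhub 0)
      ?_ (hend' 1) (hhub 1)) h3
    · exact h1 ▸ hend 1
    · exact h2 ▸ hend 0

/-- The circle through a triangle of a gadget. -/
noncomputable abbrev gadgetCircle (R : CircleRealization (augGraph m A L)) (e : OctEdge)
    (p : Fin (m e)) (t s : Fin 2) : Sphere Plane :=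
  R.col (.hub e p t) (.root e p t s)

omit hL in
theorem gadgetCircle_mem (e : OctEdge) (p : Fin (m e)) (t s : Fin 2) :
    gadgetCircle R e p t s ∈ R.S := R.col_mem (adj_root_hub e p t s).symm

theorem col_end_hub (e : OctEdge) (p : Fin (m e)) (t s : Fin 2) :
    R.col (gadgetEnd A L e p t s) (.hub e p t) = gadgetCircle R e p t s := by
  rw [R.col_comm (adj_end_hub e p t s), (col_hub hL R e p t).1]

theorem col_end_root (e : OctEdge) (p : Fin (m e)) (t s : Fin 2) :
    R.col (gadgetEnd A L e p t s) (.root e p t s) = gadgetCircle R e p t s := by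
  rw [R.col_comm (adj_end_root e p t s), col_root_end hL R, R.col_comm (adj_root_hub e p t s)]

theorem gadgetCircle_ne (e : OctEdge) (p : Fin (m e)) (t : Fin 2) {s s' : Fin 2} (h : s ≠ s') :
    gadgetCircle R e p t s ≠ gadgetCircle R e p t s' := by
  have := (col_hub hL R e p t).2
  fin_cases s <;> fin_cases s' <;> first | exact absurd rfl h | exact this | exact this.symm

/-- Separation is applied with the gadget end as the excepted vertex. At the root the circle cannot
continue into the loop, and at the hub it cannot pass to the other triangle. -/
theorem inTriangle_of_col_eq {e : OctEdge} {p : Fin (m e)} {t s : Fin 2} {x y : AugVertex m L}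
    (hxy : (augGraph m A L).Adj x y) (hcol : R.col x y = gadgetCircle R e p t s) :
    InTriangle A L e p t s x := by
  have := augVertex_finite hL
  refine (R.separation (fun x y => InTriangle A L e p t s x ∧ InTriangle A L e p t s y)
    (fun _ _ h => h.symm) (v := gadgetEnd A L e p t s) ?_ ?_ (adj_root_hub e p t s).symm rfl
    ⟨Or.inr (Or.inr rfl), Or.inr (Or.inl rfl)⟩ hxy hcol).1
  · have := R.pt_mem_col (adj_end_hub e p t s)
    rwa [col_end_hub hL R] at this
  · rintro w x y hw - hwy - hcy ⟨hwt, -⟩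
    refine ⟨hwt, ?_⟩
    rcases hwt.resolve_left hw with rfl | rfl
    · have hloop : ∀ z, y ≠ .loop e p t s z := by
        rintro z rfl
        rcases inLoop_of_col_eq hL R hwy (adj_root_hub e p t s).symm hcy.symm with h | ⟨x, h⟩ <;>
          cases h
      rcases (root_adj y).1 hwy with rfl | rfl | h | h
      · exact Or.inl rfl
      · exact Or.inr (Or.inr rfl)
      · exact absurd h (hloop _)
      · exact absurd h (hloop _)
    · have hs : ∀ s', (y = gadgetEnd A L e p t s' ∨ y = .root e p t s') → s' = s := by
        intro s' hy
        by_contra hne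
        apply gadgetCircle_ne hL R e p t hne
        refine Eq.trans ?_ hcy
        rcases hy with rfl | rfl
        · exact ((col_hub hL R e p t).1 s').symm
        · rfl
      rcases (hub_adj y).1 hwy with h | h | h | h
      · have := hs 0 (Or.inl h); subst this; exact Or.inl h
      · have := hs 1 (Or.inl h); subst this; exact Or.inl h
      · have := hs 0 (Or.inr h); subst this; exact Or.inr (Or.inl h)
      · have := hs 1 (Or.inr h); subst this; exact Or.inr (Or.inl h)

theorem inTriangle_of_mem {e : OctEdge} {p : Fin (m e)} {t s : Fin 2} {x : AugVertex m L}
    (hx : R.pt x ∈ gadgetCircle R e p t s) : InTriangle A L e p t s x := by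
  have := augVertex_finite hL
  obtain ⟨y, -, -, hy, -, hc, -⟩ := R.exists_two_neighbors (gadgetCircle_mem R e p t s) hx
  exact inTriangle_of_col_eq hL R hy hc

/-- The edges from a gadget end to its hub and root already share a circle, so the pairing there
leaves the two path edges together. -/
theorem col_path (e : OctEdge) (p : Fin (m e)) (t s : Fin 2) :
    R.col (gadgetEnd A L e p t s) (predVertex L e ((A e).pos (p, slot t s))) =
      R.col (gadgetEnd A L e p t s) (succVertex L e ((A e).pos (p, slot t s))) ∧
    R.col (gadgetEnd A L e p t s) (predVertex L e ((A e).pos (p, slot t s))) ≠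
      gadgetCircle R e p t s := by
  have := augVertex_finite hL
  have h : R.col (gadgetEnd A L e p t s) (.hub e p t) =
      R.col (gadgetEnd A L e p t s) (.root e p t s) := by
    rw [col_end_hub hL R, col_end_root hL R]
  rcases R.pairing (fun x => path_adj (A := A) (L := L) (rfl : _ = (A e).pos (p, slot t s)) x) with
    ⟨h1, h2, h3⟩ | ⟨h1, h2, h3⟩ | ⟨h1, h2, h3⟩
  · exact ⟨h1, by rwa [← col_end_hub hL R]⟩
  · exact absurd (h1.trans (h.trans h2.symm)) h3
  · exact absurd (h1.trans (h.symm.trans h2.symm)) h3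

omit hL in
theorem adj_pred (e : OctEdge) (i : Fin (4 * m e)) :
    (augGraph m A L).Adj (.path e i) (predVertex L e i) := by
  obtain ⟨p, t, s, hi⟩ := (A e).exists_slot i
  exact (path_adj hi _).2 (Or.inl rfl)

omit hL in
theorem adj_succ (e : OctEdge) (i : Fin (4 * m e)) :
    (augGraph m A L).Adj (.path e i) (succVertex L e i) := by
  obtain ⟨p, t, s, hi⟩ := (A e).exists_slot i
  exact (path_adj hi _).2 (Or.inr (Or.inl rfl))

/-- A path that replaces an octahedron edge lies on one circle. -/
theorem exists_path_circle (e : OctEdge) : ∃ C ∈ R.S,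
    (∀ i, R.col (.path e i) (predVertex L e i) = C ∧ R.col (.path e i) (succVertex L e i) = C) ∧
    R.pt (.oct e.1.1) ∈ C := by
  have hm : 0 < 4 * m e := by have := (A e).two_le; omega
  have hpred0 : predVertex L e ⟨0, hm⟩ = .oct e.1.1 := rfl
  refine ⟨R.col (.path e ⟨0, hm⟩) (predVertex L e ⟨0, hm⟩), R.col_mem (adj_pred e _), ?_,
    R.pt_mem_col_right (adj_pred e _)⟩
  have hps : ∀ i, R.col (.path e i) (predVertex L e i) = R.col (.path e i) (succVertex L e i) := by
    intro i
    obtain ⟨p, t, s, rfl⟩ := (A e).exists_slot i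
    exact (col_path hL R e p t s).1
  have hpred : ∀ i, R.col (.path e i) (predVertex L e i) =
      R.col (.path e ⟨0, hm⟩) (predVertex L e ⟨0, hm⟩) := by
    rintro ⟨n, hn⟩
    induction n with
    | zero => rfl
    | succ n ih =>
      have h1 := ih (by omega)
      rw [hps] at h1
      have h2 : succVertex L e ⟨n, by omega⟩ = .path e ⟨n + 1, hn⟩ := by
        unfold succVertex
        rw [dif_pos (by simpa using hn)]
      have h3 : predVertex L e ⟨n + 1, hn⟩ = .path e ⟨n, by omega⟩ := by
        unfold predVertex
        rw [if_neg (by simp)]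
        rfl
      have h4 := adj_succ (A := A) (L := L) e ⟨n, by omega⟩
      rw [h2] at h1 h4
      rw [h3, ← R.col_comm h4, h1]
  exact fun i => ⟨hpred i, (hps i).symm.trans (hpred i)⟩

end gadgets

/-! ### Augmented octahedra are not realizable by circles -/

section realization

variable {m : OctEdge → ℕ} {A : ∀ e, Attachment (m e)}
  {L : ∀ e, Fin (m e) → Fin 2 → Fin 2 → LoopPiece} (hL : ∀ e p t s, (L e p t s).Admissible)
  (R : CircleRealization (augGraph m A L))

include hL

/-- The circle of a path touches the gadget circles at the path vertices. -/
theorem touchAt_path_circle {e : OctEdge} {C : Sphere Plane} (hCS : C ∈ R.S)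
    (hC : ∀ i, R.col (.path e i) (predVertex L e i) = C) (p : Fin (m e)) (t s : Fin 2) :
    TouchAt (gadgetCircle R e p t s) C (R.pt (gadgetEnd A L e p t s)) := by
  have := augVertex_finite hL
  have hne : ∀ s, gadgetCircle R e p t s ≠ C := fun s h =>
    (col_path hL R e p t s).2 ((hC _).trans h.symm)
  refine ⟨hne s, ?_, ?_, ?_⟩
  · have := R.pt_mem_col (adj_end_hub e p t s)
    rwa [col_end_hub hL R] at this
  · have := R.pt_mem_col (adj_pred (A := A) (L := L) e ((A e).pos (p, slot t s)))
    rwa [hC] at this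
  · intro Q hQ hQC
    obtain ⟨x, rfl⟩ := R.exists_pt_of_mem (gadgetCircle_mem R e p t s) hCS (hne s) hQ hQC
    -- `C` would continue from `x` along an edge. At the root or hub each such edge is on a gadget
    -- circle, different from `C`, or on a circle confined to the loop.
    obtain ⟨y, -, -, hy, -, hyC, -⟩ := R.exists_two_neighbors hCS hQC
    rcases inTriangle_of_mem hL R hQ with rfl | rfl | rfl
    · rfl
    · exfalso
      have hloop : ∀ z, y ≠ .loop e p t s z := by
        rintro z rfl
        rcases inLoop_of_col_eq hL R hy (adj_pred e ((A e).pos (p, slot t s)))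
          ((hC _).trans hyC.symm) with h | ⟨x, h⟩ <;> cases h
      rcases (root_adj y).1 hy with rfl | rfl | h | h
      · rw [← R.col_comm (adj_end_root e p t s), col_end_root hL R] at hyC
        exact hne s hyC
      · rw [R.col_comm (adj_root_hub e p t s)] at hyC
        exact hne s hyC
      · exact hloop _ h
      · exact hloop _ h
    · exfalso
      rcases (hub_adj y).1 hy with rfl | rfl | rfl | rfl
      · exact hne 0 (((col_hub hL R e p t).1 0).symm.trans hyC)
      · exact hne 1 (((col_hub hL R e p t).1 1).symm.trans hyC)
      · exact hne 0 hyC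
      · exact hne 1 hyC

/-- The two circles of a gadget touch at its hub. -/
theorem touchAt_hub (e : OctEdge) (p : Fin (m e)) (t : Fin 2) {s s' : Fin 2} (h : s ≠ s') :
    TouchAt (gadgetCircle R e p t s) (gadgetCircle R e p t s') (R.pt (.hub e p t)) := by
  have hne := gadgetCircle_ne hL R e p t h
  refine ⟨hne, R.pt_mem_col (adj_root_hub e p t s).symm,
    R.pt_mem_col (adj_root_hub e p t s').symm, fun Q hQ hQ' => ?_⟩
  obtain ⟨x, rfl⟩ := R.exists_pt_of_mem (gadgetCircle_mem R e p t s)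
    (gadgetCircle_mem R e p t s') hne hQ hQ'
  rcases inTriangle_of_mem hL R hQ with rfl | rfl | rfl
  · rcases inTriangle_of_mem hL R hQ' with h' | h' | h'
    · rw [AugVertex.path.injEq, heq_eq_eq] at h'
      exact absurd ((A e).pos_slot_eq (congrArg Fin.val h'.2)).2.2 h
    · cases h'
    · cases h'
  · rcases inTriangle_of_mem hL R hQ' with h' | h' | h'
    · cases h'
    · cases h'; exact absurd rfl h
    · cases h'
  · rfl

/-- Circles of different gadgets on an edge are disjoint. -/
theorem disjoint_gadgetCircle {e : OctEdge} {p p' : Fin (m e)} {t t' : Fin 2} (s s' : Fin 2)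
    (h : (p, t) ≠ (p', t')) (Q : Plane) (hQ : Q ∈ gadgetCircle R e p t s) :
    Q ∉ gadgetCircle R e p' t' s' := by
  intro hQ'
  have hvert : ∀ x, R.pt x ∈ gadgetCircle R e p t s → R.pt x ∈ gadgetCircle R e p' t' s' →
      False := by
    intro x hx hx'
    rcases inTriangle_of_mem hL R hx with rfl | rfl | rfl
    · rcases inTriangle_of_mem hL R hx' with h' | h' | h'
      · rw [AugVertex.path.injEq, heq_eq_eq] at h'
        obtain ⟨h1, h2, -⟩ := (A e).pos_slot_eq (congrArg Fin.val h'.2)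
        exact h (Prod.ext h1 h2)
      · cases h'
      · cases h'
    · rcases inTriangle_of_mem hL R hx' with h' | h' | h' <;> cases h'
      exact h rfl
    · rcases inTriangle_of_mem hL R hx' with h' | h' | h' <;> cases h'
      exact h rfl
  by_cases heq : gadgetCircle R e p t s = gadgetCircle R e p' t' s'
  · have := R.pt_mem_col (adj_root_hub (A := A) (L := L) e p t s).symm
    exact hvert _ this (heq ▸ this)
  · obtain ⟨x, rfl⟩ := R.exists_pt_of_mem (gadgetCircle_mem R e p t s)
      (gadgetCircle_mem R e p' t' s') heq hQ hQ'
    exact hvert x hQ hQ'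

omit hL in
/-- The vertices of a path are in monotone order on its circle. -/
theorem path_stereoCoord_monotone {e : OctEdge} {C : Sphere Plane} (hCS : C ∈ R.S)
    (hC : ∀ i, R.col (.path e i) (succVertex L e i) = C) (hu : R.pt (.oct e.1.1) ∈ C) :
    StrictMono (fun i => stereoCoord C (R.pt (.oct e.1.1)) (R.pt (.path e i))) ∨
    StrictAnti (fun i => stereoCoord C (R.pt (.oct e.1.1)) (R.pt (.path e i))) := by
  let y : ℕ → AugVertex m L := fun i => if h : i < 4 * m e then .path e ⟨i, h⟩ else .oct e.1.2
  have hy : ∀ i (h : i < 4 * m e), y i = .path e ⟨i, h⟩ := fun i h => dif_pos h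
  have hys : ∀ i (h : i < 4 * m e), y (i + 1) = succVertex L e ⟨i, h⟩ := fun i h => rfl
  have key := R.path_monotone hCS hu (n := 4 * m e - 1) y
    (fun i hi => by rw [hy i (by omega), hys i (by omega)]; exact adj_succ e _)
    (fun i hi => by rw [hy i (by omega), hys i (by omega)]; exact hC _)
    (fun i hi h => by
      have := (A e).two_le
      rw [hy i (by omega)] at h; cases h)
    (fun i hi h => by
      rw [hy i (by omega), hy (i + 2) (by omega), AugVertex.path.injEq, heq_eq_eq,
        Fin.mk.injEq] at h
      omega)
  refine key.imp (fun h i j hij => ?_) (fun h i j hij => ?_)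
  · have := h i j hij (by omega)
    rwa [hy i i.2, hy j j.2] at this
  · have := h i j hij (by omega)
    rwa [hy i i.2, hy j j.2] at this

omit hL in
/-- The order of the ends of two interlaced pairs. -/
theorem Attachment.interlaced_strictMono {k : ℕ} (B : Attachment k) {p q : Fin k}
    (h1 : B.pos (p, 1) < B.pos (q, 0)) (h2 : B.pos (q, 1) < B.pos (p, 2))
    (h3 : B.pos (p, 3) < B.pos (q, 2)) :
    StrictMono fun i : Fin 8 => B.pos ((![p, p, q, q, p, p, q, q] : Fin 8 → Fin k) i,
      slot ((![0, 1, 0, 1, 1, 0, 1, 0] : Fin 8 → Fin 2) i)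
        ((![0, 0, 0, 0, 1, 1, 1, 1] : Fin 8 → Fin 2) i)) := by
  rw [Fin.strictMono_iff_lt_succ]
  intro i
  fin_cases i
  · exact B.nested p (show (0 : Fin 4) < 1 by decide)
  · exact h1
  · exact B.nested q (show (0 : Fin 4) < 1 by decide)
  · exact h2
  · exact B.nested p (show (2 : Fin 4) < 3 by decide)
  · exact h3
  · exact B.nested q (show (2 : Fin 4) < 3 by decide)

-- A single octahedron edge gives the contradiction: the pole is its tail, and the eight gadget
-- circles of the two interlaced pairs on it violate `not_interlaced`.
omit R in
theorem augGraph_not_hasCircleRealization : ¬ (augGraph m A L).HasCircleRealization := by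
  intro hR
  obtain ⟨R⟩ := hR.nonempty
  let e : OctEdge := ⟨(0, 1), by decide, by decide⟩
  obtain ⟨C, hCS, hC, hu⟩ := exists_path_circle hL R e
  obtain ⟨p, q, h1, h2, h3⟩ := (A e).interlaced
  have hpq : p ≠ q := by
    rintro rfl
    exact absurd ((A e).nested p (show (0 : Fin 4) < 1 by decide)) (not_lt.2 h1.le)
  let P : Fin 8 → Fin (m e) := ![p, p, q, q, p, p, q, q]
  let T : Fin 8 → Fin 2 := ![0, 1, 0, 1, 1, 0, 1, 0]
  let S : Fin 8 → Fin 2 := ![0, 0, 0, 0, 1, 1, 1, 1]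
  have hmono : StrictMono fun i : Fin 8 => (A e).pos (P i, slot (T i) (S i)) :=
    (A e).interlaced_strictMono h1 h2 h3
  obtain ⟨K, hK, hK'⟩ := exists_weights (R.radius_pos C hCS) hu
    (fun i : Fin 8 => R.pt (gadgetEnd A L e (P i) (T i) (S i)))
    (fun i => gadgetCircle R e (P i) (T i) (S i))
    (fun i => R.radius_pos _ (gadgetCircle_mem R _ _ _ _))
    (fun i h => by cases R.pt_injective h)
    (fun i => touchAt_path_circle hL R hCS (fun i => (hC i).1) _ _ _)
  have hne : ∀ i j : Fin 8, i ≠ j → R.pt (gadgetEnd A L e (P i) (T i) (S i)) ≠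
      R.pt (gadgetEnd A L e (P j) (T j) (S j)) := by
    intro i j hij h
    have h := R.pt_injective h
    rw [AugVertex.path.injEq, heq_eq_eq] at h
    exact hij (hmono.injective h.2)
  let x : Fin 8 → ℝ := fun i => stereoCoord C (R.pt (.oct e.1.1))
    (R.pt (gadgetEnd A L e (P i) (T i) (S i)))
  have h05 : (x 0 - x 5) ^ 2 = K 0 * K 5 :=
    hK 0 5 (hne _ _ (by decide)) ⟨_, touchAt_hub hL R e p 0 (by decide)⟩
  have h14 : (x 1 - x 4) ^ 2 = K 1 * K 4 :=
    hK 1 4 (hne _ _ (by decide)) ⟨_, touchAt_hub hL R e p 1 (by decide)⟩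
  have h27 : (x 2 - x 7) ^ 2 = K 2 * K 7 :=
    hK 2 7 (hne _ _ (by decide)) ⟨_, touchAt_hub hL R e q 0 (by decide)⟩
  have h36 : (x 3 - x 6) ^ 2 = K 3 * K 6 :=
    hK 3 6 (hne _ _ (by decide)) ⟨_, touchAt_hub hL R e q 1 (by decide)⟩
  have hgad : ∀ i j : Fin 8, i < j → (i, j) ≠ (0, 5) → (i, j) ≠ (1, 4) → (i, j) ≠ (2, 7) →
      (i, j) ≠ (3, 6) → (P i, T i) ≠ (P j, T j) := by
    -- The pairs are encoded by Booleans so that the check over all index pairs is decidable.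
    have hP : ∀ i, P i = if (![false, false, true, true, false, false, true, true] : Fin 8 → Bool) i
        then q else p := by
      intro i; fin_cases i <;> rfl
    have hdec : ∀ i j : Fin 8, i < j → (i, j) ≠ (0, 5) → (i, j) ≠ (1, 4) → (i, j) ≠ (2, 7) →
        (i, j) ≠ (3, 6) →
        (![false, false, true, true, false, false, true, true] : Fin 8 → Bool) i ≠
          (![false, false, true, true, false, false, true, true] : Fin 8 → Bool) j ∨
        (![0, 1, 0, 1, 1, 0, 1, 0] : Fin 8 → Fin 2) i ≠
          (![0, 1, 0, 1, 1, 0, 1, 0] : Fin 8 → Fin 2) j := by decide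
    intro i j hij a1 a2 a3 a4 h
    rw [Prod.mk.injEq, hP, hP] at h
    rcases hdec i j hij a1 a2 a3 a4 with h' | h'
    · apply h'
      have := h.1
      split_ifs at this with b1 b2 b2
      · rw [b1, b2]
      · exact absurd this.symm hpq
      · exact absurd this hpq
      · rw [Bool.not_eq_true] at b1 b2; rw [b1, b2]
    · exact h' h.2
  have hdis : ∀ i j : Fin 8, i < j → (i, j) ≠ (0, 5) → (i, j) ≠ (1, 4) → (i, j) ≠ (2, 7) →
      (i, j) ≠ (3, 6) → K i * K j < (x i - x j) ^ 2 := fun i j hij a1 a2 a3 a4 =>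
    hK' i j (hne i j hij.ne) (disjoint_gadgetCircle hL R _ _ (hgad i j hij a1 a2 a3 a4))
  rcases path_stereoCoord_monotone R hCS (fun i => (hC i).2) hu with h | h
  · exact not_interlaced (h.comp hmono) h05 h14 h27 h36 hdis
  -- In the decreasing case the coordinates are negated, which preserves all squared differences.
  · have hneg : ∀ i j, (-x i - -x j) ^ 2 = (x i - x j) ^ 2 := fun i j => by ring
    refine not_interlaced (x := fun i => -x i) (K := K)
      (fun i j hij => neg_lt_neg (h (hmono hij))) ?_ ?_ ?_ ?_ ?_
    · rw [hneg, h05]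
    · rw [hneg, h14]
    · rw [hneg, h27]
    · rw [hneg, h36]
    · intro i j hij a1 a2 a3 a4
      rw [hneg]
      exact hdis i j hij a1 a2 a3 a4

omit R in
theorem augGraph_isCircleCounterexample : IsCircleCounterexample (augGraph m A L) where
  finite := augVertex_finite hL
  connected := augGraph_connected hL
  regular := augGraph_isFourRegular hL
  planar := augGraph_isPlanar A L hL
  not_realizable := augGraph_not_hasCircleRealization hL

end realization

/-! ### Infinite families -/

/-- A two-page layout of the octahedron. -/
def octahedronLayout : TwoPage (fun e : OctEdge => e.1.1) (fun e : OctEdge => e.1.2) ℕ where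
  -- The spine follows the Hamiltonian cycle 0, 1, 2, 5, 3, 4.
  pos := ![0, 1, 2, 4, 5, 3]
  page e := e.1 = (0, 3) ∨ e.1 = (1, 3) ∨ e.1 = (1, 5)
  pos_injective := by decide
  src_ne_tgt := by decide
  simple := by decide
  noncrossing := by decide

theorem octahedron_isPlanar : octahedron.IsPlanar := by
  refine (octahedronLayout.map Nat.castOrderEmbedding).toArcFamily.isPlanar octahedron id
    Function.injective_id fun u v h => ?_
  rcases lt_or_gt_of_ne h.ne with h' | h'
  · exact ⟨⟨(u, v), h', h⟩, rfl⟩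
  · exact ⟨⟨(v, u), h', h.symm⟩, Sym2.eq_swap⟩

theorem octahedron_isFourRegular : octahedron.IsFourRegular := by
  intro v
  rw [Set.ncard_eq_toFinset_card']
  revert v
  decide

theorem octahedron_connected : octahedron.Connected := by
  rw [SimpleGraph.connected_iff]
  refine ⟨fun u v => ?_, inferInstance⟩
  have h : ∀ u v : Fin 6, ∃ w, (u = w ∨ octahedron.Adj u w) ∧ octahedron.Adj w v := by decide
  obtain ⟨w, rfl | hw, hv⟩ := h u v
  · exact hv.reachable
  · exact hw.reachable.trans hv.reachable

theorem octLoop_admissible : octLoop.Admissible where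
  finite := inferInstanceAs (Finite (Fin 6))
  connected := octahedron_connected
  regular := octahedron_isFourRegular
  planar := octahedron_isPlanar
  adj := by change octahedron.Adj 0 1; decide

/-! ### Attachments and loop pieces of growing size -/

/-- The position of end `t` of pair `p` if the pairs `0` and `1` are interlaced and the others
follow one after the other. -/
def chainPos (p t : ℕ) : ℕ :=
  if p = 0 then (if t < 2 then t else t + 2)
  else if p = 1 then (if t < 2 then t + 2 else t + 4) else 4 * p + t

/-- Two interlaced pairs of gadgets, followed by `n` further pairs. -/
def chainAttachment (n : ℕ) : Attachment (n + 2) where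
  pos x := ⟨chainPos x.1 x.2, by
    have h1 := x.1.2
    have h2 := x.2.2
    unfold chainPos
    split_ifs <;> omega⟩
  bijective := by
    rw [Fintype.bijective_iff_injective_and_card]
    constructor
    · rintro ⟨p, t⟩ ⟨p', t'⟩ h
      have h1 := t.2
      have h2 := t'.2
      simp only [Fin.mk.injEq, chainPos] at h
      rw [Prod.mk.injEq, Fin.ext_iff, Fin.ext_iff]
      split_ifs at h <;> omega
    · simp [mul_comm]
  nested p t t' h := by
    have : (t : ℕ) < t' := h
    simp only [Fin.mk_lt_mk, chainPos]
    split_ifs <;> omega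
  noncrossing := by
    -- Only the pairs 0 and 1 interleave, so giving pair 0 a side of its own suffices.
    refine ⟨fun p _ => decide ((p : ℕ) = 0), fun p t p' t' h => ?_⟩
    rw [decide_eq_decide] at h
    have hs : ∀ t : Fin 2, (slot t 0 : ℕ) = t ∧ (slot t 1 : ℕ) = 3 - t := by decide
    have h1 := t.2
    have h2 := t'.2
    simp only [Fin.mk_lt_mk, chainPos, (hs _).1, (hs _).2]
    split_ifs <;> omega
  interlaced := by
    refine ⟨0, 1, ?_, ?_, ?_⟩ <;> rw [Fin.mk_lt_mk] <;> simp [chainPos]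

/-- The vertices of an augmented octahedron with `k` pairs on each edge and equal
loop-subgraphs. -/
def augVertexEquiv (k : ℕ) (P : LoopPiece) : AugVertex (fun _ => k) (fun _ _ _ _ => P) ≃
    Fin 6 ⊕ OctEdge × (Fin (4 * k) ⊕ Fin k × Fin 2 × (Unit ⊕ Fin 2 × (Unit ⊕ P.V))) where
  toFun
    | .oct v => .inl v
    | .path e i => .inr (e, .inl i)
    | .hub e p t => .inr (e, .inr (p, t, .inl ()))
    | .root e p t s => .inr (e, .inr (p, t, .inr (s, .inl ())))
    | .loop e p t s x => .inr (e, .inr (p, t, .inr (s, .inr x)))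
  invFun
    | .inl v => .oct v
    | .inr (e, .inl i) => .path e i
    | .inr (e, .inr (p, t, .inl ())) => .hub e p t
    | .inr (e, .inr (p, t, .inr (s, .inl ()))) => .root e p t s
    | .inr (e, .inr (p, t, .inr (s, .inr x))) => .loop e p t s x
  left_inv v := by cases v <;> rfl
  right_inv v := by rcases v with v | ⟨e, i | ⟨p, t, _ | ⟨s, _ | x⟩⟩⟩ <;> rfl

/-- The order grows with `k` and, for positive `k`, with the size of the piece. It is the only
invariant needed to separate the members of both families. -/
theorem card_augVertex (k : ℕ) (P : LoopPiece) [Finite P.V] :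
    Nat.card (AugVertex (fun _ => k) (fun _ _ _ _ => P)) =
      6 + 12 * (4 * k + k * (2 * (1 + 2 * (1 + Nat.card P.V)))) := by
  have h : Nat.card OctEdge = 12 := by
    rw [Nat.card_eq_fintype_card]; decide
  rw [Nat.card_congr (augVertexEquiv k P)]
  simp only [Nat.card_sum, Nat.card_prod, h, Nat.card_eq_fintype_card, Fintype.card_fin,
    Fintype.card_unit]

/-- The augmented octahedron with octahedral loop-subgraphs and `n + 2` pairs on each edge, with a
marked edge. -/
def augLoop (n : ℕ) : LoopPiece where
  V := AugVertex (fun _ => n + 2) (fun _ _ _ _ => octLoop)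
  graph := augGraph (fun _ => n + 2) (fun _ => chainAttachment n) (fun _ _ _ _ => octLoop)
  a := .root ⟨(0, 1), by decide⟩ 0 0 0
  b := .hub ⟨(0, 1), by decide⟩ 0 0

/-- The construction can be iterated: its outputs are connected, 4-regular and planar, hence again
usable as loop pieces, and their sizes are unbounded. -/
theorem augLoop_admissible (n : ℕ) : (augLoop n).Admissible where
  finite := augVertex_finite fun _ _ _ _ => octLoop_admissible
  connected := augGraph_connected fun _ _ _ _ => octLoop_admissible
  regular := augGraph_isFourRegular fun _ _ _ _ => octLoop_admissible
  planar := augGraph_isPlanar _ _ fun _ _ _ _ => octLoop_admissible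
  adj := adj_root_hub (A := fun _ => chainAttachment n) _ _ _ _

theorem card_augLoop (n : ℕ) : Nat.card (augLoop n).V =
    6 + 12 * (4 * (n + 2) + (n + 2) * (2 * (1 + 2 * (1 + 6)))) := by
  have : Finite octLoop.V := octLoop_admissible.finite
  have h : Nat.card octLoop.V = 6 := Nat.card_fin 6
  exact (card_augVertex (n + 2) octLoop).trans (by rw [h])

theorem theorem5 :
    -- every octahedron augmented by (at least two) pairs of gadgets on each edge, with arbitrary
    -- loop-subgraphs, is a counterexample
    (∀ (m : OctEdge → ℕ) (A : ∀ e, Attachment (m e))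
        (L : ∀ e, Fin (m e) → Fin 2 → Fin 2 → LoopPiece),
        (∀ e p t s, (L e p t s).Admissible) → IsCircleCounterexample (augGraph m A L)) ∧
    -- infinitely many of them arise with octahedral loop-subgraphs, from more and more pairs
    (∃ A : ∀ n : ℕ, Attachment (n + 2),
        (∀ n, IsCircleCounterexample
          (augGraph (fun _ => n + 2) (fun _ => A n) (fun _ _ _ _ => octLoop))) ∧
        Pairwise fun n n' => IsEmpty
          (augGraph (fun _ => n + 2) (fun _ => A n) (fun _ _ _ _ => octLoop) ≃g
            augGraph (fun _ => n' + 2) (fun _ => A n') (fun _ _ _ _ => octLoop))) ∧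
    -- infinitely many of them arise with two pairs on each edge, from other loop-subgraphs
    (∃ P : ℕ → LoopPiece, (∀ n, (P n).Admissible) ∧
        ∀ A : OctEdge → Attachment 2,
          (∀ n, IsCircleCounterexample (augGraph (fun _ => 2) A (fun _ _ _ _ => P n))) ∧
          Pairwise fun n n' => IsEmpty
            (augGraph (fun _ => 2) A (fun _ _ _ _ => P n) ≃g
              augGraph (fun _ => 2) A (fun _ _ _ _ => P n'))) := by
  refine ⟨fun m A L hL => augGraph_isCircleCounterexample hL,
    ⟨chainAttachment, fun n => augGraph_isCircleCounterexample fun _ _ _ _ => octLoop_admissible,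
      fun n n' hne => ⟨fun f => hne ?_⟩⟩,
    ⟨augLoop, augLoop_admissible, fun A =>
      ⟨fun n => augGraph_isCircleCounterexample fun _ _ _ _ => augLoop_admissible n,
        fun n n' hne => ⟨fun f => hne ?_⟩⟩⟩⟩
  · have h : Nat.card (augLoop n).V = Nat.card (augLoop n').V := Nat.card_congr f.toEquiv
    rw [card_augLoop, card_augLoop] at h
    omega
  · have := fun n => (augLoop_admissible n).finite
    have h := Nat.card_congr f.toEquiv
    rw [card_augVertex, card_augVertex, card_augLoop, card_augLoop] at h
    omega
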